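/- Let $G$ be a real Banach–Lie group with Lie algebra $\mathfrak g$ and exponential map $v\mapsto e^v$, let $\sigma$ be a smooth involutive automorphism of $G$ (i.e. $\sigma^2=\mathrm{id}$), let $K=\{g\in G:\sigma(g)=g\}$, $\mathfrak p=\{v\in\mathfrak g:\sigma_{*1}v=-v\}$, $M=G/K$, and let $q:G\to M$ be the quotient map. Write $\mu_g(q(h))=q(gh)$, $o=q(1)$, and identify $T_oM$ with $\mathfrak p$. Let $\|\cdot\|_{\mathfrak p}$ be an $\mathrm{Ad}_K$-invariant norm on $\mathfrak p$ inducing the topology of $\mathfrak p$, and give $M$ the tangent norm $\|(\mu_g)_{*o}v\|_{q(g)}=\|v\|_{\mathfrak p}$ ($g\in G$, $v\in\mathfrak p$). The exponential map of $M$ at $x=q(g)$ is $\exp_{x}((\mu_g)_{*o}v)=q(ge^v)$, $v\in\mathfrak p$. Assume that $M$ is connected and has semi-negative curvature, that is, for every $x\in M$ and $v\in T_xM$ the differential $(\exp_x)_{*v}$ is invertible and $\|(\exp_x)_{*v}(w)\|_{\exp_x(v)}\ge\|w\|_x$ for all $w\in T_xM$. Let $\mathfrak s\subset\mathfrak p$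 be a closed linear subspace. Then the following conditions are equivalent: 1. $[[v,w],s]\in\mathfrak s$ for all $v,w,s\in\mathfrak s$ ($\mathfrak s$ is a Lie triple system). 2. $\mathrm{ad}_s^2(\mathfrak s)\subset\mathfrak s$ for every $s\in\mathfrak s$. 3. For every $v\in\mathfrak s$, the operator $F(\mathrm{ad}\,v)=\frac{\sinh \mathrm{ad}\,v}{\mathrm{ad}\,v}=\sum_{n\ge0}\frac{(\mathrm{ad}\,v)^{2n}}{(2n+1)!}$ restricts to an isomorphism (a bounded linear bijection with bounded inverse) of $\mathfrak s$ onto $\mathfrak s$. 4. For all $v,w\in\mathfrak s$: if $\beta:\mathbb R\to\mathfrak p$ is a continuous lift of the geodesic $\alpha(t)=q(e^ve^{tw})$, i.e. $q(e^{\beta(t)})=\alpha(t)$ for all $t\in\mathbb R$, and $\beta(0)\in\mathfrak s$, then $\beta(t)\in\mathfrak s$ for all $t\in\mathbb R$. -/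

import Mathlib

open scoped Manifold ContDiff

noncomputable section

/-!
Symmetric Banach-Lie groups `(G, σ)`, the homogeneous space `M = G ⧸ K` with `K = G^σ`, its
tangent norm, and semi-negative curvature.  The group `G` is a real Banach-Lie group modelled on a
Banach space `E`; its Lie algebra is Mathlib's `GroupLieAlgebra 𝓘(ℝ, E) G`, the tangent space at
the identity with the bracket of left-invariant vector fields.
-/

namespace SymmetricLie

section LieGroup

variable {E : Type*} [NormedAddCommGroup E] [NormedSpace ℝ E]
  {G : Type*} [TopologicalSpace G] [ChartedSpace E G] [Group G]

/-- The exponential map of a Lie group: `lieExp v = γ 1`, where `γ` is the integral curve, starting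
at the identity and defined on all of `ℝ`, of the left-invariant vector field given by `v`.
On a Banach-Lie group `γ` exists and is unique, so that the choice is immaterial. -/
def lieExp (v : GroupLieAlgebra 𝓘(ℝ, E) G) : G :=
  Classical.epsilon fun g : G => ∃ γ : ℝ → G, γ 0 = 1 ∧
    IsMIntegralCurve γ (mulInvariantVectorField (I := 𝓘(ℝ, E)) v) ∧ γ 1 = g

/-- The adjoint action `Ad k`, the differential at `1` of `g ↦ k g k⁻¹`.  (The tangent space at
`k * 1 * k⁻¹ = 1` is read as the Lie algebra.) -/
def adjoint (k : G) : GroupLieAlgebra 𝓘(ℝ, E) G →L[ℝ] GroupLieAlgebra 𝓘(ℝ, E) G :=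
  mfderiv 𝓘(ℝ, E) 𝓘(ℝ, E) (fun g : G => k * g * k⁻¹) 1

/-- The left logarithmic velocity `c(0)⁻¹ c'(0)` of a curve in `G` at time `0`: the velocity at
time `0` of `t ↦ c(0)⁻¹ c(t)`, a curve that is at `1` at time `0`. -/
def leftVelocity (c : ℝ → G) : GroupLieAlgebra 𝓘(ℝ, E) G :=
  mfderiv 𝓘(ℝ, ℝ) 𝓘(ℝ, E) (fun t : ℝ => (c 0)⁻¹ * c t) 0 (1 : ℝ)

/-- `F(ad v) w`, where `F(z) = sinh z / z = ∑ z^(2n) / (2n+1)!` and `(ad v) x = ⁅v, x⁆`. -/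
def sinhAdDivAd (v w : GroupLieAlgebra 𝓘(ℝ, E) G) : GroupLieAlgebra 𝓘(ℝ, E) G :=
  ∑' n : ℕ, ((2 * n + 1).factorial : ℝ)⁻¹ • ((fun x => ⁅v, x⁆)^[2 * n] w)

end LieGroup

/-- An involutive automorphism of the Banach-Lie group `G`; the pair `(G, σ)` is a symmetric
Banach-Lie group. -/
structure Involution (E : Type*) [NormedAddCommGroup E] [NormedSpace ℝ E]
    (G : Type*) [TopologicalSpace G] [ChartedSpace E G] [Group G] where
  /-- the automorphism -/
  toHom : G →* G
  smooth : ContMDiff 𝓘(ℝ, E) 𝓘(ℝ, E) ∞ toHom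
  involutive : Function.Involutive toHom

namespace Involution

variable {E : Type*} [NormedAddCommGroup E] [NormedSpace ℝ E]
  {G : Type*} [TopologicalSpace G] [ChartedSpace E G] [Group G] (σ : Involution E G)

/-- The subgroup `K = G^σ` of fixed points. -/
def K : Subgroup G where
  carrier := {g | σ.toHom g = g}
  one_mem' := map_one _
  mul_mem' := by
    intro a b ha hb
    simp only [Set.mem_ofPred_eq] at *
    rw [map_mul, ha, hb]
  inv_mem' := by
    intro a ha
    simp only [Set.mem_ofPred_eq] at *
    rw [map_inv, ha]

/-- The differential of `σ` at the identity (the tangent space at `σ 1 = 1` is read as the Lie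
algebra). -/
def diff : GroupLieAlgebra 𝓘(ℝ, E) G →L[ℝ] GroupLieAlgebra 𝓘(ℝ, E) G :=
  mfderiv 𝓘(ℝ, E) 𝓘(ℝ, E) σ.toHom 1

/-- The subspace `𝔭`, the eigenspace of the differential of `σ` for the eigenvalue `-1`. -/
def p : Submodule ℝ (GroupLieAlgebra 𝓘(ℝ, E) G) where
  carrier := {v | σ.diff v = -v}
  zero_mem' := by simp
  add_mem' := by
    intro a b ha hb
    simp only [Set.mem_ofPred_eq] at *
    rw [map_add, ha, hb]
    abel
  smul_mem' := by
    intro c a ha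
    simp only [Set.mem_ofPred_eq] at *
    rw [map_smul, ha, smul_neg]

theorem mem_p {v : GroupLieAlgebra 𝓘(ℝ, E) G} : v ∈ σ.p ↔ σ.diff v = -v := Iff.rfl

theorem diff_diff (v : GroupLieAlgebra 𝓘(ℝ, E) G) : σ.diff (σ.diff v) = v := by
  have h1 : MDifferentiableAt 𝓘(ℝ, E) 𝓘(ℝ, E) σ.toHom (1 : G) :=
    (σ.smooth.mdifferentiable (by simp)) 1
  have h2 : MDifferentiableAt 𝓘(ℝ, E) 𝓘(ℝ, E) σ.toHom (σ.toHom 1) :=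
    (σ.smooth.mdifferentiable (by simp)) _
  have hc : (σ.toHom ∘ σ.toHom : G → G) = id := by
    funext g
    exact σ.involutive g
  have h := mfderiv_comp (1 : G) h2 h1
  rw [hc, mfderiv_id] at h
  have h3 := DFunLike.congr_fun h v
  have h4 : ∀ x : G, x = 1 → ∀ y : E,
      (show E from (show E →L[ℝ] E from mfderiv 𝓘(ℝ, E) 𝓘(ℝ, E) σ.toHom x) y) =
        (show E from σ.diff y) := by
    rintro x rfl y
    rfl
  exact (h4 (σ.toHom 1) (map_one _) (σ.diff v)).symm.trans h3.symm

/-- The projection `v ↦ (v - σ_* v) / 2` of the Lie algebra onto `𝔭` along the Lie algebra `𝔨` of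
`K`, the fixed space of `σ_*`.  It is the differential at `1` of `q : G → G ⧸ K`, under the
identification of the tangent space of `G ⧸ K` at `o = q 1` with `𝔭`. -/
def projP (v : GroupLieAlgebra 𝓘(ℝ, E) G) : σ.p :=
  ⟨(2 : ℝ)⁻¹ • (v - σ.diff v), by
    rw [mem_p, map_smul, map_sub, diff_diff, ← smul_neg, neg_sub]⟩

/-- The velocity at time `0` of the curve `t ↦ q (c t)` in `M = G ⧸ K`, for a differentiable curve
`c` in `G`.  Tangent vectors at `q g` are written `(μ_g)_{*o} u` with `u ∈ 𝔭`, where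
`μ_g (q h) = q (g h)`, and the value is the vector `u` for `g = c 0`. -/
def velocity (c : ℝ → G) : σ.p := σ.projP (leftVelocity c)

/-- The differential at `v ∈ 𝔭` in the direction `w ∈ 𝔭` of the exponential map of `M = G ⧸ K` at
`q g`, which is `v ↦ q (g e^v)`.  Its value, a tangent vector of `M` at `q (g e^v)`, is expressed
in `𝔭` through `(μ_{g e^v})_{*o}`. -/
def expDifferential (g : G) (v w : σ.p) : σ.p :=
  σ.velocity fun t : ℝ => g * lieExp (v + t • w : GroupLieAlgebra 𝓘(ℝ, E) G)

/-- `N` is a norm on `𝔭` that induces the topology of `𝔭` and is invariant under `Ad k` for every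
`k ∈ K`.  Such a norm makes `M = G ⧸ K` a Finsler manifold by `‖(μ_g)_{*o} v‖ = N v` at the point
`q g`. -/
structure IsInvariantNorm (N : Seminorm ℝ σ.p) : Prop where
  eq_zero : ∀ v, N v = 0 → v = 0
  compatible : WithSeminorms fun _ : Unit => N
  invariant : ∀ k ∈ σ.K, ∀ v w : σ.p,
    (w : GroupLieAlgebra 𝓘(ℝ, E) G) = adjoint k (v : GroupLieAlgebra 𝓘(ℝ, E) G) → N w = N v

/-- Semi-negative curvature of the Finsler manifold `M = G ⧸ K` with the tangent norm given by `N`: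
at each point `x = q g`, the differential of the exponential map `exp_x` at each `v` is invertible
and does not decrease the norm of any tangent vector. -/
def SemiNegativeCurvature (N : Seminorm ℝ σ.p) : Prop :=
  ∀ (g : G) (v : σ.p),
    (∃ e : σ.p ≃L[ℝ] σ.p, ∀ w, e w = σ.expDifferential g v w) ∧
    ∀ w : σ.p, N w ≤ N (σ.expDifferential g v w)

end Involution

end SymmetricLie

end

open scoped Manifold ContDiff

set_option linter.unusedSectionVars false

/-! ### Power series in a bounded operator: `exp T`, `(exp T - 1) / T` and `sinh T / T`. -/

namespace OpSeries

open NormedSpace Filter Topology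

section

variable {V : Type*} [NormedAddCommGroup V] [NormedSpace ℝ V]

/-! The differential of `exp_x` at `v`, written in `𝔭`, is `F(ad v)` (`expDifferential_eq`): the
exponential of `G` has left logarithmic differential `(1 - e^{-ad v}) / ad v`, and its `𝔭`-part is
`sinh (ad v) / ad v`. Semi-negative curvature thus says that every `F(ad v)`, `v ∈ 𝔭`, is invertible
on `𝔭` and does not decrease `N`. In particular all these operators are bounded below by one
constant. This is all that is used of the curvature (`IsExpanding`).

1 ⇔ 2 is polarization together with the Jacobi identity. For 2 ⇒ 3, the restrictions of `F(t ad v)`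
to `s` form a continuous path of operators, uniformly bounded below and starting at the identity, so
they stay invertible. For 3 ⇒ 2, solve `F(t ad v) y_t = w` in `s`: then `(w - y_t) / t²` tends to
`(ad v)² w / 6`, and `s` is closed.

For condition 4, the map `q(g) ↦ g σ(g)⁻¹` embeds `M` in `G` and turns the lifting equation into
`e^{2β(t)} = e^v e^{2tw} e^v`. Differentiating yields the equation `F(ad β) β' = proj (e^{ad β}
e^{-ad v} w)` (`hasDerivAt_lift`), whose right-hand side has norm `N w` by `Ad_K`-invariance. Hence
`N β' ≤ N w`, so lifts neither blow up nor stop, and every geodesic has a lift defined on all of `ℝ`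
(`exists_lift`).

4 ⇒ 2: the lift starting at `v ∈ s` has initial velocity `y` with `F(ad v) y = w`. By 4 this `y`
lies in `s`, so `F(ad v)` maps `s` onto `s`, which is what the argument for 3 ⇒ 2 needs. 1 ⇒ 4: at a
point `z ∈ s` the right-hand side of the equation lies in `s` (`proj_exp_exp_mem`), and `F(ad z)` is
invertible on `s` by 2 ⇒ 3, so the velocity prescribed at `z` lies in `s`. As it is locally
Lipschitz in the point, Grönwall's inequality in `𝔭 / s` keeps the lift in `s`. -/

theorem norm_pow_le (T : V →L[ℝ] V) (n : ℕ) : ‖T ^ n‖ ≤ ‖T‖ ^ n := by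
  induction n with
  | zero =>
    rw [pow_zero, pow_zero]
    exact ContinuousLinearMap.norm_id_le
  | succ n ih =>
    rw [pow_succ, pow_succ]
    exact (norm_mul_le _ _).trans (by gcongr)

theorem norm_pow_sub_pow_le {S T : V →L[ℝ] V} {R : ℝ} (hS : ‖S‖ ≤ R) (hT : ‖T‖ ≤ R) (n : ℕ) :
    ‖S ^ n - T ^ n‖ ≤ n * R ^ (n - 1) * ‖S - T‖ := by
  have hR : 0 ≤ R := (norm_nonneg S).trans hS
  induction n with
  | zero => simp
  | succ n ih =>
    have h1 : S ^ (n + 1) - T ^ (n + 1) = S ^ n * (S - T) + (S ^ n - T ^ n) * T := by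
      simp only [pow_succ]; noncomm_ring
    have h2 : ‖S ^ n * (S - T)‖ ≤ R ^ n * ‖S - T‖ :=
      (norm_mul_le _ _).trans (by gcongr; exact (norm_pow_le S n).trans (by gcongr))
    have h3 : ‖(S ^ n - T ^ n) * T‖ ≤ n * R ^ (n - 1) * ‖S - T‖ * R :=
      (norm_mul_le _ _).trans (by gcongr)
    have h4 : (n : ℝ) * R ^ (n - 1) * R = n * R ^ n := by
      cases n with
      | zero => simp
      | succ m => simp [pow_succ]; ring
    rw [h1]
    refine (norm_add_le _ _).trans ((add_le_add h2 h3).trans (le_of_eq ?_))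
    simp only [Nat.add_sub_cancel]
    push_cast
    linear_combination ‖S - T‖ * h4

/-- The power series `∑ c n T ^ n` in an operator `T`. -/
noncomputable def opSeries (c : ℕ → ℝ) (T : V →L[ℝ] V) : V →L[ℝ] V := ∑' n, c n • T ^ n

/-- The coefficients of a power series are dominated by those of the exponential series. -/
def ExpBounded (c : ℕ → ℝ) : Prop := ∀ n, |c n| ≤ ((n.factorial : ℝ))⁻¹

variable {c : ℕ → ℝ}

theorem ExpBounded.norm_smul_pow_le (hc : ExpBounded c) (T : V →L[ℝ] V) (n : ℕ) :
    ‖c n • T ^ n‖ ≤ ‖T‖ ^ n / n.factorial := by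
  rw [norm_smul, Real.norm_eq_abs, div_eq_inv_mul]
  exact mul_le_mul (hc n) (norm_pow_le T n) (norm_nonneg _) (by positivity)

theorem opSeries_zero (c : ℕ → ℝ) : opSeries c (0 : V →L[ℝ] V) = c 0 • 1 := by
  rw [opSeries, tsum_eq_single 0 (fun n hn => by simp [zero_pow hn])]
  simp

theorem expBounded_exp : ExpBounded fun n => ((n.factorial : ℝ))⁻¹ := fun n => by
  rw [abs_of_nonneg (by positivity)]

theorem exp_eq_opSeries (T : V →L[ℝ] V) :
    exp T = opSeries (fun n => ((n.factorial : ℝ))⁻¹) T :=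
  congrFun (exp_eq_tsum ℝ) T

variable [CompleteSpace V]

theorem ExpBounded.summable (hc : ExpBounded c) (T : V →L[ℝ] V) :
    Summable fun n => c n • T ^ n :=
  Summable.of_norm_bounded (Real.summable_pow_div_factorial ‖T‖) (hc.norm_smul_pow_le T)

theorem ExpBounded.hasSum (hc : ExpBounded c) (T : V →L[ℝ] V) :
    HasSum (fun n => c n • T ^ n) (opSeries c T) :=
  (hc.summable T).hasSum

theorem ExpBounded.hasSum_apply (hc : ExpBounded c) (T : V →L[ℝ] V) (x : V) :
    HasSum (fun n => c n • (T ^ n) x) (opSeries c T x) :=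
  (hc.hasSum T).mapL (ContinuousLinearMap.apply ℝ V x)

/-- Summing the termwise bound `n R^(n-1) ‖S - T‖ / n!` gives a Lipschitz constant on each ball.
Using `|R|` avoids a sign hypothesis on `R`. -/
theorem ExpBounded.exists_lipschitz (hc : ExpBounded c) (R : ℝ) :
    ∃ L, 0 ≤ L ∧ ∀ S T : V →L[ℝ] V, ‖S‖ ≤ R → ‖T‖ ≤ R →
      ‖opSeries c S - opSeries c T‖ ≤ L * ‖S - T‖ := by
  have hsum : Summable fun n : ℕ => ((n.factorial : ℝ))⁻¹ * (n * |R| ^ (n - 1)) := by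
    rw [← summable_nat_add_iff 1]
    refine (Real.summable_pow_div_factorial |R|).congr fun n => ?_
    rw [Nat.factorial_succ, Nat.add_sub_cancel]
    push_cast
    field_simp
  refine ⟨∑' n : ℕ, ((n.factorial : ℝ))⁻¹ * (n * |R| ^ (n - 1)), tsum_nonneg fun n => by positivity,
    fun S T hS hT => ?_⟩
  have h1 := (hc.hasSum S).sub (hc.hasSum T)
  rw [← h1.tsum_eq, ← tsum_mul_right]
  refine tsum_of_norm_bounded (hsum.mul_right _).hasSum fun n => ?_
  rw [← smul_sub, norm_smul, Real.norm_eq_abs, mul_assoc]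
  exact mul_le_mul (hc n) (norm_pow_sub_pow_le (hS.trans (le_abs_self R))
    (hT.trans (le_abs_self R)) n) (norm_nonneg _) (by positivity)

theorem ExpBounded.continuous (hc : ExpBounded c) :
    Continuous (opSeries c : (V →L[ℝ] V) → V →L[ℝ] V) := by
  rw [continuous_iff_continuousAt]
  intro T
  obtain ⟨L, -, h⟩ := hc.exists_lipschitz (V := V) (‖T‖ + 1)
  refine continuousAt_of_locally_lipschitz zero_lt_one L fun S hS => ?_
  rw [dist_eq_norm, dist_eq_norm]
  rw [dist_eq_norm] at hS
  refine h S T ?_ (by linarith)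
  have := norm_add_le T (S - T)
  rw [add_sub_cancel] at this
  linarith

theorem ExpBounded.apply_mem (hc : ExpBounded c) {T : V →L[ℝ] V} {s : Submodule ℝ V}
    (hs : IsClosed (s : Set V)) (hT : ∀ x ∈ s, T x ∈ s) {x : V} (hx : x ∈ s) :
    opSeries c T x ∈ s := by
  have hp : ∀ n : ℕ, (T ^ n) x ∈ s := by
    intro n
    induction n with
    | zero => simpa using hx
    | succ n ih => rw [pow_succ']; exact hT _ ih
  refine hs.mem_of_tendsto (hc.hasSum_apply T x) (Eventually.of_forall fun t => ?_)
  exact s.sum_mem fun n _ => s.smul_mem _ (hp n)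

/-- The operator `∑ T ^ n / (n + 1)!`, that is, `(exp T - 1) / T`. -/
noncomputable def theta (T : V →L[ℝ] V) : V →L[ℝ] V :=
  opSeries (fun n => (((n + 1).factorial : ℝ))⁻¹) T

/-- The operator `∑ T ^ (2 n) / (2 n + 1)!`, that is, `sinh T / T`. -/
noncomputable def sinhc (T : V →L[ℝ] V) : V →L[ℝ] V :=
  opSeries (fun n => (((2 * n + 1).factorial : ℝ))⁻¹) (T * T)

/-- The operator `∑ T ^ (2 n) / (2 n + 3)!`, that is, `(sinh T - T) / T ^ 3`. -/
noncomputable def sinhcRem (T : V →L[ℝ] V) : V →L[ℝ] V :=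
  opSeries (fun n => (((2 * n + 3).factorial : ℝ))⁻¹) (T * T)

theorem expBounded_inv_factorial {f : ℕ → ℕ} (hf : ∀ n, n ≤ f n) :
    ExpBounded fun n => (((f n).factorial : ℝ))⁻¹ := fun n => by
  rw [abs_of_nonneg (by positivity)]
  exact inv_anti₀ (by positivity) (mod_cast Nat.factorial_le (hf n))

theorem expBounded_theta : ExpBounded fun n => (((n + 1).factorial : ℝ))⁻¹ :=
  expBounded_inv_factorial (f := fun n => n + 1) fun n => by lia

theorem expBounded_sinhc : ExpBounded fun n => (((2 * n + 1).factorial : ℝ))⁻¹ :=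
  expBounded_inv_factorial (f := fun n => 2 * n + 1) fun n => by lia

theorem expBounded_sinhcRem : ExpBounded fun n => (((2 * n + 3).factorial : ℝ))⁻¹ :=
  expBounded_inv_factorial (f := fun n => 2 * n + 3) fun n => by lia

theorem continuous_exp : Continuous (exp : (V →L[ℝ] V) → V →L[ℝ] V) := by
  rw [show (exp : (V →L[ℝ] V) → V →L[ℝ] V) = _ from funext exp_eq_opSeries]
  exact expBounded_exp.continuous

theorem continuous_theta : Continuous (theta : (V →L[ℝ] V) → V →L[ℝ] V) :=
  expBounded_theta.continuous

theorem continuous_sinhc : Continuous (sinhc : (V →L[ℝ] V) → V →L[ℝ] V) :=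
  expBounded_sinhc.continuous.comp (continuous_id.mul continuous_id)

theorem continuous_sinhcRem : Continuous (sinhcRem : (V →L[ℝ] V) → V →L[ℝ] V) :=
  expBounded_sinhcRem.continuous.comp (continuous_id.mul continuous_id)

theorem sinhc_zero : sinhc (0 : V →L[ℝ] V) = 1 := by simp [sinhc, opSeries_zero]

theorem sinhcRem_zero : sinhcRem (0 : V →L[ℝ] V) = (6 : ℝ)⁻¹ • 1 := by
  simp [sinhcRem, opSeries_zero, Nat.factorial]
  norm_num

/-- Taylor's formula with remainder: along `t • T` it isolates the term `t² T² / 6`, from which `(ad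
v)²` is recovered in 3 ⇒ 2. -/
theorem sinhc_eq (T : V →L[ℝ] V) : sinhc T = 1 + T * T * sinhcRem T := by
  have h1 := (expBounded_sinhcRem.hasSum (T * T)).mul_left (T * T)
  have h2 : HasSum (fun n : ℕ => (((2 * (n + 1) + 1).factorial : ℝ))⁻¹ • (T * T) ^ (n + 1))
      (T * T * sinhcRem T) := by
    convert! h1 using 2 with n
    rw [mul_smul_comm, ← pow_succ']
    rfl
  have h3 := (hasSum_nat_add_iff (f := fun n : ℕ =>
    (((2 * n + 1).factorial : ℝ))⁻¹ • (T * T) ^ n) 1).1 h2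
  have h4 := (expBounded_sinhc.hasSum (T * T)).unique h3
  rw [sinhc, h4, add_comm]
  simp

theorem exists_lipschitz_exp (R : ℝ) : ∃ L, 0 ≤ L ∧ ∀ S T : V →L[ℝ] V, ‖S‖ ≤ R → ‖T‖ ≤ R →
    ‖exp S - exp T‖ ≤ L * ‖S - T‖ := by
  simpa only [exp_eq_opSeries] using expBounded_exp.exists_lipschitz (V := V) R

theorem exists_lipschitz_sinhc (R : ℝ) : ∃ L, 0 ≤ L ∧ ∀ S T : V →L[ℝ] V, ‖S‖ ≤ R → ‖T‖ ≤ R →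
    ‖sinhc S - sinhc T‖ ≤ L * ‖S - T‖ := by
  obtain ⟨L, hL, h⟩ := expBounded_sinhc.exists_lipschitz (V := V) (|R| * |R|)
  refine ⟨L * (2 * |R|), by positivity, fun S T hS hT => ?_⟩
  replace hS := hS.trans (le_abs_self R)
  replace hT := hT.trans (le_abs_self R)
  have h1 : ∀ A : V →L[ℝ] V, ‖A‖ ≤ |R| → ‖A * A‖ ≤ |R| * |R| := fun A hA =>
    (norm_mul_le _ _).trans (by gcongr)
  refine (h _ _ (h1 S hS) (h1 T hT)).trans ?_
  rw [mul_assoc]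
  gcongr
  have h2 := norm_pow_sub_pow_le hS hT 2
  simpa [sq] using h2

theorem exp_apply_mem {T : V →L[ℝ] V} {s : Submodule ℝ V} (hs : IsClosed (s : Set V))
    (hT : ∀ x ∈ s, T x ∈ s) {x : V} (hx : x ∈ s) : exp T x ∈ s := by
  rw [exp_eq_opSeries]
  exact expBounded_exp.apply_mem hs hT hx

theorem sinhc_apply_mem {T : V →L[ℝ] V} {s : Submodule ℝ V} (hs : IsClosed (s : Set V))
    (hT : ∀ x ∈ s, T (T x) ∈ s) {x : V} (hx : x ∈ s) : sinhc T x ∈ s :=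
  expBounded_sinhc.apply_mem hs hT hx

theorem hasDerivAt_exp_smul (T : V →L[ℝ] V) (t : ℝ) :
    HasDerivAt (fun u : ℝ => exp (u • T)) (T * exp (t • T)) t :=
  hasDerivAt_exp_smul_const' T t

theorem exp_add_smul (T : V →L[ℝ] V) (a b : ℝ) :
    exp ((a + b) • T) = exp (a • T) * exp (b • T) := by
  let _ : NormedAlgebra ℚ (V →L[ℝ] V) := NormedAlgebra.restrictScalars ℚ ℝ _
  rw [add_smul]
  exact exp_add_of_commute ((Commute.refl T).smul_left a |>.smul_right b)

theorem exp_mul_exp_neg (T : V →L[ℝ] V) : exp T * exp (-T) = 1 := by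
  have := exp_add_smul T 1 (-1)
  simp [exp_zero] at this
  exact this.symm

theorem exp_neg_mul_exp (T : V →L[ℝ] V) : exp (-T) * exp T = 1 := by
  simpa using exp_mul_exp_neg (-T)

/-- Termwise integration of the exponential series, dominated by `‖T‖ⁿ / n!`. In this form `theta`
arises as the integral of a left logarithmic derivative, and its identities become substitutions. -/
theorem theta_eq_integral (T : V →L[ℝ] V) : theta T = ∫ s in (0 : ℝ)..1, exp (s • T) := by
  have hT : ∀ s : ℝ, HasSum (fun n : ℕ => ((n.factorial : ℝ))⁻¹ • (s • T) ^ n) (exp (s • T)) := by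
    intro s
    rw [exp_eq_opSeries]
    exact expBounded_exp.hasSum _
  have h := intervalIntegral.hasSum_integral_of_dominated_convergence
    (μ := MeasureTheory.volume) (a := 0) (b := 1)
    (F := fun (n : ℕ) (s : ℝ) => ((n.factorial : ℝ))⁻¹ • (s • T) ^ n)
    (f := fun s => exp (s • T))
    (fun n _ => ‖T‖ ^ n / n.factorial)
    (fun n => Continuous.aestronglyMeasurable (by fun_prop))
    (fun n => Eventually.of_forall fun s hs => by
      rw [Set.uIoc_of_le zero_le_one] at hs
      refine (expBounded_exp.norm_smul_pow_le _ n).trans ?_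
      gcongr
      rw [norm_smul, Real.norm_eq_abs, abs_of_pos hs.1]
      exact mul_le_of_le_one_left (norm_nonneg _) hs.2)
    (Eventually.of_forall fun s _ => Real.summable_pow_div_factorial ‖T‖)
    (by simp)
    (Eventually.of_forall fun s _ => hT s)
  refine (expBounded_theta.hasSum T).unique ?_
  convert! h using 2 with n
  simp only [smul_pow]
  rw [intervalIntegral.integral_smul, intervalIntegral.integral_smul_const, integral_pow, smul_smul]
  congr 1
  rw [Nat.factorial_succ]
  push_cast
  have : (n.factorial : ℝ) ≠ 0 := by positivity
  field_simp
  simp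

theorem theta_add_theta_neg (T : V →L[ℝ] V) : theta T + theta (-T) = (2 : ℝ) • sinhc T := by
  have h1 := (expBounded_theta.hasSum T).add (expBounded_theta.hasSum (-T))
  have h2 := (expBounded_sinhc.hasSum (T * T)).const_smul (2 : ℝ)
  have hinj : Function.Injective fun n : ℕ => 2 * n := fun a b h => by simpa using h
  refine h1.unique ((hinj.hasSum_iff ?_).1 ?_)
  · intro n hn
    have : Odd n := by
      rw [← Nat.not_even_iff_odd]
      rintro ⟨k, hk⟩
      exact hn ⟨k, by simp only; lia⟩
    rw [this.neg_pow, smul_neg, add_neg_cancel]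
  · convert! h2 using 2 with n
    have : Even (2 * n) := even_two_mul n
    simp only [Function.comp_apply]
    rw [this.neg_pow, ← two_smul ℝ, pow_mul, sq]

/-- Moving `e^{-T}` under the integral gives `∫₀¹ e^{(2s-1)T} ds`, half the integral of `e^{sT}`
over the symmetric interval `[-1, 1]`, in which the odd powers cancel. This is why centring `e^{2x}`
by `e^{-a}` on both sides produces `sinhc`. -/
theorem exp_neg_mul_theta_two (T : V →L[ℝ] V) : exp (-T) * theta ((2 : ℝ) • T) = sinhc T := by
  have hcont : Continuous fun s : ℝ => exp (s • T) :=
    continuous_exp.comp (continuous_id.smul continuous_const)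
  have hi : ∀ a b : ℝ, IntervalIntegrable (fun s : ℝ => exp (s • T)) MeasureTheory.volume a b :=
    fun a b => hcont.intervalIntegrable a b
  have h1 : exp (-T) * theta ((2 : ℝ) • T) = ∫ s in (0 : ℝ)..1, exp ((2 * s - 1) • T) := by
    have hi' := (hcont.comp (continuous_id.mul continuous_const)).intervalIntegrable
      (μ := MeasureTheory.volume) (u := fun s : ℝ => exp ((s * 2) • T)) 0 1
    have := ((ContinuousLinearMap.mul ℝ (V →L[ℝ] V)) (exp (-T))).intervalIntegral_comp_comm hi'
    simp only [theta_eq_integral, smul_smul]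
    refine (Eq.trans ?_ this.symm).trans ?_
    · rfl
    congr 1
    ext1 s
    rw [ContinuousLinearMap.mul_apply', ← neg_one_smul ℝ T, ← exp_add_smul]
    congr 2
    ring
  have h2 : (∫ s in (0 : ℝ)..1, exp ((2 * s - 1) • T)) =
      (2 : ℝ)⁻¹ • ∫ s in (-1 : ℝ)..1, exp (s • T) := by
    rw [intervalIntegral.integral_comp_mul_sub (fun s => exp (s • T)) two_ne_zero]
    norm_num
  have h3 : (∫ s in (-1 : ℝ)..0, exp (s • T)) = theta (-T) := by
    rw [theta_eq_integral]
    have := intervalIntegral.integral_comp_neg (a := 0) (b := 1) (fun s : ℝ => exp (s • T))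
    rw [neg_zero] at this
    rw [← this]
    simp only [smul_neg, neg_smul]
  rw [h1, h2, ← intervalIntegral.integral_add_adjacent_intervals (hi (-1) 0) (hi 0 1), h3,
    ← theta_eq_integral, add_comm, theta_add_theta_neg, smul_smul]
  norm_num

theorem sinhc_neg (T : V →L[ℝ] V) : sinhc (-T) = sinhc T := by simp [sinhc]

theorem theta_zero : theta (0 : V →L[ℝ] V) = 1 := by simp [theta, opSeries_zero]

/-- Evenness of `sinhc`, applied to the previous identity at `± T / 2`, gives `e^{-T/2} θ(T) =
e^{T/2} θ(-T)`. -/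
theorem exp_neg_mul_theta (T : V →L[ℝ] V) : exp (-T) * theta T = theta (-T) := by
  have h1 : (2 : ℝ) • ((2 : ℝ)⁻¹ • T) = T := by rw [smul_smul]; norm_num
  have h2 := exp_neg_mul_theta_two ((2 : ℝ)⁻¹ • T)
  have h3 := exp_neg_mul_theta_two (-((2 : ℝ)⁻¹ • T))
  rw [smul_neg, neg_neg, sinhc_neg, h1, ← h2, h1] at h3
  have h4 : exp (-T) = exp (-((2 : ℝ)⁻¹ • T)) * exp (-((2 : ℝ)⁻¹ • T)) := by
    simp only [← neg_smul, ← exp_add_smul]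
    congr 1
    rw [← neg_one_smul ℝ T]
    congr 1
    norm_num
  rw [h4, mul_assoc, ← h3, ← mul_assoc, exp_neg_mul_exp, one_mul]

theorem ExpBounded.intertwine (hc : ExpBounded c) {S T D : V →L[ℝ] V} (h : D * S = T * D) (x : V) :
    D (opSeries c S x) = opSeries c T (D x) := by
  have h1 := (hc.hasSum_apply S x).mapL D
  refine h1.unique ((hc.hasSum_apply T (D x)).congr_fun fun n => ?_)
  have h2 : SemiconjBy D S T := h
  have h3 := congrArg (fun A : V →L[ℝ] V => A x) (h2.pow_right n).eq
  simp only [mul_apply_eq_comp] at h3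
  rw [map_smul, h3]

/-- Provides the explicit primitive to which `exists_evolution_estimate` compares the curve
`e^{s(v+w)} e^{-sv}`. -/
theorem exists_hasDerivAt_exp_smul_theta (T : V →L[ℝ] V) : ∃ b : ℝ → V →L[ℝ] V,
    b 0 = 0 ∧ b 1 = theta T ∧ ∀ s, HasDerivAt b (exp (s • T)) s := by
  have hcont : Continuous fun s : ℝ => exp (s • T) :=
    continuous_exp.comp (continuous_id.smul continuous_const)
  refine ⟨fun s => ∫ r in (0 : ℝ)..s, exp (r • T), by simp, (theta_eq_integral T).symm, fun s => ?_⟩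
  exact intervalIntegral.integral_hasDerivAt_right (hcont.intervalIntegrable _ _)
    (hcont.stronglyMeasurableAtFilter _ _) hcont.continuousAt

end

end OpSeries

/-! ### Multiplication, inversion and conjugation in a chart at the identity. -/

noncomputable section

namespace SymmetricLie

open Filter Topology

section Chart

variable {E : Type*} [NormedAddCommGroup E] [NormedSpace ℝ E]
  {G : Type*} [TopologicalSpace G] [ChartedSpace E G] [Group G]

/-- The preferred chart at the identity. -/
def ch (g : G) : E := extChartAt 𝓘(ℝ, E) (1 : G) g

variable (G) in
/-- The image of the identity under the preferred chart. -/
def chOne : E := ch (1 : G)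

/-- The inverse of the preferred chart at the identity. -/
def chInv (x : E) : G := (extChartAt 𝓘(ℝ, E) (1 : G)).symm x

theorem chInv_chOne : (chInv (chOne G : E) : G) = 1 := extChartAt_to_inv (I := 𝓘(ℝ, E)) (1 : G)

theorem eventually_ch_chInv : ∀ᶠ x in 𝓝 (chOne G : E), ch (chInv x : G) = x := by
  filter_upwards [extChartAt_target_mem_nhds (I := 𝓘(ℝ, E)) (1 : G)] with x hx
  exact (extChartAt 𝓘(ℝ, E) (1 : G)).right_inv hx

theorem eventually_chInv_ch : ∀ᶠ g in 𝓝 (1 : G), chInv (ch g : E) = g := by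
  filter_upwards [extChartAt_source_mem_nhds (I := 𝓘(ℝ, E)) (1 : G)] with x hx
  exact (extChartAt 𝓘(ℝ, E) (1 : G)).left_inv hx

theorem eventually_continuousAt_ch : ∀ᶠ g in 𝓝 (1 : G), ContinuousAt (ch : G → E) g := by
  filter_upwards [extChartAt_source_mem_nhds (I := 𝓘(ℝ, E)) (1 : G)] with x hx
  exact continuousAt_extChartAt' hx

theorem continuousAt_ch : ContinuousAt (ch : G → E) 1 :=
  (eventually_continuousAt_ch (E := E)).self_of_nhds

theorem tendsto_ch : Tendsto (ch : G → E) (𝓝 1) (𝓝 (chOne G)) := continuousAt_ch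

theorem continuousAt_chInv : ContinuousAt (chInv : E → G) (chOne G) :=
  continuousAt_extChartAt_symm (I := 𝓘(ℝ, E)) (1 : G)

theorem tendsto_chInv : Tendsto (chInv : E → G) (𝓝 (chOne G)) (𝓝 1) := by
  simpa only [ContinuousAt, chInv_chOne] using continuousAt_chInv (E := E) (G := G)

/-- The multiplication in the chart. -/
def mulCh (G : Type*) [TopologicalSpace G] [ChartedSpace E G] [Group G] (p : E × E) : E :=
  ch (chInv p.1 * chInv p.2 : G)

theorem eventually_mulCh_left : ∀ᶠ x in 𝓝 (chOne G : E), mulCh G (x, chOne G) = x := by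
  filter_upwards [eventually_ch_chInv (E := E) (G := G)] with x hx
  simpa [mulCh, chInv_chOne] using hx

theorem eventually_mulCh_right : ∀ᶠ x in 𝓝 (chOne G : E), mulCh G (chOne G, x) = x := by
  filter_upwards [eventually_ch_chInv (E := E) (G := G)] with x hx
  simpa [mulCh, chInv_chOne] using hx

section Smooth

variable [LieGroup 𝓘(ℝ, E) ∞ G]

theorem contMDiffAt_ch : ContMDiffAt 𝓘(ℝ, E) 𝓘(ℝ, E) ∞ (ch : G → E) 1 := contMDiffAt_extChartAt

theorem contMDiffAt_chInv : ContMDiffAt 𝓘(ℝ, E) 𝓘(ℝ, E) ∞ (chInv : E → G) (chOne G) :=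
  (contMDiffOn_extChartAt_symm (1 : G)).contMDiffAt
    (extChartAt_target_mem_nhds (I := 𝓘(ℝ, E)) (1 : G))

variable {X : Type*} [NormedAddCommGroup X] [NormedSpace ℝ X]

theorem contDiffAt_ch_comp {f : X → G} {x : X} (hf : ContMDiffAt 𝓘(ℝ, X) 𝓘(ℝ, E) ∞ f x)
    (h : f x = 1) : ContDiffAt ℝ ∞ (fun y => (ch (f y) : E)) x := by
  rw [← contMDiffAt_iff_contDiffAt]
  exact ContMDiffAt.comp x (I' := 𝓘(ℝ, E)) (g := (ch : G → E)) (by rw [h]; exact contMDiffAt_ch) hf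

theorem contMDiffAt_chInv_comp {f : X → E} {x : X} (hf : ContDiffAt ℝ ∞ f x) (h : f x = chOne G) :
    ContMDiffAt 𝓘(ℝ, X) 𝓘(ℝ, E) ∞ (fun y => (chInv (f y) : G)) x :=
  ContMDiffAt.comp x (I' := 𝓘(ℝ, E)) (g := (chInv : E → G)) (by rw [h]; exact contMDiffAt_chInv)
    hf.contMDiffAt

/-- The differential at the identity of a map that fixes the identity, in the chart. -/
theorem hasStrictFDerivAt_ch_comp_chInv {f : G → G}
    (hf : ContMDiffAt 𝓘(ℝ, E) 𝓘(ℝ, E) ∞ f 1) (h : f 1 = 1) :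
    HasStrictFDerivAt (fun x : E => (ch (f (chInv x)) : E))
      (show E →L[ℝ] E from mfderiv 𝓘(ℝ, E) 𝓘(ℝ, E) f 1) (chOne G) := by
  have h1 : ContDiffAt ℝ ∞ (fun x : E => (ch (f (chInv x)) : E)) (chOne G) := by
    refine contDiffAt_ch_comp ?_ (by rw [chInv_chOne, h])
    exact ContMDiffAt.comp _ (I' := 𝓘(ℝ, E)) (g := f) (by rw [chInv_chOne]; exact hf)
      contMDiffAt_chInv
  have h2 := (hf.mdifferentiableAt (by simp)).hasMFDerivAt.2
  have h3 : writtenInExtChartAt 𝓘(ℝ, E) 𝓘(ℝ, E) 1 f = fun x : E => (ch (f (chInv x)) : E) := by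
    ext x
    simp only [writtenInExtChartAt, h]
    rfl
  rw [h3] at h2
  have h4 : HasFDerivAt (fun x : E => (ch (f (chInv x)) : E))
      (show E →L[ℝ] E from mfderiv 𝓘(ℝ, E) 𝓘(ℝ, E) f 1) (chOne G) := by
    rw [← hasFDerivWithinAt_univ]
    convert! h2 using 1
    simp
  have h5 := h1.hasStrictFDerivAt (by simp)
  rwa [h5.hasFDerivAt.unique h4] at h5

theorem contDiffAt_mulCh : ContDiffAt ℝ ∞ (mulCh G : E × E → E) (chOne G, chOne G) := by
  refine contDiffAt_ch_comp ?_ (by simp [chInv_chOne])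
  exact (contMDiffAt_chInv_comp contDiffAt_fst rfl).mul (contMDiffAt_chInv_comp contDiffAt_snd rfl)

/-- Multiplication is smooth in the chart, and restricting it to either axis through the identity
gives the identity map, which determines both partial derivatives. -/
theorem hasStrictFDerivAt_mulCh : HasStrictFDerivAt (mulCh G : E × E → E)
    (ContinuousLinearMap.fst ℝ E E + ContinuousLinearMap.snd ℝ E E) (chOne G, chOne G) := by
  have h := (contDiffAt_mulCh (E := E) (G := G)).hasStrictFDerivAt (by simp)
  convert! h using 1
  have hl : HasFDerivAt (fun x : E => mulCh G (x, chOne G)) (ContinuousLinearMap.id ℝ E) (chOne G) :=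
    (hasFDerivAt_id _).congr_of_eventuallyEq eventually_mulCh_left
  have hr : HasFDerivAt (fun x : E => mulCh G (chOne G, x)) (ContinuousLinearMap.id ℝ E) (chOne G) :=
    (hasFDerivAt_id _).congr_of_eventuallyEq eventually_mulCh_right
  have hl' := hl.unique (HasFDerivAt.comp (chOne G : E) (g := mulCh G)
    (f := fun x : E => (x, chOne G)) h.hasFDerivAt (hasFDerivAt_prodMk_left _ _))
  have hr' := hr.unique (HasFDerivAt.comp (chOne G : E) (g := mulCh G)
    (f := fun x : E => (chOne G, x)) h.hasFDerivAt (hasFDerivAt_prodMk_right _ _))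
  ext x
  · simpa using congrArg (fun L : E →L[ℝ] E => L x) hl'
  · simpa using congrArg (fun L : E →L[ℝ] E => L x) hr'

/-- `Ad g`, as an operator on the model space. -/
def Ad (g : G) : E →L[ℝ] E := adjoint g

variable (E) in
theorem contMDiff_conj (g : G) : ContMDiff 𝓘(ℝ, E) 𝓘(ℝ, E) ∞ fun h : G => g * h * g⁻¹ :=
  (contMDiff_const.mul contMDiff_id).mul contMDiff_const

theorem hasStrictFDerivAt_conj (g : G) :
    HasStrictFDerivAt (fun x : E => (ch (g * chInv x * g⁻¹) : E)) (Ad g) (chOne G) :=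
  hasStrictFDerivAt_ch_comp_chInv (f := fun h => g * h * g⁻¹) (contMDiff_conj E g).contMDiffAt
    (by simp)

/-- Differentiating the constant `x * x⁻¹` gives `id + L = 0` for the differential `L` of inversion.
-/
theorem hasStrictFDerivAt_inv :
    HasStrictFDerivAt (fun x : E => (ch ((chInv x : G)⁻¹) : E)) (-ContinuousLinearMap.id ℝ E)
      (chOne G) := by
  have h := hasStrictFDerivAt_ch_comp_chInv (E := E) (G := G) (f := fun h => h⁻¹)
    (contMDiff_inv 𝓘(ℝ, E) ∞).contMDiffAt inv_one
  have hc : ∀ᶠ x in 𝓝 (chOne G : E), (chInv (ch ((chInv x : G)⁻¹) : E) : G) = (chInv x)⁻¹ := by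
    have : Tendsto (fun x : E => (chInv x : G)⁻¹) (𝓝 (chOne G)) (𝓝 1) := by
      have := topologicalGroup_of_lieGroup 𝓘(ℝ, E) ∞ (G := G)
      simpa using (tendsto_chInv (E := E) (G := G)).inv
    exact this.eventually eventually_chInv_ch
  have h1 : HasFDerivAt (fun x : E => mulCh G (x, ch ((chInv x : G)⁻¹))) _ (chOne G) :=
    HasFDerivAt.comp (chOne G : E) (g := mulCh G) (f := fun x : E => (x, ch ((chInv x : G)⁻¹)))
      (by
        rw [chInv_chOne, inv_one]
        exact (hasStrictFDerivAt_mulCh (E := E) (G := G)).hasFDerivAt)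
      ((hasFDerivAt_id _).prodMk h.hasFDerivAt)
  have h2 : HasFDerivAt (fun x : E => mulCh G (x, ch ((chInv x : G)⁻¹))) (0 : E →L[ℝ] E)
      (chOne G) := by
    refine (hasFDerivAt_const (chOne G : E) _).congr_of_eventuallyEq ?_
    filter_upwards [hc] with x hx
    simp [mulCh, hx, chOne]
  have h3 := h1.unique h2
  convert! h using 1
  ext x
  have h4 := congrArg (fun L : E →L[ℝ] E => L x) h3
  simp only [ContinuousLinearMap.comp_apply, _root_.add_apply,
    ContinuousLinearMap.coe_fst', ContinuousLinearMap.coe_snd', _root_.zero_apply] at h4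
  rw [_root_.neg_apply, ContinuousLinearMap.id_apply]
  exact neg_eq_of_add_eq_zero_right h4

theorem Ad_one : Ad (1 : G) = ContinuousLinearMap.id ℝ E := by
  have h := (hasStrictFDerivAt_conj (E := E) (1 : G)).hasFDerivAt
  refine h.unique ((hasFDerivAt_id _).congr_of_eventuallyEq ?_)
  filter_upwards [eventually_ch_chInv (E := E) (G := G)] with x hx
  simpa using hx

theorem Ad_mul (g h : G) : (Ad (g * h) : E →L[ℝ] E) = Ad g ∘L Ad h := by
  have h1 := (hasStrictFDerivAt_conj (E := E) h).hasFDerivAt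
  have h2 := (hasStrictFDerivAt_conj (E := E) g).hasFDerivAt
  have h3 : HasFDerivAt (fun x : E => (ch (g * chInv (ch (h * chInv x * h⁻¹) : E) * g⁻¹) : E))
      (Ad g ∘L Ad h) (chOne G) :=
    HasFDerivAt.comp (chOne G : E) (g := fun x : E => (ch (g * chInv x * g⁻¹) : E))
      (f := fun x : E => (ch (h * chInv x * h⁻¹) : E))
      (by rw [chInv_chOne, mul_one, mul_inv_cancel]; exact h2) h1
  refine (hasStrictFDerivAt_conj (E := E) (g * h)).hasFDerivAt.unique
    (h3.congr_of_eventuallyEq ?_)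
  have : Tendsto (fun x : E => h * (chInv x : G) * h⁻¹) (𝓝 (chOne G)) (𝓝 1) := by
    have := topologicalGroup_of_lieGroup 𝓘(ℝ, E) ∞ (G := G)
    simpa using ((tendsto_chInv (E := E) (G := G)).const_mul h).mul_const h⁻¹
  filter_upwards [this.eventually (eventually_chInv_ch (E := E))] with x hx
  simp only [hx]
  group

theorem Ad_mul_apply (g h : G) (v : E) : Ad (g * h) v = Ad g (Ad h v) := by
  rw [Ad_mul]; rfl

end Smooth

end Chart

end SymmetricLie

end

/-! ### Left logarithmic derivatives of curves. -/

noncomputable section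

namespace SymmetricLie

open Filter Topology

section LeftDeriv

variable {E : Type*} [NormedAddCommGroup E] [NormedSpace ℝ E]
  {G : Type*} [TopologicalSpace G] [ChartedSpace E G] [Group G]

/-- The curve `c` is differentiable at time `t`, with left logarithmic derivative
`c(t)⁻¹ c'(t) = u`. -/
def HasLeftDeriv (c : ℝ → G) (u : E) (t : ℝ) : Prop :=
  ContinuousAt c t ∧ HasDerivAt (fun τ => (ch ((c t)⁻¹ * c τ) : E)) u t

theorem hasDerivAt_ch_map {c : ℝ → G} {t : ℝ} {u : E} {f : G → G} {L : E →L[ℝ] E}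
    (hf : HasFDerivAt (fun x : E => (ch (f (chInv x)) : E)) L (chOne G))
    (hc : ContinuousAt c t) (h1 : c t = 1) (hu : HasDerivAt (fun τ => (ch (c τ) : E)) u t) :
    HasDerivAt (fun τ => (ch (f (c τ)) : E)) (L u) t := by
  have h2 : HasDerivAt (fun τ => (ch (f (chInv (ch (c τ) : E))) : E)) (L u) t :=
    HasFDerivAt.comp_hasDerivAt (l := fun x : E => (ch (f (chInv x)) : E)) t
      (by rw [h1]; exact hf) hu
  refine h2.congr_of_eventuallyEq ?_
  rw [ContinuousAt, h1] at hc
  filter_upwards [hc.eventually (eventually_chInv_ch (E := E))] with τ hτ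
  rw [hτ]

variable [LieGroup 𝓘(ℝ, E) ∞ G]

theorem hasDerivAt_ch_mul {c d : ℝ → G} {t : ℝ} {u v : E}
    (hc : ContinuousAt c t) (hc1 : c t = 1) (hu : HasDerivAt (fun τ => (ch (c τ) : E)) u t)
    (hd : ContinuousAt d t) (hd1 : d t = 1) (hv : HasDerivAt (fun τ => (ch (d τ) : E)) v t) :
    HasDerivAt (fun τ => (ch (c τ * d τ) : E)) (u + v) t := by
  have h2 : HasDerivAt (fun τ => mulCh G ((ch (c τ) : E), (ch (d τ) : E)))
      ((ContinuousLinearMap.fst ℝ E E + ContinuousLinearMap.snd ℝ E E) (u, v)) t :=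
    HasFDerivAt.comp_hasDerivAt (l := mulCh G) t
      (by rw [hc1, hd1]; exact (hasStrictFDerivAt_mulCh (E := E) (G := G)).hasFDerivAt)
      (hu.prodMk hv)
  refine h2.congr_of_eventuallyEq ?_
  rw [ContinuousAt, hc1] at hc
  rw [ContinuousAt, hd1] at hd
  filter_upwards [hc.eventually (eventually_chInv_ch (E := E)),
    hd.eventually (eventually_chInv_ch (E := E))] with τ h3 h4
  simp only [mulCh, h3, h4]

/-- The left-invariant vector fields in the chart: the differential at the identity of the left
multiplication by the point with coordinates `x`. -/
def leftMulCh (G : Type*) [TopologicalSpace G] [ChartedSpace E G] [Group G] (x : E) : E →L[ℝ] E :=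
  fderiv ℝ (fun y : E => mulCh G (x, y)) (chOne G)

theorem contDiffAt_leftMulCh : ContDiffAt ℝ 2 (leftMulCh G : E → E →L[ℝ] E) (chOne G) :=
  ContDiffAt.fderiv (n := ∞) (m := 2) (f := fun x y : E => mulCh G (x, y))
    (g := fun _ => chOne G) contDiffAt_mulCh contDiffAt_const (by norm_cast)

theorem leftMulCh_chOne : leftMulCh G (chOne G) = ContinuousLinearMap.id ℝ E :=
  ((hasFDerivAt_id _).congr_of_eventuallyEq eventually_mulCh_right).fderiv

theorem eventually_contDiffAt_mulCh :
    ∀ᶠ x in 𝓝 (chOne G : E), ContDiffAt ℝ 2 (mulCh G) (x, (chOne G : E)) := by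
  have h1 := ((contDiffAt_mulCh (E := E) (G := G)).of_le (m := 2) (by norm_cast)).eventually
    (by simp)
  have h2 : Tendsto (fun x : E => (x, (chOne G : E))) (𝓝 (chOne G))
      (𝓝 ((chOne G : E), (chOne G : E))) := by
    exact (continuous_id.prodMk continuous_const).continuousAt
  exact h2.eventually h1

theorem eventually_hasFDerivAt_mulCh : ∀ᶠ x in 𝓝 (chOne G : E),
    HasFDerivAt (fun y : E => mulCh G (x, y)) (leftMulCh G x) (chOne G) := by
  filter_upwards [eventually_contDiffAt_mulCh (E := E) (G := G)] with x hx
  have := (hx.differentiableAt (by simp)).comp (chOne G : E) (f := fun y : E => (x, y))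
    (differentiableAt_const _ |>.prodMk differentiableAt_id)
  exact this.hasFDerivAt

variable [IsTopologicalGroup G] {c d : ℝ → G} {t : ℝ} {u v : E}

/-- The product centred at time `t` is `d(t)⁻¹ (c(t)⁻¹ c) d(t)` times `d(t)⁻¹ d`. Conjugation
contributes `Ad (d t)⁻¹`, and velocities at the identity add. -/
theorem HasLeftDeriv.mul (hc : HasLeftDeriv c u t) (hd : HasLeftDeriv d v t) :
    HasLeftDeriv (fun τ => c τ * d τ) (Ad (d t)⁻¹ u + v) t := by
  refine ⟨hc.1.mul hd.1, ?_⟩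
  have hc' : ContinuousAt (fun τ => (c t)⁻¹ * c τ) t := hc.1.const_mul _
  have h1 := hasDerivAt_ch_map (f := fun h => (d t)⁻¹ * h * (d t)⁻¹⁻¹)
    (hasStrictFDerivAt_conj (E := E) (d t)⁻¹).hasFDerivAt hc'
    (by simp) hc.2
  have h2 := hasDerivAt_ch_mul ((hc'.const_mul (d t)⁻¹).mul_const ((d t)⁻¹)⁻¹) (by simp) h1
    (hd.1.const_mul (d t)⁻¹) (by simp) hd.2
  convert! h2 using 3 with τ
  group

theorem HasLeftDeriv.inv (hc : HasLeftDeriv c u t) :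
    HasLeftDeriv (fun τ => (c τ)⁻¹) (-Ad (c t) u) t := by
  refine ⟨hc.1.inv, ?_⟩
  have hc' : ContinuousAt (fun τ => (c t)⁻¹ * c τ) t := hc.1.const_mul _
  have h1 := hasDerivAt_ch_map (f := fun h => c t * h * (c t)⁻¹)
    (hasStrictFDerivAt_conj (E := E) (c t)).hasFDerivAt hc'
    (by simp) hc.2
  have h2 := hasDerivAt_ch_map (hasStrictFDerivAt_inv (E := E) (G := G)).hasFDerivAt
    ((hc'.const_mul (c t)).mul_const (c t)⁻¹) (by simp) h1
  convert! h2 using 3 with τ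
  group

theorem HasLeftDeriv.map {f : G →* G} (hf : ContMDiff 𝓘(ℝ, E) 𝓘(ℝ, E) ∞ f)
    (hc : HasLeftDeriv c u t) :
    HasLeftDeriv (fun τ => f (c τ))
      ((show E →L[ℝ] E from mfderiv 𝓘(ℝ, E) 𝓘(ℝ, E) f 1) u) t := by
  refine ⟨hf.continuous.continuousAt.comp hc.1, ?_⟩
  have h := hasDerivAt_ch_map
    (hasStrictFDerivAt_ch_comp_chInv (E := E) hf.contMDiffAt (map_one f)).hasFDerivAt
    (hc.1.const_mul (c t)⁻¹) (by simp) hc.2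
  simpa only [map_mul, map_inv] using h

theorem HasLeftDeriv.const_mul (g : G) (hc : HasLeftDeriv c u t) :
    HasLeftDeriv (fun τ => g * c τ) u t := by
  refine ⟨hc.1.const_mul g, ?_⟩
  convert! hc.2 using 3 with τ
  group

theorem HasLeftDeriv.mul_const (g : G) (hc : HasLeftDeriv c u t) :
    HasLeftDeriv (fun τ => c τ * g) (Ad g⁻¹ u) t := by
  have h : HasLeftDeriv (fun _ : ℝ => g) (0 : E) t :=
    ⟨continuousAt_const, hasDerivAt_const _ _⟩
  simpa using hc.mul h

theorem HasLeftDeriv.scomp {r : ℝ → ℝ} {r' s : ℝ} (hc : HasLeftDeriv c u (r s))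
    (hr : HasDerivAt r r' s) : HasLeftDeriv (fun τ => c (r τ)) (r' • u) s :=
  ⟨ContinuousAt.comp (f := r) hc.1 hr.continuousAt, HasDerivAt.scomp s hc.2 hr⟩

/-- Near the identity a left logarithmic derivative becomes the ordinary differential equation `x' =
L_x u` in the fixed chart, with one neighbourhood for all curves. -/
theorem eventually_hasDerivAt_ch : ∀ᶠ g in 𝓝 (1 : G), ∀ (c : ℝ → G) (u : E) (t : ℝ), c t = g →
    HasLeftDeriv c u t → HasDerivAt (fun τ => (ch (c τ) : E)) (leftMulCh G (ch (c t)) u) t := by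
  filter_upwards [eventually_chInv_ch (E := E), tendsto_ch.eventually
    (eventually_hasFDerivAt_mulCh (E := E) (G := G))] with g h1 h2 c u t hg hc
  subst hg
  have h3 : HasDerivAt (fun τ => mulCh G ((ch (c t) : E), (ch ((c t)⁻¹ * c τ) : E)))
      (leftMulCh G (ch (c t)) u) t :=
    HasFDerivAt.comp_hasDerivAt (l := fun y : E => mulCh G ((ch (c t) : E), y)) t
      (by rw [inv_mul_cancel]; exact h2) hc.2
  refine h3.congr_of_eventuallyEq ?_
  have h4 : Tendsto (fun τ => (c t)⁻¹ * c τ) (𝓝 t) (𝓝 1) := by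
    simpa using (hc.1.const_mul (c t)⁻¹).tendsto
  filter_upwards [h4.eventually (eventually_chInv_ch (E := E))] with τ h5
  simp only [mulCh, h1, h5, mul_inv_cancel_left]

/-- Around each time, the curve translated to the identity has zero derivative in the chart, hence
is locally constant, and `ℝ` is connected. Applied to `c d⁻¹`, this gives uniqueness for the
evolution equation. -/
theorem eq_of_hasLeftDeriv_zero (hc : ∀ t, HasLeftDeriv c (0 : E) t) (a b : ℝ) : c a = c b := by
  have hcont : Continuous c := continuous_iff_continuousAt.2 fun t => (hc t).1
  suffices h : IsLocallyConstant c from h.apply_eq_of_isPreconnected isPreconnected_univ trivial trivial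
  rw [IsLocallyConstant.iff_eventually_eq]
  intro t
  have h1 : Tendsto (fun τ => (c t)⁻¹ * c τ) (𝓝 t) (𝓝 1) := by
    simpa using ((hc t).1.const_mul (c t)⁻¹).tendsto
  have h2 : ∀ᶠ τ in 𝓝 t, HasDerivAt (fun τ => (ch ((c t)⁻¹ * c τ) : E)) 0 τ := by
    filter_upwards [h1.eventually (eventually_hasDerivAt_ch (E := E))] with τ hτ
    simpa using hτ _ 0 τ rfl ((hc τ).const_mul (c t)⁻¹)
  obtain ⟨r, hr, h3⟩ := Metric.eventually_nhds_iff_ball.1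
    (h2.and (h1.eventually (eventually_chInv_ch (E := E))))
  filter_upwards [Metric.ball_mem_nhds t hr] with τ hτ
  have h4 : (ch ((c t)⁻¹ * c τ) : E) = ch ((c t)⁻¹ * c t) :=
    (convex_ball t r).is_const_of_fderivWithin_eq_zero
      (fun x hx => (h3 x hx).1.differentiableAt.differentiableWithinAt)
      (fun x hx => by
        rw [fderivWithin_of_isOpen Metric.isOpen_ball hx, (h3 x hx).1.hasFDerivAt.fderiv]
        ext; simp) hτ (Metric.mem_ball_self hr)
  have h5 := congrArg (chInv : E → G) h4
  rw [(h3 τ hτ).2, (h3 t (Metric.mem_ball_self hr)).2] at h5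
  exact mul_left_cancel h5

theorem eq_of_hasLeftDeriv_eq {u : ℝ → E} (hc : ∀ t, HasLeftDeriv c (u t) t)
    (hd : ∀ t, HasLeftDeriv d (u t) t) {a : ℝ} (ha : c a = d a) : c = d := by
  ext b
  have h : ∀ t, HasLeftDeriv (fun τ => c τ * (d τ)⁻¹) (0 : E) t := by
    intro t
    simpa using (hc t).mul (hd t).inv
  have h1 := eq_of_hasLeftDeriv_zero h b a
  simp only [ha, mul_inv_cancel] at h1
  exact mul_inv_eq_one.1 h1

end LeftDeriv

end SymmetricLie

end

/-! ### The exponential map and one-parameter subgroups. -/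

noncomputable section

namespace SymmetricLie

open Filter Topology

section Exp

variable {E : Type*} [NormedAddCommGroup E] [NormedSpace ℝ E]
  {G : Type*} [TopologicalSpace G] [ChartedSpace E G] [Group G]

/-- The exponential map, on the model space. -/
def ex (v : E) : G := lieExp (v : GroupLieAlgebra 𝓘(ℝ, E) G)

variable [LieGroup 𝓘(ℝ, E) ∞ G]

theorem mdifferentiable_mul_left (g : G) : MDifferentiable 𝓘(ℝ, E) 𝓘(ℝ, E) (g * · : G → G) :=
  (contMDiff_mul_left (I := 𝓘(ℝ, E)) (n := ∞)).mdifferentiable (by simp)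

/-- The differential of a self-map of `G`, as an operator on the model space. -/
def diffAt (f : G → G) (x : G) : E →L[ℝ] E := mfderiv 𝓘(ℝ, E) 𝓘(ℝ, E) f x

theorem diffAt_comp {f g : G → G} {x : G} (hg : MDifferentiableAt 𝓘(ℝ, E) 𝓘(ℝ, E) g (f x))
    (hf : MDifferentiableAt 𝓘(ℝ, E) 𝓘(ℝ, E) f x) (v : E) :
    diffAt (g ∘ f) x v = diffAt g (f x) (diffAt f x v) :=
  congrArg (fun L : E →L[ℝ] E => L v) (mfderiv_comp (I' := 𝓘(ℝ, E)) x hg hf)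

theorem diffAt_mul_left (g h : G) (v : E) :
    diffAt (g * · : G → G) h (diffAt (h * · : G → G) 1 v) = diffAt (g * h * · : G → G) 1 v := by
  have h1 : ((g * · : G → G) ∘ (h * ·)) = (g * h * ·) := by
    ext x; simp [mul_assoc]
  have h2 := diffAt_comp (E := E) (x := (1 : G)) (g := (g * · : G → G)) (f := (h * · : G → G))
    (mdifferentiable_mul_left _ _) (mdifferentiable_mul_left _ _) v
  rw [h1, mul_one] at h2
  exact h2.symm

theorem diffAt_one_mul (v : E) : diffAt ((1 : G) * · : G → G) 1 v = v := by
  have h : ((1 : G) * · : G → G) = id := by ext; simp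
  rw [diffAt, h, mfderiv_id]
  rfl

theorem hasLeftDeriv_of_isMIntegralCurve {γ : ℝ → G} {v : E}
    (hγ : IsMIntegralCurve γ (mulInvariantVectorField (I := 𝓘(ℝ, E)) (G := G) v)) (t : ℝ) :
    HasLeftDeriv (E := E) γ v t := by
  refine ⟨hγ.continuous.continuousAt, ?_⟩
  have h1 := (mdifferentiable_mul_left (E := E) (γ t)⁻¹ (γ t)).hasMFDerivAt.comp t (hγ t)
  have h2 := h1.2
  have h3 : writtenInExtChartAt 𝓘(ℝ, ℝ) 𝓘(ℝ, E) t (((γ t)⁻¹ * ·) ∘ γ) =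
      fun τ => (ch ((γ t)⁻¹ * γ τ) : E) := by
    ext τ
    simp only [writtenInExtChartAt, Function.comp_apply, inv_mul_cancel]
    rfl
  rw [h3] at h2
  have h4 : HasFDerivAt (fun τ => (ch ((γ t)⁻¹ * γ τ) : E))
      (((diffAt ((γ t)⁻¹ * ·) (γ t) : E →L[ℝ] E)).comp
        ((1 : ℝ →L[ℝ] ℝ).smulRight (diffAt (γ t * ·) 1 v))) t := by
    rw [← hasFDerivWithinAt_univ]
    convert! h2 using 1
    simp
  have h5 : diffAt ((γ t)⁻¹ * ·) (γ t) (diffAt (γ t * ·) 1 v) = (v : E) := by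
    rw [diffAt_mul_left, inv_mul_cancel, diffAt_one_mul]
  have h6 := h4.hasDerivAt
  simp only [ContinuousLinearMap.comp_apply, ContinuousLinearMap.smulRight_apply,
    one_apply_eq_self, one_smul, h5] at h6
  exact h6

/-- Left translation carries a local integral curve through `1` to one through any point with the
same lifetime, and a uniform lifetime makes the flow complete. -/
theorem exists_isMIntegralCurve [CompleteSpace E] [T2Space G] (v : E) :
    ∃ γ : ℝ → G, γ 0 = 1 ∧ IsMIntegralCurve γ
      (mulInvariantVectorField (I := 𝓘(ℝ, E)) (G := G) v) := by
  have : LieGroup 𝓘(ℝ, E) (minSmoothness ℝ 3) G := LieGroup.of_le (n := ∞) (by simp; norm_cast)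
  have : IsManifold 𝓘(ℝ, E) 1 G := IsManifold.of_le (n := ∞) (by simp)
  have hv : ContMDiff 𝓘(ℝ, E) 𝓘(ℝ, E).tangent 1
      (fun g : G => (⟨g, mulInvariantVectorField (I := 𝓘(ℝ, E)) (G := G) v g⟩ : TangentBundle 𝓘(ℝ, E) G)) :=
    (contMDiff_mulInvariantVectorField (I := 𝓘(ℝ, E)) (G := G) v).of_le (by simp)
  obtain ⟨γ, h0, hγ⟩ := exists_isMIntegralCurveAt_of_contMDiffAt_boundaryless (t₀ := 0)
    (hv.contMDiffAt (x := (1 : G)))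
  obtain ⟨ε, hε, hγ'⟩ := isMIntegralCurveAt_iff'.1 hγ
  refine exists_isMIntegralCurve_of_isMIntegralCurveOn hv hε (fun x => ?_) 1
  refine ⟨fun t => x * γ t, by simp [h0], fun t ht => ?_⟩
  rw [Real.ball_eq_Ioo, zero_sub, zero_add] at hγ'
  have h2 := HasMFDerivAt.comp_hasMFDerivWithinAt t
    (mdifferentiable_mul_left (E := E) x (γ t)).hasMFDerivAt (hγ' t ht)
  have h3 : diffAt (x * γ t * ·) 1 (v : E) = diffAt (x * ·) (γ t) (diffAt (γ t * ·) 1 v) :=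
    (diffAt_mul_left x (γ t) v).symm
  let L : ℝ →L[ℝ] E := (1 : ℝ →L[ℝ] ℝ).smulRight (diffAt (x * γ t * ·) 1 v)
  have h4 : L = (diffAt (x * ·) (γ t) : E →L[ℝ] E).comp
      ((1 : ℝ →L[ℝ] ℝ).smulRight (diffAt (γ t * ·) 1 v)) := by
    ext
    simp [L, h3]
  have h5 : HasMFDerivWithinAt 𝓘(ℝ, ℝ) 𝓘(ℝ, E) (fun t => x * γ t) (Set.Ioo (-ε) ε) t L := by
    rw [h4]
    exact h2
  exact h5

variable [IsTopologicalGroup G] [CompleteSpace E] [T2Space G]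

/-- Uniqueness removes the choice made in `lieExp`: any curve from `1` with constant left derivative
`v` computes the exponential. -/
theorem ex_eq {γ : ℝ → G} {v : E} (h0 : γ 0 = 1) (hγ : ∀ t, HasLeftDeriv γ v t) :
    ex v = γ 1 := by
  obtain ⟨γ₁, h1, h2⟩ := exists_isMIntegralCurve (G := G) (E := E) v
  obtain ⟨γ₂, h3, h4, h5⟩ := Classical.epsilon_spec (p := fun g : G => ∃ γ : ℝ → G, γ 0 = 1 ∧
    IsMIntegralCurve γ (mulInvariantVectorField (I := 𝓘(ℝ, E)) (G := G) v) ∧ γ 1 = g)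
    ⟨γ₁ 1, γ₁, h1, h2, rfl⟩
  rw [eq_of_hasLeftDeriv_eq (u := fun _ => v) hγ (hasLeftDeriv_of_isMIntegralCurve h4)
    (h0.trans h3.symm), h5]
  rfl

theorem hasLeftDeriv_ex_smul (v : E) (t : ℝ) : HasLeftDeriv (fun s : ℝ => (ex (s • v) : G)) v t := by
  obtain ⟨γ, h1, h2⟩ := exists_isMIntegralCurve (G := G) (E := E) v
  have h3 := hasLeftDeriv_of_isMIntegralCurve h2
  have h4 : (fun s : ℝ => (ex (s • v) : G)) = γ := by
    ext s
    have h5 := ex_eq (γ := fun τ => γ (s * τ)) (v := s • v) (by simpa using h1)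
      (fun t => (h3 (s * t)).scomp (by simpa using (hasDerivAt_id t).const_mul s))
    simpa using h5
  rw [h4]
  exact h3 t

theorem ex_zero : (ex (0 : E) : G) = 1 :=
  ex_eq (γ := fun _ => 1) rfl fun _ => ⟨continuousAt_const, hasDerivAt_const _ _⟩

/-- As functions of `τ`, `e^{-av} e^{(a+τ)v}` and `e^{τv}` have the same constant left derivative
and the same starting point. -/
theorem ex_add_smul (v : E) (a b : ℝ) : (ex ((a + b) • v) : G) = ex (a • v) * ex (b • v) := by
  have h : (fun τ : ℝ => (ex (a • v) : G)⁻¹ * ex ((a + τ) • v)) = fun τ => ex (τ • v) := by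
    refine eq_of_hasLeftDeriv_eq (u := fun _ => v) (a := 0) (fun t => ?_)
      (hasLeftDeriv_ex_smul v) ?_
    · have h1 := (hasLeftDeriv_ex_smul (G := G) v (a + t)).scomp ((hasDerivAt_id t).const_add a)
      rw [one_smul] at h1
      exact h1.const_mul _
    · simp [ex_zero]
  have := congrFun h b
  rw [← this, mul_inv_cancel_left]

theorem ex_neg (v : E) : (ex (-v) : G) = (ex v)⁻¹ := by
  have := ex_add_smul (G := G) v (-1) 1
  rw [neg_add_cancel, zero_smul, ex_zero, neg_one_smul, one_smul] at this
  exact eq_inv_of_mul_eq_one_left this.symm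

theorem ex_two_smul (v : E) : (ex ((2 : ℝ) • v) : G) = ex v * ex v := by
  have := ex_add_smul (G := G) v 1 1
  rwa [one_smul, one_add_one_eq_two] at this

theorem map_ex {f : G →* G} (hf : ContMDiff 𝓘(ℝ, E) 𝓘(ℝ, E) ∞ f) (v : E) :
    f (ex v) = ex ((show E →L[ℝ] E from mfderiv 𝓘(ℝ, E) 𝓘(ℝ, E) f 1) v) := by
  have h := ex_eq (γ := fun τ : ℝ => f (ex (τ • v))) (by simp [ex_zero])
    (fun t => (hasLeftDeriv_ex_smul (G := G) v t).map hf)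
  simpa using h.symm

end Exp
end SymmetricLie

end

/-! ### The Lie bracket as the derivative of `Ad`. -/

noncomputable section

namespace SymmetricLie

open Filter Topology

section Bracket

variable {E : Type*} [NormedAddCommGroup E] [NormedSpace ℝ E]
  {G : Type*} [TopologicalSpace G] [ChartedSpace E G] [Group G]

/-- The differential at the identity of the right multiplication by the point with
coordinates `x`, in the chart. -/
def rightMulCh (G : Type*) [TopologicalSpace G] [ChartedSpace E G] [Group G] (x : E) : E →L[ℝ] E :=
  fderiv ℝ (fun y : E => mulCh G (y, x)) (chOne G)

/-- The adjoint representation of the Lie algebra, on the model space. -/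
def ad (G : Type*) [TopologicalSpace G] [ChartedSpace E G] [Group G] : E →L[ℝ] E →L[ℝ] E :=
  fderiv ℝ (leftMulCh G) (chOne G) -
    (show E →L[ℝ] E →L[ℝ] E from fderiv ℝ (leftMulCh G) (chOne G)).flip

theorem rightMulCh_chOne : rightMulCh G (chOne G) = ContinuousLinearMap.id ℝ E :=
  ((hasFDerivAt_id _).congr_of_eventuallyEq eventually_mulCh_left).fderiv

variable [LieGroup 𝓘(ℝ, E) ∞ G]

theorem contDiffAt_rightMulCh : ContDiffAt ℝ 2 (rightMulCh G : E → E →L[ℝ] E) (chOne G) :=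
  ContDiffAt.fderiv (n := ∞) (m := 2) (f := fun x y : E => mulCh G (y, x))
    (g := fun _ => chOne G)
    (ContDiffAt.comp (chOne G, chOne G) (g := mulCh G) (f := fun p : E × E => (p.2, p.1))
      contDiffAt_mulCh (contDiffAt_snd.prodMk contDiffAt_fst)) contDiffAt_const (by norm_cast)

theorem contDiffAt_Ad_chInv : ContDiffAt ℝ 2 (fun x : E => (Ad (chInv x : G) : E →L[ℝ] E))
    (chOne G) := by
  have h : (fun x : E => (Ad (chInv x : G) : E →L[ℝ] E)) = fun x =>
      fderiv ℝ (fun y : E => (ch (chInv x * chInv y * (chInv x)⁻¹ : G) : E)) (chOne G) := by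
    ext1 x
    exact (hasStrictFDerivAt_conj (chInv x : G)).hasFDerivAt.fderiv.symm
  rw [h]
  refine ContDiffAt.fderiv (n := ∞) (m := 2)
    (f := fun x y : E => (ch (chInv x * chInv y * (chInv x)⁻¹ : G) : E))
    (g := fun _ => chOne G) (contDiffAt_ch_comp ?_ (by simp [chInv_chOne]))
    contDiffAt_const (by norm_cast)
  exact ((contMDiffAt_chInv_comp contDiffAt_fst rfl).mul
    (contMDiffAt_chInv_comp contDiffAt_snd rfl)).mul (contMDiffAt_chInv_comp contDiffAt_fst rfl).inv

theorem eventually_contDiffAt_mulCh' :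
    ∀ᶠ x in 𝓝 (chOne G : E), ContDiffAt ℝ 2 (mulCh G) ((chOne G : E), x) := by
  have h1 := ((contDiffAt_mulCh (E := E) (G := G)).of_le (m := 2) (by norm_cast)).eventually
    (by simp)
  have h2 : Tendsto (fun x : E => ((chOne G : E), x)) (𝓝 (chOne G))
      (𝓝 ((chOne G : E), (chOne G : E))) := by
    exact (continuous_const.prodMk continuous_id).continuousAt
  exact h2.eventually h1

theorem eventually_leftMulCh_eq : ∀ᶠ x in 𝓝 (chOne G : E), ∀ w,
    leftMulCh G x w = fderiv ℝ (mulCh G) (x, (chOne G : E)) (0, w) := by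
  filter_upwards [eventually_contDiffAt_mulCh (E := E) (G := G)] with x hx w
  have h := HasFDerivAt.comp (chOne G : E) (g := mulCh G) (f := fun y : E => (x, y))
    (hx.differentiableAt (by simp)).hasFDerivAt (hasFDerivAt_prodMk_right _ _)
  have h' : HasFDerivAt (fun y : E => mulCh G (x, y)) _ (chOne G) := h
  rw [leftMulCh, h'.fderiv]
  simp

theorem eventually_rightMulCh_eq : ∀ᶠ x in 𝓝 (chOne G : E),
    HasFDerivAt (fun y : E => mulCh G (y, x)) (rightMulCh G x) (chOne G) ∧ ∀ w,
    rightMulCh G x w = fderiv ℝ (mulCh G) ((chOne G : E), x) (w, 0) := by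
  filter_upwards [eventually_contDiffAt_mulCh' (E := E) (G := G)] with x hx
  have h := HasFDerivAt.comp (chOne G : E) (g := mulCh G) (f := fun y : E => (y, x))
    (hx.differentiableAt (by simp)).hasFDerivAt (hasFDerivAt_prodMk_left _ _)
  have h' : HasFDerivAt (fun y : E => mulCh G (y, x)) _ (chOne G) := h
  rw [rightMulCh, h'.fderiv]
  exact ⟨h', fun w => by simp⟩

/-- This is the differential in `h` of `(g h g⁻¹) g = g h`. -/
theorem eventually_rightMulCh_comp_Ad [IsTopologicalGroup G] : ∀ᶠ x in 𝓝 (chOne G : E),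
    rightMulCh G x ∘L Ad (chInv x : G) = leftMulCh G x := by
  filter_upwards [eventually_rightMulCh_eq (E := E) (G := G),
    eventually_hasFDerivAt_mulCh (E := E) (G := G)] with x h1 h2
  have h3 : HasFDerivAt (fun y : E => mulCh G ((ch (chInv x * chInv y * (chInv x)⁻¹ : G) : E), x))
      (rightMulCh G x ∘L Ad (chInv x : G)) (chOne G) :=
    HasFDerivAt.comp (chOne G : E) (g := fun y : E => mulCh G (y, x))
      (f := fun y : E => (ch (chInv x * chInv y * (chInv x)⁻¹ : G) : E))
      (by rw [chInv_chOne, mul_one, mul_inv_cancel]; exact h1.1)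
      (hasStrictFDerivAt_conj (chInv x : G)).hasFDerivAt
  refine h3.unique (h2.congr_of_eventuallyEq ?_)
  have : Tendsto (fun y : E => chInv x * (chInv y : G) * (chInv x)⁻¹) (𝓝 (chOne G)) (𝓝 1) := by
    simpa using ((tendsto_chInv (E := E) (G := G)).const_mul (chInv x)).mul_const (chInv x)⁻¹
  filter_upwards [this.eventually (eventually_chInv_ch (E := E))] with y hy
  simp only [mulCh, hy]
  group

/-- Both sides are the mixed second derivative of the multiplication at the identity, which is
symmetric. -/
theorem fderiv_rightMulCh_apply (v w : E) :
    fderiv ℝ (rightMulCh G) (chOne G) v w = fderiv ℝ (leftMulCh G) (chOne G) w v := by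
  have hM : ContDiffAt ℝ 1 (fderiv ℝ (mulCh G)) ((chOne G : E), (chOne G : E)) :=
    (contDiffAt_mulCh (E := E) (G := G)).fderiv_right (m := 1) (by norm_cast)
  have hM' := (hM.differentiableAt (by simp)).hasFDerivAt
  have hL := ((contDiffAt_leftMulCh (E := E) (G := G)).differentiableAt (by simp)).hasFDerivAt
  have hR := ((contDiffAt_rightMulCh (E := E) (G := G)).differentiableAt (by simp)).hasFDerivAt
  have h1 : ∀ v w : E, fderiv ℝ (leftMulCh G) (chOne G) v w =
      fderiv ℝ (fderiv ℝ (mulCh G)) ((chOne G : E), (chOne G : E)) (v, 0) (0, w) := by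
    intro v w
    have h2 := (HasFDerivAt.comp (chOne G : E) (g := fderiv ℝ (mulCh G))
      (f := fun y : E => (y, (chOne G : E))) hM' (hasFDerivAt_prodMk_left _ _)).clm_apply
        (hasFDerivAt_const ((0 : E), w) (chOne G : E))
    have h3 := hL.clm_apply (hasFDerivAt_const w (chOne G : E))
    have h4 := h3.unique (h2.congr_of_eventuallyEq
      (by filter_upwards [eventually_leftMulCh_eq (E := E) (G := G)] with x hx using hx w))
    simpa using congrArg (fun L : E →L[ℝ] E => L v) h4
  have h1' : ∀ v w : E, fderiv ℝ (rightMulCh G) (chOne G) v w =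
      fderiv ℝ (fderiv ℝ (mulCh G)) ((chOne G : E), (chOne G : E)) (0, v) (w, 0) := by
    intro v w
    have h2 := (HasFDerivAt.comp (chOne G : E) (g := fderiv ℝ (mulCh G))
      (f := fun y : E => ((chOne G : E), y)) hM' (hasFDerivAt_prodMk_right _ _)).clm_apply
        (hasFDerivAt_const (w, (0 : E)) (chOne G : E))
    have h3 := hR.clm_apply (hasFDerivAt_const w (chOne G : E))
    have h4 := h3.unique (h2.congr_of_eventuallyEq
      (by filter_upwards [eventually_rightMulCh_eq (E := E) (G := G)] with x hx using hx.2 w))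
    simpa using congrArg (fun L : E →L[ℝ] E => L v) h4
  rw [h1, h1']
  exact (contDiffAt_mulCh (E := E) (G := G)).isSymmSndFDerivAt (by simp; norm_cast) _ _

/-- Differentiating `R_x ∘ Ad x = L_x` at the identity, where `R` and `Ad` are both the identity,
gives `D Ad = D L - D R`, and `D R` is `D L` with its arguments exchanged. -/
theorem hasFDerivAt_Ad_chInv [IsTopologicalGroup G] :
    HasFDerivAt (fun x : E => (Ad (chInv x : G) : E →L[ℝ] E)) (ad G) (chOne G) := by
  have hL := ((contDiffAt_leftMulCh (E := E) (G := G)).differentiableAt (by simp)).hasFDerivAt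
  have hR := ((contDiffAt_rightMulCh (E := E) (G := G)).differentiableAt (by simp)).hasFDerivAt
  have hA := ((contDiffAt_Ad_chInv (E := E) (G := G)).differentiableAt (by simp)).hasFDerivAt
  have h := hL.unique ((hR.clm_comp hA).congr_of_eventuallyEq
    (by filter_upwards [eventually_rightMulCh_comp_Ad (E := E) (G := G)] with x hx using hx.symm))
  convert! hA using 1
  ext v w
  have h1 := congrArg (fun L : E →L[ℝ] E →L[ℝ] E => L v w) h
  simp [chInv_chOne, Ad_one, rightMulCh_chOne, fderiv_rightMulCh_apply] at h1
  simp [ad, h1]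

theorem hasFDerivAt_leftMulCh_apply (v : E) :
    HasFDerivAt (fun x : E => leftMulCh G x v)
      ((show E →L[ℝ] E →L[ℝ] E from fderiv ℝ (leftMulCh G) (chOne G)).flip v) (chOne G) := by
  have hL := ((contDiffAt_leftMulCh (E := E) (G := G)).differentiableAt (by simp)).hasFDerivAt
  convert! hL.clm_apply (hasFDerivAt_const v (chOne G : E)) using 1
  ext w
  simp

/-- The differential of the chart at `g`, as an operator on the model space. -/
def diffCh (g : G) : E →L[ℝ] E := mfderiv 𝓘(ℝ, E) 𝓘(ℝ, E) (ch : G → E) g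

/-- The differential of the inverse chart at `x`, as an operator on the model space. -/
def diffChInv (G : Type*) [TopologicalSpace G] [ChartedSpace E G] [Group G] (x : E) : E →L[ℝ] E :=
  mfderiv 𝓘(ℝ, E) 𝓘(ℝ, E) (chInv : E → G) x

theorem diffCh_one : diffCh (1 : G) = ContinuousLinearMap.id ℝ E := by
  have h := ((contMDiffAt_ch (E := E) (G := G)).mdifferentiableAt (by simp)).hasMFDerivAt.2
  have h1 : HasFDerivAt (fun x : E => (ch (chInv x : G) : E)) (diffCh (1 : G)) (chOne G) := by
    rw [← hasFDerivWithinAt_univ]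
    convert! h using 1
    simp
  exact h1.unique ((hasFDerivAt_id _).congr_of_eventuallyEq eventually_ch_chInv)

theorem eventually_mdifferentiableAt : ∀ᶠ x in 𝓝 (chOne G : E),
    MDifferentiableAt 𝓘(ℝ, E) 𝓘(ℝ, E) (ch : G → E) (chInv x) ∧
    MDifferentiableAt 𝓘(ℝ, E) 𝓘(ℝ, E) (chInv : E → G) x := by
  have : IsManifold 𝓘(ℝ, E) 1 G := IsManifold.of_le (n := ∞) (by simp)
  have h1 : ∀ᶠ g in 𝓝 (1 : G), MDifferentiableAt 𝓘(ℝ, E) 𝓘(ℝ, E) (ch : G → E) g := by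
    filter_upwards [chart_source_mem_nhds E (1 : G)] with g hg
    exact mdifferentiableAt_extChartAt hg
  refine (tendsto_chInv.eventually h1).and ?_
  filter_upwards [extChartAt_target_mem_nhds (I := 𝓘(ℝ, E)) (1 : G)] with x hx
  exact ((contMDiffOn_extChartAt_symm (n := 1) (1 : G)).contMDiffAt
    ((isOpen_extChartAt_target (I := 𝓘(ℝ, E)) (1 : G)).mem_nhds hx)).mdifferentiableAt (by simp)

theorem diffCh_chInv_comp {x : E}
    (h1 : MDifferentiableAt 𝓘(ℝ, E) 𝓘(ℝ, E) (ch : G → E) (chInv x))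
    (h2 : MDifferentiableAt 𝓘(ℝ, E) 𝓘(ℝ, E) (chInv : E → G) x)
    (h : ∀ᶠ y in 𝓝 x, ch (chInv y : G) = y) :
    diffCh (chInv x : G) ∘L diffChInv G x = ContinuousLinearMap.id ℝ E := by
  have h3 := mfderiv_comp (I' := 𝓘(ℝ, E)) x h1 h2
  have h4 : ((ch : G → E) ∘ chInv) =ᶠ[𝓝 x] id := h
  rw [h4.mfderiv_eq, mfderiv_id] at h3
  exact h3.symm

theorem diffChInv_chOne : diffChInv G (chOne G) = ContinuousLinearMap.id ℝ E := by
  have h := diffCh_chInv_comp (E := E) (G := G)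
    (eventually_mdifferentiableAt (E := E) (G := G)).self_of_nhds.1
    (eventually_mdifferentiableAt (E := E) (G := G)).self_of_nhds.2 eventually_ch_chInv
  rw [chInv_chOne, diffCh_one] at h
  exact h

theorem diffChInv_comp_diffCh {x : E}
    (h1 : MDifferentiableAt 𝓘(ℝ, E) 𝓘(ℝ, E) (ch : G → E) (chInv x))
    (h2 : MDifferentiableAt 𝓘(ℝ, E) 𝓘(ℝ, E) (chInv : E → G) x)
    (hx : ch (chInv x : G) = x)
    (h : ∀ᶠ g in 𝓝 (chInv x : G), chInv (ch g : E) = g) :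
    diffChInv G x ∘L diffCh (chInv x : G) = ContinuousLinearMap.id ℝ E := by
  have h3 := mfderiv_comp (I' := 𝓘(ℝ, E)) (chInv x : G) (g := (chInv : E → G)) (by rwa [hx]) h1
  have h4 : ((chInv : E → G) ∘ ch) =ᶠ[𝓝 (chInv x)] id := h
  rw [h4.mfderiv_eq, mfderiv_id, hx] at h3
  exact h3.symm

/-- The left-invariant vector fields in the chart. -/
theorem eventually_inverse_diffChInv : ∀ᶠ x in 𝓝 (chOne G : E), ∀ v,
    (diffChInv G x).inverse (diffAt ((chInv x : G) * ·) 1 v) = leftMulCh G x v := by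
  filter_upwards [eventually_mdifferentiableAt (E := E) (G := G),
    (eventually_ch_chInv (E := E) (G := G)).eventually_nhds,
    tendsto_chInv.eventually (eventually_chInv_ch (E := E) (G := G)).eventually_nhds,
    eventually_hasFDerivAt_mulCh (E := E) (G := G)] with x h1 h2 h3 h4 v
  rw [ContinuousLinearMap.inverse_eq (diffChInv_comp_diffCh h1.1 h1.2 h2.self_of_nhds h3)
    (diffCh_chInv_comp h1.1 h1.2 h2)]
  have h5 : MDifferentiableAt 𝓘(ℝ, E) 𝓘(ℝ, E) (chInv : E → G) (chOne G) :=
    (eventually_mdifferentiableAt (E := E) (G := G)).self_of_nhds.2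
  have h6 := mdifferentiable_mul_left (E := E) (chInv x : G) (chInv (chOne G : E))
  have h7 : MDifferentiableAt 𝓘(ℝ, E) 𝓘(ℝ, E) (ch : G → E) (chInv x * chInv (chOne G : E)) := by
    rw [chInv_chOne, mul_one]; exact h1.1
  have h8 := mfderiv_comp (I' := 𝓘(ℝ, E)) (chOne G : E) (f := (chInv x * ·) ∘ (chInv : E → G)) h7
    (h6.comp _ h5)
  rw [mfderiv_comp (I' := 𝓘(ℝ, E)) (chOne G : E) (g := ((chInv x : G) * ·)) h6 h5,
    mfderiv_eq_fderiv] at h8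
  have h9 : leftMulCh G x v = diffCh (chInv x * chInv (chOne G : E) : G)
      (diffAt ((chInv x : G) * ·) (chInv (chOne G : E)) (diffChInv G (chOne G) v)) :=
    congrArg (fun L : E →L[ℝ] E => L v) h8
  rw [h9, diffChInv_chOne, chInv_chOne, mul_one]
  rfl

/-- In the chart the left-invariant fields are `x ↦ L_x v` near the identity, so their bracket there
is `D L(v) w - D L(w) v`. -/
theorem lieBracketWithin_leftInvariant (v w : E) : VectorField.lieBracketWithin ℝ
      (fun x : E => (diffChInv G x).inverse (diffAt ((chInv x : G) * ·) 1 v))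
      (fun x : E => (diffChInv G x).inverse (diffAt ((chInv x : G) * ·) 1 w))
      ((extChartAt 𝓘(ℝ, E) (1 : G)).symm ⁻¹' Set.univ ∩ Set.range 𝓘(ℝ, E)) (chOne G) =
      ad G v w := by
  have h1 : ∀ u : E, (fun x : E =>
      (diffChInv G x).inverse (diffAt ((chInv x : G) * ·) 1 u)) =ᶠ[𝓝 (chOne G)]
      fun x => leftMulCh G x u := by
    intro u
    filter_upwards [eventually_inverse_diffChInv (E := E) (G := G)] with x hx using hx u
  simp only [Set.preimage_univ, modelWithCornersSelf_coe, Set.range_id, Set.inter_univ,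
    VectorField.lieBracketWithin_univ]
  rw [VectorField.lieBracket, (h1 w).fderiv_eq, (h1 v).fderiv_eq,
    (hasFDerivAt_leftMulCh_apply (E := E) (G := G) v).fderiv,
    (hasFDerivAt_leftMulCh_apply (E := E) (G := G) w).fderiv]
  have h2 := (h1 v).self_of_nhds
  have h3 := (h1 w).self_of_nhds
  simp only at h2 h3
  rw [h2, h3, leftMulCh_chOne]
  simp [ad]

theorem bracket_eq_ad (v w : GroupLieAlgebra 𝓘(ℝ, E) G) : ⁅v, w⁆ = ad (E := E) G v w := by
  let A : E → E → E := fun u => VectorField.mpullbackWithin 𝓘(ℝ, E) 𝓘(ℝ, E)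
    (extChartAt 𝓘(ℝ, E) (1 : G)).symm (mulInvariantVectorField u) (Set.range 𝓘(ℝ, E))
  have hA : A = fun u x =>
      (diffChInv G x).inverse (diffAt ((chInv x : G) * ·) 1 u) := by
    ext u x
    simp only [A, VectorField.mpullbackWithin_apply, modelWithCornersSelf_coe, Set.range_id,
      mfderivWithin_univ]
    rfl
  have h3 : VectorField.lieBracketWithin ℝ (A v) (A w)
      ((extChartAt 𝓘(ℝ, E) (1 : G)).symm ⁻¹' Set.univ ∩ Set.range 𝓘(ℝ, E)) (chOne G) =
      ad (E := E) G v w := by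
    rw [hA]
    exact lieBracketWithin_leftInvariant _ _
  have h4 : ((diffCh (1 : G) : E →L[ℝ] E)).inverse = ContinuousLinearMap.id ℝ E := by
    rw [diffCh_one, ContinuousLinearMap.inverse_id]
  exact (congrArg (fun L : E →L[ℝ] E => L _) h4).trans h3

end Bracket
end SymmetricLie

end

/-! ### `Ad` of an exponential and the differential of the exponential map. -/

noncomputable section

namespace SymmetricLie

open Filter Topology OpSeries
open NormedSpace (exp)

section AdExp

variable {E : Type*} [NormedAddCommGroup E] [NormedSpace ℝ E]
  {G : Type*} [TopologicalSpace G] [ChartedSpace E G] [Group G]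
  [LieGroup 𝓘(ℝ, E) ∞ G]

theorem ad_leibniz [CompleteSpace E] (u v w : E) :
    ad G u (ad G v w) = ad G (ad G u v) w + ad G v (ad G u w) := by
  have : LieGroup 𝓘(ℝ, E) (minSmoothness ℝ 3) G := LieGroup.of_le (n := ∞) (by simp; norm_cast)
  let B : E → E → E := fun x y =>
    (Bracket.bracket : GroupLieAlgebra 𝓘(ℝ, E) G → GroupLieAlgebra 𝓘(ℝ, E) G →
      GroupLieAlgebra 𝓘(ℝ, E) G) x y
  have hB : B = fun x y => ad G x y := funext fun x => funext fun y => bracket_eq_ad (G := G) x y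
  have h : ∀ x y z : E, B x (B y z) = B (B x y) z + B y (B x z) :=
    leibniz_lie (L₁ := GroupLieAlgebra 𝓘(ℝ, E) G) (L₂ := GroupLieAlgebra 𝓘(ℝ, E) G)
      (M := GroupLieAlgebra 𝓘(ℝ, E) G)
  rw [hB] at h
  exact h u v w

theorem ad_swap (v w : E) : ad G v w = -ad G w v := by simp [ad]

variable [IsTopologicalGroup G] [CompleteSpace E] [T2Space G]

/-- `t ↦ Ad (e^{tv})` is a one-parameter group with derivative `ad v` at `0`, so its product with
`e^{-t ad v}` has zero derivative. -/
theorem Ad_ex_smul (v : E) (t : ℝ) : (Ad (ex (t • v) : G) : E →L[ℝ] E) = exp (t • ad G v) := by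
  have h0 : HasDerivAt (fun h : ℝ => (Ad (ex (h • v) : G) : E →L[ℝ] E)) (ad G v) 0 := by
    have h1 := (hasLeftDeriv_ex_smul (G := G) v 0)
    have h2 : HasDerivAt (fun τ : ℝ => (ch (ex (τ • v) : G) : E)) v 0 := by
      simpa [ex_zero] using h1.2
    have h3 : HasDerivAt (fun h : ℝ => (Ad (chInv (ch (ex (h • v) : G) : E) : G) : E →L[ℝ] E))
        (ad G v) 0 :=
      HasFDerivAt.comp_hasDerivAt (l := fun x : E => (Ad (chInv x : G) : E →L[ℝ] E)) 0
        (by rw [zero_smul, ex_zero]; exact hasFDerivAt_Ad_chInv) h2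
    refine h3.congr_of_eventuallyEq ?_
    have h4 : Tendsto (fun h : ℝ => (ex (h • v) : G)) (𝓝 0) (𝓝 1) := by
      simpa [ContinuousAt, ex_zero] using h1.1
    filter_upwards [h4.eventually (eventually_chInv_ch (E := E))] with h hh
    rw [hh]
  have h1 : ∀ s : ℝ, HasDerivAt (fun h : ℝ => (Ad (ex (h • v) : G) : E →L[ℝ] E))
      (ad G v * Ad (ex (s • v) : G)) s := by
    intro s
    have h2 : HasDerivAt (fun h : ℝ => (Ad (ex ((h - s) • v) : G) : E →L[ℝ] E)) (ad G v) s := by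
      have := HasDerivAt.comp_sub_const s s (by rwa [sub_self] : HasDerivAt
        (fun h : ℝ => (Ad (ex (h • v) : G) : E →L[ℝ] E)) (ad G v) (s - s))
      exact this
    convert! h2.mul_const (Ad (ex (s • v) : G) : E →L[ℝ] E) using 2 with h
    rw [ContinuousLinearMap.mul_def, ← Ad_mul, ← ex_add_smul, sub_add_cancel]
  have h2 : ∀ s : ℝ, HasDerivAt (fun h : ℝ => exp (h • -ad G v) *
      (Ad (ex (h • v) : G) : E →L[ℝ] E)) 0 s := by
    intro s
    have h3 := (hasDerivAt_exp_smul_const (-ad G v) s).mul (h1 s)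
    convert! h3 using 1
    noncomm_ring
  have h3 := is_const_of_deriv_eq_zero (fun s => (h2 s).differentiableAt) (fun s => (h2 s).deriv) t 0
  simp only [zero_smul, ex_zero, Ad_one, NormedSpace.exp_zero] at h3
  have h4 : exp (t • -ad G v) * (Ad (ex (t • v) : G) : E →L[ℝ] E) = 1 := h3
  have h5 := congrArg (exp (t • ad G v) * ·) h4
  simp only [smul_neg, ← mul_assoc, exp_mul_exp_neg, one_mul, mul_one] at h5
  exact h5

theorem Ad_ex (v : E) : (Ad (ex v : G) : E →L[ℝ] E) = exp (ad G v) := by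
  simpa using Ad_ex_smul (G := G) v 1

theorem diffAt_hom_Ad {f : G →* G} (hf : ContMDiff 𝓘(ℝ, E) 𝓘(ℝ, E) ∞ f) (g : G) (v : E) :
    diffAt f 1 (Ad g v) = Ad (f g) (diffAt f 1 v) := by
  have hf' : MDifferentiable 𝓘(ℝ, E) 𝓘(ℝ, E) f := hf.mdifferentiable (by simp)
  have hc : ∀ g : G, MDifferentiable 𝓘(ℝ, E) 𝓘(ℝ, E) fun h : G => g * h * g⁻¹ := fun g =>
    (contMDiff_conj E g).mdifferentiable (by simp)
  have h1 := diffAt_comp (E := E) (x := (1 : G)) (g := f) (hf' _) (hc g 1) v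
  have h2 := diffAt_comp (E := E) (x := (1 : G)) (f := f) (hc (f g) _) (hf' 1) v
  have h3 : (f ∘ fun h : G => g * h * g⁻¹) = (fun h : G => f g * h * (f g)⁻¹) ∘ f := by
    ext h; simp
  rw [h3, h2, map_one, mul_one, mul_inv_cancel] at h1
  exact h1.symm

/-- Derivative at `t = 0` of the equivariance `f_* (Ad (e^{tv}) w) = Ad (f (e^{tv})) (f_* w)`. -/
theorem diffAt_hom_ad {f : G →* G} (hf : ContMDiff 𝓘(ℝ, E) 𝓘(ℝ, E) ∞ f) (v w : E) :
    diffAt f 1 (ad G v w) = ad G (diffAt f 1 v) (diffAt f 1 w) := by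
  have h1 : ∀ t : ℝ, diffAt f 1 (exp (t • ad G v) w) =
      exp (t • ad G (diffAt f 1 v)) (diffAt f 1 w) := by
    intro t
    rw [← Ad_ex_smul, ← Ad_ex_smul, diffAt_hom_Ad hf, map_ex hf]
    congr 3
    exact map_smul (diffAt f 1 : E →L[ℝ] E) t v
  have h2 : ∀ (T : E →L[ℝ] E) (x : E), HasDerivAt (fun t : ℝ => exp (t • T) x) (T x) 0 := by
    intro T x
    have := (hasDerivAt_exp_smul T 0).clm_apply (hasDerivAt_const (0 : ℝ) x)
    simpa using this
  have h3 := (diffAt f 1 : E →L[ℝ] E).hasFDerivAt.comp_hasDerivAt (0 : ℝ) (h2 (ad G v) w)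
  have h4 := h2 (ad G (diffAt f 1 v)) (diffAt f 1 w)
  exact h3.unique (h4.congr_of_eventuallyEq (Eventually.of_forall h1))

/-- A curve starting at the identity whose left logarithmic derivative `a` is small is, up to a
quadratic error, the integral of `a`. -/
theorem exists_evolution_estimate : ∃ r > 0, ∃ C : ℝ, 0 ≤ C ∧ ∀ (f : ℝ → G) (a b : ℝ → E) (ε : ℝ),
    f 0 = 1 → (∀ s, HasLeftDeriv f (a s) s) → (∀ s, HasDerivAt b (a s) s) →
    (∀ s ∈ Set.Icc (0 : ℝ) 1, ‖a s‖ ≤ ε) → ε ≤ r →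
    chInv (ch (f 1) : E) = f 1 ∧ ‖ch (f 1) - chOne G - (b 1 - b 0)‖ ≤ C * ε ^ 2 := by
  have hL := ((contDiffAt_leftMulCh (E := E) (G := G)).differentiableAt (by simp)).hasFDerivAt
  obtain ⟨L, hL0, hL1⟩ := hL.isBigO_sub.exists_nonneg
  have hL2 := hL1.bound
  have hcont : ∀ᶠ x in 𝓝 (chOne G : E), ‖leftMulCh G x‖ < 2 := by
    have h1 : ‖leftMulCh G (chOne G : E)‖ < 2 := by
      rw [leftMulCh_chOne]
      exact ContinuousLinearMap.norm_id_le.trans_lt one_lt_two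
    exact hL.continuousAt.norm.eventually_lt_const h1
  obtain ⟨W, hW, hWc, hWP⟩ := exists_mem_nhds_isClosed_subset
    (((eventually_hasDerivAt_ch (E := E) (G := G)).and (eventually_chInv_ch (E := E))).and
      (tendsto_ch.eventually (hL2.and hcont)))
  obtain ⟨ρ, hρ, hball⟩ := Metric.eventually_nhds_iff_ball.1
    ((tendsto_chInv (E := E) (G := G)).eventually (interior_mem_nhds.2 hW))
  -- While the curve stays in `W` it moves at most `2ε ≤ ρ / 2` in the chart, hence inside the
  -- `ρ`-ball. The constant `2 * L` comes from `‖L_x - id‖ ≤ L * 2ε` multiplied by `‖a‖ ≤ ε`.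
  refine ⟨ρ / 4, by positivity, 2 * L, by positivity, fun f a b ε h0 hf hb ha hε => ?_⟩
  have hε0 : 0 ≤ ε := (norm_nonneg _).trans (ha 0 (by simp))
  have hfc : Continuous f := continuous_iff_continuousAt.2 fun s => (hf s).1
  have hstep : ∀ s : ℝ, 0 ≤ s → s ≤ 1 → (∀ τ ∈ Set.Icc 0 s, f τ ∈ W) →
      ‖(ch (f s) : E) - chOne G‖ ≤ 2 * ε := by
    intro s hs0 hs1 hs
    have h1 := (convex_Icc 0 s).norm_image_sub_le_of_norm_hasDerivWithin_le (C := 2 * ε)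
      (f := fun τ => (ch (f τ) : E)) (fun τ hτ =>
        ((hWP (hs τ hτ)).1.1 f (a τ) τ rfl (hf τ)).hasDerivWithinAt)
      (fun τ hτ => (ContinuousLinearMap.le_opNorm _ _).trans (by
        have := ha τ ⟨hτ.1, hτ.2.trans hs1⟩
        have := (hWP (hs τ hτ)).2.2.le
        gcongr)) (Set.left_mem_Icc.2 hs0) (Set.right_mem_Icc.2 hs0)
    rw [h0] at h1
    refine h1.trans ?_
    rw [sub_zero, Real.norm_eq_abs, abs_of_nonneg hs0]
    exact mul_le_of_le_one_right (by positivity) hs1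
  -- First-exit argument: up to and including the first time outside the interior of `W` the curve
  -- lies in the closed set `W`, where the displacement bound puts it back in the interior.
  have hmem : ∀ s ∈ Set.Icc (0 : ℝ) 1, f s ∈ interior W := by
    by_contra! hcon
    obtain ⟨s₀, hs₀, hs₀'⟩ := hcon
    let A : Set ℝ := Set.Icc 0 1 ∩ f ⁻¹' (interior W)ᶜ
    have hA : IsCompact A := isCompact_Icc.inter_right
      ((isOpen_interior.isClosed_compl).preimage hfc)
    have hAne : A.Nonempty := ⟨s₀, hs₀, hs₀'⟩
    obtain ⟨⟨hs0, hs1⟩, hs2⟩ := hA.sInf_mem hAne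
    set s := sInf A
    have hlt : ∀ τ ∈ Set.Ico 0 s, f τ ∈ interior W := by
      intro τ hτ
      by_contra h
      exact (not_le.2 hτ.2) (csInf_le hA.bddBelow ⟨⟨hτ.1, hτ.2.le.trans hs1⟩, h⟩)
    have hspos : 0 < s := by
      rcases hs0.eq_or_lt with h | h
      · rw [Set.mem_preimage, ← h, h0] at hs2
        exact absurd (mem_interior_iff_mem_nhds.2 hW) hs2
      · exact h
    have hcl : Set.Icc 0 s ⊆ f ⁻¹' W := by
      rw [← closure_Ico hspos.ne]
      exact closure_minimal (fun τ hτ => interior_subset (s := W) (hlt τ hτ)) (hWc.preimage hfc)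
    refine hs2 ?_
    have h1 := hball (ch (f s)) (by
      rw [mem_ball_iff_norm]
      exact (hstep s hs0 hs1 hcl).trans_lt (by linarith))
    rwa [(hWP (hcl (Set.right_mem_Icc.2 hs0))).1.2] at h1
  have hmem' : ∀ s ∈ Set.Icc (0 : ℝ) 1, f s ∈ W := fun s hs => interior_subset (hmem s hs)
  refine ⟨(hWP (hmem' 1 (by simp))).1.2, ?_⟩
  have h1 := (convex_Icc (0 : ℝ) 1).norm_image_sub_le_of_norm_hasDerivWithin_le (C := 2 * L * ε ^ 2)
      (f := fun τ => (ch (f τ) : E) - b τ) (fun τ hτ =>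
        (((hWP (hmem' τ hτ)).1.1 f (a τ) τ rfl (hf τ)).sub (hb τ)).hasDerivWithinAt)
      (fun τ hτ => by
        have h2 := (hWP (hmem' τ hτ)).2.1
        rw [leftMulCh_chOne] at h2
        have h3 := hstep τ hτ.1 hτ.2 fun x hx => hmem' x ⟨hx.1, hx.2.trans hτ.2⟩
        have h4 : leftMulCh G (ch (f τ)) (a τ) - a τ =
          (leftMulCh G (ch (f τ)) - ContinuousLinearMap.id ℝ E : E →L[ℝ] E) (a τ) := by simp
        rw [h4]
        refine (ContinuousLinearMap.le_opNorm _ _).trans ?_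
        calc _ ≤ L * (2 * ε) * ε := by
              gcongr
              · exact h2.trans (by gcongr)
              · exact ha τ hτ
          _ = 2 * L * ε ^ 2 := by ring)
      (Set.left_mem_Icc.2 zero_le_one) (Set.right_mem_Icc.2 zero_le_one)
  rw [h0, sub_zero, norm_one, mul_one] at h1
  refine le_trans (le_of_eq ?_) h1
  congr 1
  change _ = (_ - b 1) - (chOne G - b 0)
  abel

/-- The curve `e^{s(v+w)} e^{-sv}` has left logarithmic derivative `e^{s ad v} w`, of size `O(‖w‖)`
uniformly for `‖v‖ ≤ R`, and the integral of this over `[0, 1]` is `theta (ad v) w`. -/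
theorem exists_ex_estimate (R : ℝ) : ∃ δ > 0, ∃ C : ℝ, 0 ≤ C ∧ ∀ v w : E, ‖v‖ ≤ R → ‖w‖ ≤ δ →
    chInv (ch (ex (v + w) * (ex v)⁻¹ : G) : E) = (ex (v + w) * (ex v)⁻¹ : G) ∧
    ‖ch (ex (v + w) * (ex v)⁻¹ : G) - chOne G - theta (ad G v) w‖ ≤ C * ‖w‖ ^ 2 := by
  obtain ⟨r, hr, C, hC, h⟩ := exists_evolution_estimate (E := E) (G := G)
  obtain ⟨L, hL, hexp⟩ := exists_lipschitz_exp (V := E) (‖ad (E := E) G‖ * |R|)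
  let M := L * (‖ad (E := E) G‖ * |R|) + 1
  have hM : 0 < M := by positivity
  have hexpM : ∀ (v : E), ‖v‖ ≤ R → ∀ s ∈ Set.Icc (0 : ℝ) 1, ‖exp (s • ad G v)‖ ≤ M := by
    intro v hv s hs
    have h1 : ‖s • ad G v‖ ≤ ‖ad (E := E) G‖ * |R| := by
      rw [norm_smul, Real.norm_eq_abs, abs_of_nonneg hs.1]
      refine (mul_le_of_le_one_left (norm_nonneg _) hs.2).trans ?_
      exact (ContinuousLinearMap.le_opNorm _ _).trans (by gcongr; exact hv.trans (le_abs_self R))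
    have h2 := hexp (s • ad G v) 0 h1 (by simp; positivity)
    rw [NormedSpace.exp_zero, sub_zero] at h2
    have h3 : exp (s • ad G v) = (exp (s • ad G v) - 1) + 1 := by abel
    rw [h3]
    refine (norm_add_le _ _).trans (add_le_add (h2.trans (by gcongr)) ContinuousLinearMap.norm_id_le)
  refine ⟨r / M, by positivity, C * M ^ 2, by positivity, fun v w hv hw => ?_⟩
  obtain ⟨b, hb0, hb1, hb⟩ := exists_hasDerivAt_exp_smul_theta (ad G v)
  have h1 := h (fun s => ex (s • (v + w)) * (ex (s • v))⁻¹) (fun s => exp (s • ad G v) w)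
    (fun s => b s w) (M * ‖w‖) (by simp [ex_zero]) (fun s => by
      have h2 := (hasLeftDeriv_ex_smul (G := G) (v + w) s).mul
        (hasLeftDeriv_ex_smul (G := G) v s).inv
      rw [inv_inv, ← sub_eq_add_neg, ← map_sub, add_sub_cancel_left, Ad_ex_smul] at h2
      exact h2)
    (fun s => by
      have := (hb s).clm_apply (hasDerivAt_const s w)
      simpa using this)
    (fun s hs => (ContinuousLinearMap.le_opNorm _ _).trans (by gcongr; exact hexpM v hv s hs))
    (by rw [← le_div_iff₀' hM]; exact hw)
  simp only [one_smul, hb0, hb1, zero_apply, sub_zero] at h1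
  rwa [mul_pow, ← mul_assoc] at h1

/-- Both points vary, as strict differentiability requires: the error is quadratic in `p.1 - p.2`
with a uniform constant, and continuity of `theta` replaces the moving base point `p.2` by `a`. -/
theorem tendsto_ex_mul_ex_inv (a : E) :
    Tendsto (fun p : E × E => (ex p.1 * (ex p.2)⁻¹ : G)) (𝓝 (a, a)) (𝓝 1) ∧
    (fun p : E × E => ch (ex p.1 * (ex p.2)⁻¹ : G) - chOne G - theta (ad G a) (p.1 - p.2))
      =o[𝓝 (a, a)] fun p => p.1 - p.2 := by
  obtain ⟨δ, hδ, C, hC, h⟩ := exists_ex_estimate (E := E) (G := G) (‖a‖ + 1)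
  have hsub : Tendsto (fun p : E × E => p.1 - p.2) (𝓝 (a, a)) (𝓝 0) := by
    have : Continuous fun p : E × E => p.1 - p.2 := by fun_prop
    simpa using this.tendsto (a, a)
  have hth : Tendsto (fun p : E × E => theta (ad G p.2) - theta (ad G a)) (𝓝 (a, a)) (𝓝 0) := by
    have : Continuous fun p : E × E => theta (ad G p.2) - theta (ad G a) :=
      (continuous_theta.comp ((ad G).continuous.comp continuous_snd)).sub continuous_const
    simpa using this.tendsto (a, a)
  have hev : ∀ᶠ p : E × E in 𝓝 (a, a),
      chInv (ch (ex p.1 * (ex p.2)⁻¹ : G) : E) = (ex p.1 * (ex p.2)⁻¹ : G) ∧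
      ‖ch (ex p.1 * (ex p.2)⁻¹ : G) - chOne G - theta (ad G p.2) (p.1 - p.2)‖ ≤
        C * ‖p.1 - p.2‖ ^ 2 := by
    have h1 : ∀ᶠ p : E × E in 𝓝 (a, a), ‖p.2‖ < ‖a‖ + 1 :=
      (continuous_snd.norm.tendsto (a, a)).eventually_lt_const (by simp)
    have h2 : ∀ᶠ p : E × E in 𝓝 (a, a), ‖p.1 - p.2‖ < δ :=
      hsub.norm.eventually_lt_const (by simpa using hδ)
    filter_upwards [h1, h2] with p hp1 hp2
    have h3 := h p.2 (p.1 - p.2) hp1.le hp2.le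
    rwa [add_sub_cancel] at h3
  have ho1 : (fun p : E × E => ch (ex p.1 * (ex p.2)⁻¹ : G) - chOne G -
      theta (ad G p.2) (p.1 - p.2)) =o[𝓝 (a, a)] fun p => p.1 - p.2 := by
    have h1 : (fun p : E × E => ch (ex p.1 * (ex p.2)⁻¹ : G) - chOne G -
      theta (ad G p.2) (p.1 - p.2)) =O[𝓝 (a, a)] fun p => ‖p.1 - p.2‖ ^ 2 :=
      Asymptotics.IsBigO.of_bound C (hev.mono fun p hp => by simpa using hp.2)
    refine h1.trans_isLittleO ?_
    have h2 : (fun p : E × E => ‖p.1 - p.2‖) =o[𝓝 (a, a)] fun _ => (1 : ℝ) :=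
      (Asymptotics.isLittleO_one_iff ℝ).2 (by simpa using hsub.norm)
    have h3 := h2.mul_isBigO (Asymptotics.isBigO_refl (fun p : E × E => ‖p.1 - p.2‖) (𝓝 (a, a)))
    simpa [← sq] using h3.norm_right
  have ho2 : (fun p : E × E => (theta (ad G p.2) - theta (ad G a)) (p.1 - p.2))
      =o[𝓝 (a, a)] fun p => p.1 - p.2 := by
    have h2 : (fun p : E × E => ‖theta (ad G p.2) - theta (ad G a)‖) =o[𝓝 (a, a)]
        fun _ => (1 : ℝ) :=
      (Asymptotics.isLittleO_one_iff ℝ).2 (by simpa using hth.norm)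
    have h3 := h2.mul_isBigO (Asymptotics.isBigO_refl (fun p : E × E => ‖p.1 - p.2‖) (𝓝 (a, a)))
    refine (Asymptotics.IsBigO.of_bound 1 (Eventually.of_forall fun p => ?_)).trans_isLittleO
      (by simpa using h3.norm_right)
    simpa using ContinuousLinearMap.le_opNorm (theta (ad G p.2) - theta (ad G a)) (p.1 - p.2)
  have ho : (fun p : E × E => ch (ex p.1 * (ex p.2)⁻¹ : G) - chOne G - theta (ad G a) (p.1 - p.2))
      =o[𝓝 (a, a)] fun p => p.1 - p.2 := by
    refine (ho1.add ho2).congr_left fun p => ?_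
    simp only [sub_apply]
    abel
  refine ⟨?_, ho⟩
  have h1 : Tendsto (fun p : E × E => (ch (ex p.1 * (ex p.2)⁻¹ : G) : E)) (𝓝 (a, a))
      (𝓝 (chOne G)) := by
    have h2 := (ho.trans_tendsto hsub).add (((theta (ad G a)).continuous.tendsto _).comp hsub)
    have h3 := h2.add_const (chOne G)
    simpa [Function.comp_def] using h3
  exact (tendsto_chInv.comp h1).congr' (hev.mono fun p hp => hp.1)

theorem continuous_ex : Continuous (ex : E → G) := by
  rw [continuous_iff_continuousAt]
  intro a
  have h1 : Tendsto (fun x : E => (x, a)) (𝓝 a) (𝓝 (a, a)) :=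
    (continuous_id.prodMk continuous_const).tendsto a
  have h2 := (((tendsto_ex_mul_ex_inv (G := G) a).1.comp h1).mul_const (ex a))
  simpa [Function.comp_def, ContinuousAt] using h2

/-- The differential of the exponential map. -/
theorem hasStrictFDerivAt_ex {a : E} {g₁ g₂ : G} (h : g₁ * ex a * g₂ = 1) :
    HasStrictFDerivAt (fun x : E => (ch (g₁ * ex x * g₂) : E)) (Ad g₁ ∘L theta (ad G a)) a := by
  obtain ⟨hq, ho⟩ := tendsto_ex_mul_ex_inv (G := G) a
  have hO1 : (fun p : E × E => (ch (ex p.1 * (ex p.2)⁻¹ : G) - chOne G : E)) =O[𝓝 (a, a)]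
      fun p => p.1 - p.2 := by
    have h1 := ho.isBigO.add ((theta (ad G a)).isBigO_comp (fun p : E × E => p.1 - p.2) (𝓝 (a, a)))
    exact h1.congr_left fun p => by abel
  -- The factorization `g₁ e^x g₂ = (g₁ e^x e^{-y} g₁⁻¹) (g₁ e^y g₂)` puts the whole increment into
  -- the factor `K` near the identity; `H` below is the other factor.
  let K : E × E → E := fun p => ch (g₁ * (ex p.1 * (ex p.2)⁻¹) * g₁⁻¹ : G)
  have hK1 : (fun p => K p - chOne G - Ad g₁ (ch (ex p.1 * (ex p.2)⁻¹ : G) - chOne G))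
      =o[𝓝 (a, a)] fun p => p.1 - p.2 := by
    have h1 := ((hasStrictFDerivAt_conj (E := E) g₁).hasFDerivAt.isLittleO.comp_tendsto
      (tendsto_ch.comp hq)).trans_isBigO hO1
    refine h1.congr' ?_ EventuallyEq.rfl
    filter_upwards [hq.eventually (eventually_chInv_ch (E := E))] with p hp
    simp [K, hp, chInv_chOne]
    rfl
  have hK2 : (fun p => K p - chOne G - (Ad g₁ ∘L theta (ad G a)) (p.1 - p.2))
      =o[𝓝 (a, a)] fun p => p.1 - p.2 := by
    have h1 := ((Ad g₁ : E →L[ℝ] E).isBigO_comp _ (𝓝 (a, a))).trans_isLittleO ho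
    refine (hK1.add h1).congr_left fun p => ?_
    simp only [map_sub, ContinuousLinearMap.comp_apply]
    abel
  have hO2 : (fun p => K p - chOne G) =O[𝓝 (a, a)] fun p => p.1 - p.2 := by
    have h1 := hK2.isBigO.add
      ((Ad g₁ ∘L theta (ad G a)).isBigO_comp (fun p : E × E => p.1 - p.2) (𝓝 (a, a)))
    exact h1.congr_left fun p => by abel
  let H : E × E → E := fun p => (ch (g₁ * ex p.2 * g₂) : E)
  have hHG : Tendsto (fun p : E × E => g₁ * (ex p.2 : G) * g₂) (𝓝 (a, a)) (𝓝 1) := by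
    have h1 : Continuous fun p : E × E => g₁ * (ex p.2 : G) * g₂ :=
      (continuous_const.mul (continuous_ex.comp continuous_snd)).mul continuous_const
    simpa [h] using h1.tendsto (a, a)
  have hKG : Tendsto (fun p : E × E => g₁ * (ex p.1 * (ex p.2)⁻¹ : G) * g₁⁻¹) (𝓝 (a, a))
      (𝓝 1) := by
    simpa using (hq.const_mul g₁).mul_const g₁⁻¹
  have hKH : Tendsto (fun p => ((K p, H p), ((chOne G : E), H p))) (𝓝 (a, a))
      (𝓝 (((chOne G : E), (chOne G : E)), ((chOne G : E), (chOne G : E)))) :=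
    ((tendsto_ch.comp hKG).prodMk_nhds (tendsto_ch.comp hHG)).prodMk_nhds
      (tendsto_const_nhds.prodMk_nhds (tendsto_ch.comp hHG))
  have h1 := (hasStrictFDerivAt_mulCh (E := E) (G := G)).isLittleO.comp_tendsto hKH
  have hO3 : (fun p => ((K p, H p) - ((chOne G : E), H p) : E × E)) =O[𝓝 (a, a)]
      fun p => p.1 - p.2 := by
    refine (hO2.prod_left (Asymptotics.isBigO_zero (E' := E) _ _)).congr_left fun p => ?_
    ext <;> simp
  have h2 := h1.trans_isBigO hO3
  refine HasStrictFDerivAt.of_isLittleO ((h2.add hK2).congr' ?_ EventuallyEq.rfl)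
  filter_upwards [hHG.eventually (eventually_chInv_ch (E := E)),
    hKG.eventually (eventually_chInv_ch (E := E))] with p hp1 hp2
  simp only [Function.comp_apply, mulCh, K, H, hp1, hp2, chInv_chOne, one_mul, Prod.mk_sub_mk,
    sub_self, add_apply, ContinuousLinearMap.coe_fst', ContinuousLinearMap.coe_snd', add_zero]
  have h3 : g₁ * (ex p.1 * (ex p.2)⁻¹) * g₁⁻¹ * (g₁ * ex p.2 * g₂) = g₁ * (ex p.1 : G) * g₂ := by
    group
  rw [h3]
  abel

end AdExp

end SymmetricLie

end

/-! ### The eigenspace `𝔭` and the differential of the exponential map of `M`. -/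

noncomputable section

namespace SymmetricLie

open Filter Topology OpSeries
open NormedSpace (exp)

section Symmetric

variable {E : Type*} [NormedAddCommGroup E] [NormedSpace ℝ E]
  {G : Type*} [TopologicalSpace G] [ChartedSpace E G] [Group G] (σ : Involution E G)

namespace Involution

/-- The differential of the involution at the identity, on the model space. -/
def dσ : E →L[ℝ] E := diffAt σ.toHom 1

/-- The subspace `𝔭`, as a subspace of the model space. -/
def pE : Submodule ℝ E := σ.p

theorem mem_pE {v : E} : v ∈ σ.pE ↔ σ.dσ v = -v := Iff.rfl

theorem dσ_dσ (v : E) : σ.dσ (σ.dσ v) = v := σ.diff_diff v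

theorem isClosed_pE : IsClosed (σ.pE : Set E) := by
  have h : (σ.pE : Set E) = {v | σ.dσ v = -v} := rfl
  rw [h]
  exact isClosed_eq σ.dσ.continuous continuous_neg

instance [CompleteSpace E] : CompleteSpace σ.pE := σ.isClosed_pE.completeSpace_coe

theorem half_sub_mem_pE (v : E) : (2 : ℝ)⁻¹ • (v - σ.dσ v) ∈ σ.pE := by
  rw [mem_pE, map_smul, map_sub, dσ_dσ, ← smul_neg, neg_sub]

/-- The projection onto `𝔭` along the fixed space of the involution. -/
def proj : E →L[ℝ] σ.pE :=
  ((2 : ℝ)⁻¹ • (ContinuousLinearMap.id ℝ E - σ.dσ)).codRestrict σ.pE σ.half_sub_mem_pE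

theorem coe_proj (v : E) : (σ.proj v : E) = (2 : ℝ)⁻¹ • (v - σ.dσ v) := rfl

theorem proj_coe (v : σ.pE) : σ.proj v = v := by
  ext
  rw [coe_proj, σ.mem_pE.1 v.2, sub_neg_eq_add, ← two_smul ℝ, smul_smul]
  norm_num

theorem proj_of_mem {v : E} (hv : v ∈ σ.pE) : (σ.proj v : E) = v :=
  congrArg Subtype.val (σ.proj_coe ⟨v, hv⟩)

variable [LieGroup 𝓘(ℝ, E) ∞ G] [IsTopologicalGroup G] [CompleteSpace E] [T2Space G]

theorem dσ_Ad (g : G) (v : E) : σ.dσ (Ad g v) = Ad (σ.toHom g) (σ.dσ v) :=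
  diffAt_hom_Ad σ.smooth g v

theorem Ad_mem_pE {k : G} (hk : σ.toHom k = k) {v : E} (hv : v ∈ σ.pE) : Ad k v ∈ σ.pE := by
  rw [mem_pE, dσ_Ad, hk, σ.mem_pE.1 hv, map_neg]

theorem map_ex (v : E) : σ.toHom (ex v) = ex (σ.dσ v) := SymmetricLie.map_ex σ.smooth v

theorem map_ex_of_mem {v : E} (hv : v ∈ σ.pE) : σ.toHom (ex v) = (ex v)⁻¹ := by
  rw [map_ex, σ.mem_pE.1 hv, ex_neg]

theorem dσ_ad (v w : E) : σ.dσ (ad G v w) = ad G (σ.dσ v) (σ.dσ w) :=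
  diffAt_hom_ad σ.smooth v w

theorem ad_ad_mem_pE {u v w : E} (hu : u ∈ σ.pE) (hv : v ∈ σ.pE) (hw : w ∈ σ.pE) :
    ad G u (ad G v w) ∈ σ.pE := by
  rw [mem_pE, dσ_ad, dσ_ad, σ.mem_pE.1 hu, σ.mem_pE.1 hv, σ.mem_pE.1 hw]
  simp

theorem sinhc_mem_pE {v w : E} (hv : v ∈ σ.pE) (hw : w ∈ σ.pE) : sinhc (ad G v) w ∈ σ.pE :=
  sinhc_apply_mem σ.isClosed_pE (fun _ hx => σ.ad_ad_mem_pE hv hv hx) hw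

theorem dσ_comp_ad {v : E} (hv : v ∈ σ.pE) : σ.dσ * ad G v = -ad G v * σ.dσ := by
  ext w
  have h := σ.dσ_ad v w
  rw [σ.mem_pE.1 hv] at h
  simpa using h

theorem dσ_theta {v w : E} (hv : v ∈ σ.pE) :
    σ.dσ (theta (ad G v) w) = theta (-ad G v) (σ.dσ w) :=
  expBounded_theta.intertwine (σ.dσ_comp_ad hv) w

/-- `σ_*` exchanges `ad v` with `-ad v` and negates `w`, so the projection averages `θ(-ad v) w` and
`θ(ad v) w`, leaving the even part of the series. -/
theorem proj_theta_neg {v w : E} (hv : v ∈ σ.pE) (hw : w ∈ σ.pE) :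
    (σ.proj (theta (-ad G v) w) : E) = sinhc (ad G v) w := by
  have h1 := σ.dσ_theta (w := w) (σ.pE.neg_mem hv)
  rw [map_neg, neg_neg, σ.mem_pE.1 hw, map_neg] at h1
  have h2 := congrArg (fun T : E →L[ℝ] E => T w) (theta_add_theta_neg (ad G v))
  simp only [add_apply, smul_apply] at h2
  rw [coe_proj, h1, sub_neg_eq_add, add_comm, h2, smul_smul]
  norm_num

theorem leftVelocity_eq {c : ℝ → G} {u : E} (hc : HasLeftDeriv c u 0) :
    leftVelocity (E := E) c = u := by
  let L : ℝ →L[ℝ] E := ContinuousLinearMap.toSpanSingleton ℝ u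
  have h1 : HasMFDerivAt 𝓘(ℝ, ℝ) 𝓘(ℝ, E) (fun t : ℝ => (c 0)⁻¹ * c t) 0 L := by
    refine ⟨hc.1.const_mul _, ?_⟩
    have h3 : writtenInExtChartAt 𝓘(ℝ, ℝ) 𝓘(ℝ, E) 0 (fun t : ℝ => (c 0)⁻¹ * c t) =
        fun τ => (ch ((c 0)⁻¹ * c τ) : E) := by
      ext τ
      simp only [writtenInExtChartAt, inv_mul_cancel]
      rfl
    have h4 : HasFDerivWithinAt (fun τ => (ch ((c 0)⁻¹ * c τ) : E)) L (Set.range 𝓘(ℝ, ℝ))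
        (extChartAt 𝓘(ℝ, ℝ) (0 : ℝ) 0) := by
      exact (hasDerivAt_iff_hasFDerivAt.1 hc.2).hasFDerivWithinAt
    rw [h3]
    exact h4
  have h2 : (show ℝ →L[ℝ] E from mfderiv 𝓘(ℝ, ℝ) 𝓘(ℝ, E) (fun t : ℝ => (c 0)⁻¹ * c t) 0) = L :=
    h1.mfderiv
  refine (congrArg (fun L : ℝ →L[ℝ] E => L 1) h2).trans ?_
  simp [L]

/-- The left velocity of `g e^{v+tw}` is `e^{-ad v} θ(ad v) w = θ(-ad v) w`, whatever `g` is. This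
turns the curvature hypothesis into a statement on `sinhc`. -/
theorem expDifferential_eq (g : G) (v w : σ.pE) :
    (show σ.pE from σ.expDifferential g v w) =
      ⟨sinhc (ad G (v : E)) w, σ.sinhc_mem_pE v.2 w.2⟩ := by
  have h1 : HasLeftDeriv (fun t : ℝ => g * (ex (v + t • w : E) : G)) (theta (-ad G (v : E)) w) 0 := by
    refine HasLeftDeriv.const_mul g ⟨?_, ?_⟩
    · exact (continuous_ex.comp (by fun_prop)).continuousAt
    · have h2 := (hasStrictFDerivAt_ex (E := E) (G := G) (a := v) (g₁ := (ex (v : E))⁻¹) (g₂ := 1)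
        (by simp)).hasFDerivAt
      have h3 : HasDerivAt (fun t : ℝ => (v + t • w : E)) w 0 := by
        simpa using ((hasDerivAt_id (0 : ℝ)).smul_const (w : E)).const_add (v : E)
      have h4 := HasFDerivAt.comp_hasDerivAt (0 : ℝ) (f := fun t : ℝ => (v + t • w : E))
        (l := fun x : E => (ch ((ex (v : E))⁻¹ * ex x * 1 : G) : E)) (by simpa using h2) h3
      rw [← ex_neg, Ad_ex, map_neg, ← ContinuousLinearMap.mul_def, exp_neg_mul_theta] at h4
      simpa [Function.comp_def, ex_neg] using h4
  have h2 := congrArg σ.proj (leftVelocity_eq h1)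
  refine Eq.trans h2 (Subtype.ext ?_)
  exact σ.proj_theta_neg v.2 w.2

end Involution

end Symmetric

end SymmetricLie

end

/-! ### The quadratic representation `q(g) ↦ g σ(g)⁻¹` and its local coordinates. -/

noncomputable section

namespace SymmetricLie

open Filter Topology OpSeries
open NormedSpace (exp)

namespace Involution

section Lifts

variable {E : Type*} [NormedAddCommGroup E] [NormedSpace ℝ E]
  {G : Type*} [TopologicalSpace G] [ChartedSpace E G] [Group G] (σ : Involution E G)
  [LieGroup 𝓘(ℝ, E) ∞ G] [IsTopologicalGroup G] [CompleteSpace E] [T2Space G]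

/-- The operator `F(ad v) = sinh (ad v) / ad v` on `𝔭`, for `v ∈ 𝔭`. -/
def sinhcP (v : σ.pE) : σ.pE →L[ℝ] σ.pE :=
  (sinhc (ad G (v : E)) ∘L σ.pE.subtypeL).codRestrict σ.pE fun w => σ.sinhc_mem_pE v.2 w.2

theorem coe_sinhcP (v w : σ.pE) : (σ.sinhcP v w : E) = sinhc (ad G (v : E)) w := rfl

/-- The local coordinates `½ proj (ch (a₁⁻¹ g a₁⁻¹))` with `a₁ = ex a`, centred at `g = a₁ ^ 2`. -/
def polarCh (a : σ.pE) (g : G) : σ.pE :=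
  (2 : ℝ)⁻¹ • σ.proj (ch ((ex (a : E))⁻¹ * g * (ex (a : E))⁻¹))

/-- The chain rule gives `Ad (e^{-a}) θ(2 ad a)`, which is `sinhc (ad a)`; the factor `½` of the
coordinates cancels the `2` of `e^{2x}`. -/
theorem hasStrictFDerivAt_polarCh (a : σ.pE) :
    HasStrictFDerivAt (fun x : σ.pE => σ.polarCh a (ex ((2 : ℝ) • x : E))) (σ.sinhcP a) a := by
  have h1 := hasStrictFDerivAt_ex (E := E) (G := G) (a := (2 : ℝ) • (a : E))
    (g₁ := (ex (a : E))⁻¹) (g₂ := (ex (a : E))⁻¹) (by rw [ex_two_smul]; group)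
  have h2 := ((2 : ℝ) • σ.pE.subtypeL).hasStrictFDerivAt (x := a)
  have h3 := ((2 : ℝ)⁻¹ • σ.proj).hasStrictFDerivAt.comp a (HasStrictFDerivAt.comp a
    (g := fun x : E => (ch ((ex (a : E))⁻¹ * ex x * (ex (a : E))⁻¹ : G) : E))
    (f := fun x : σ.pE => (2 : ℝ) • (x : E)) h1 h2)
  convert! h3 using 1
  ext w
  have h4 : (Ad (ex (a : E) : G)⁻¹ : E →L[ℝ] E) (theta (ad G ((2 : ℝ) • (a : E))) w) =
      sinhc (ad G (a : E)) w := by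
    rw [← ex_neg, Ad_ex, map_neg, map_smul, ← exp_neg_mul_theta_two]
    rfl
  simp only [ContinuousLinearMap.comp_apply, smul_apply, map_smul (Ad _),
    map_smul (theta _), map_smul σ.proj, Submodule.subtypeL_apply, h4]
  rw [smul_smul, inv_mul_cancel₀ two_ne_zero, one_smul,
    σ.proj_of_mem (σ.sinhc_mem_pE a.2 w.2), coe_sinhcP]

theorem map_ex_mul_ex_mul_ex {v u : E} (hv : v ∈ σ.pE) (hu : u ∈ σ.pE) :
    σ.toHom (ex v * ex u * ex v) = (ex v * ex u * ex v)⁻¹ := by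
  simp only [map_mul, σ.map_ex_of_mem hv, σ.map_ex_of_mem hu, mul_inv_rev, mul_assoc]

/-- `g ↦ g σ(g)⁻¹` separates the cosets of `K`. It sends `e^x` to `e^{2x}` and `e^v e^u` to `e^v
e^{2u} e^v`, since `σ` inverts exponentials of `𝔭`. -/
theorem mk_ex_eq_mk_iff {x v u : E} (hx : x ∈ σ.pE) (hv : v ∈ σ.pE) (hu : u ∈ σ.pE) :
    ((ex x : G) : G ⧸ σ.K) = ((ex v * ex u : G) : G ⧸ σ.K) ↔
      (ex ((2 : ℝ) • x) : G) = ex v * ex ((2 : ℝ) • u) * ex v := by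
  have h : ((ex x : G)⁻¹ * (ex v * ex u) ∈ σ.K) ↔
      σ.toHom ((ex x : G)⁻¹ * (ex v * ex u)) = (ex x : G)⁻¹ * (ex v * ex u) := Iff.rfl
  rw [QuotientGroup.eq, h, map_mul, map_mul, map_inv, σ.map_ex_of_mem hx, σ.map_ex_of_mem hv,
    σ.map_ex_of_mem hu, ex_two_smul, ex_two_smul, inv_inv, eq_inv_mul_iff_mul_eq, ← mul_assoc,
    ← mul_assoc, mul_inv_eq_iff_eq_mul, mul_inv_eq_iff_eq_mul, ← mul_assoc]

/-- A neighbourhood of the identity on which the elements inverted by the involution are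
determined by their image under `proj ∘ ch`. -/
theorem exists_injOn_proj_ch : ∃ U ∈ 𝓝 (1 : G), ∀ g ∈ U, ∀ h ∈ U, σ.toHom g = g⁻¹ →
    σ.toHom h = h⁻¹ → σ.proj (ch g) = σ.proj (ch h) → g = h := by
  have h1 : HasStrictFDerivAt (fun x : E => (ch (ex x : G) : E))
      ((ContinuousLinearEquiv.refl ℝ E : E ≃L[ℝ] E) : E →L[ℝ] E) 0 := by
    have := hasStrictFDerivAt_ex (E := E) (G := G) (a := 0) (g₁ := 1) (g₂ := 1) (by simp [ex_zero])
    simp only [one_mul, mul_one, map_zero, theta_zero, Ad_one] at this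
    exact this
  have h2 : HasStrictFDerivAt (fun x : σ.pE => σ.proj (ch (ex (x : E) : G)))
      ((ContinuousLinearEquiv.refl ℝ σ.pE : σ.pE ≃L[ℝ] σ.pE) : σ.pE →L[ℝ] σ.pE) 0 := by
    have := σ.proj.hasStrictFDerivAt.comp (0 : σ.pE) (HasStrictFDerivAt.comp (0 : σ.pE)
      (g := fun x : E => (ch (ex x : G) : E)) (f := fun x : σ.pE => (x : E)) (by simpa using h1)
      σ.pE.subtypeL.hasStrictFDerivAt)
    convert! this using 1
    ext x
    simp [σ.proj_coe x]
  let Φ := h1.toOpenPartialHomeomorph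
  let Φ' := h2.toOpenPartialHomeomorph
  have hΦ : Φ.source ∈ 𝓝 (0 : E) :=
    Φ.open_source.mem_nhds h1.mem_toOpenPartialHomeomorph_source
  have hΦ' : Φ'.source ∈ 𝓝 (0 : σ.pE) :=
    Φ'.open_source.mem_nhds h2.mem_toOpenPartialHomeomorph_source
  obtain ⟨V, hV, hVΦ⟩ := mem_nhds_induced (Subtype.val : σ.pE → E) 0 Φ'.source |>.1 hΦ'
  have hlog : Tendsto (fun g : G => h1.localInverse _ _ _ (ch g : E)) (𝓝 1) (𝓝 0) := by
    have := h1.localInverse_tendsto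
    rw [ex_zero] at this
    exact this.comp tendsto_ch
  have hD : Tendsto (fun x : E => σ.dσ x) (𝓝 0) (𝓝 0) := by
    simpa using σ.dσ.continuous.tendsto 0
  have hN : Tendsto (fun x : E => -x) (𝓝 0) (𝓝 0) := by 
    simpa using (continuous_neg : Continuous fun x : E => -x).tendsto 0
  have hE : Tendsto (ex : E → G) (𝓝 0) (𝓝 1) := by 
    simpa [ex_zero] using (continuous_ex (E := E) (G := G)).tendsto 0
  have hright : ∀ᶠ g in 𝓝 (1 : G), ch (ex (h1.localInverse _ _ _ (ch g : E)) : G) = (ch g : E) := by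
    have := h1.eventually_right_inverse
    rw [ex_zero] at this
    exact tendsto_ch.eventually this
  have hex : ∀ᶠ g in 𝓝 (1 : G), σ.toHom g = g⁻¹ → ∃ x : σ.pE, x ∈ Φ'.source ∧ ex (x : E) = g := by
    filter_upwards [hlog.eventually hV, hlog.eventually (hD.eventually hΦ),
      hlog.eventually (hN.eventually hΦ), hright, eventually_chInv_ch (E := E) (G := G),
      hlog.eventually (hE.eventually (eventually_chInv_ch (E := E) (G := G)))]
      with g hg1 hg2 hg3 hg4 hg5 hg6 hg
    set x := h1.localInverse _ _ _ (ch g : E)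
    have hx : ex x = g := by rw [← hg6, hg4, hg5]
    -- With `x` the local logarithm of `g`, both `σ_* x` and `-x` are small logarithms of `σ(g) =
    -- g⁻¹`, hence equal.
    have hxp : x ∈ σ.pE := by
      refine Φ.injOn hg2 hg3 ?_
      change (ch (ex (σ.dσ x) : G) : E) = ch (ex (-x) : G)
      rw [← σ.map_ex, ex_neg, hx, hg]
    exact ⟨⟨x, hxp⟩, hVΦ hg1, hx⟩
  refine ⟨_, hex, fun g hg h hh h3 h4 h5 => ?_⟩
  obtain ⟨x, hx, rfl⟩ := hg h3
  obtain ⟨y, hy, rfl⟩ := hh h4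
  rw [Φ'.injOn hx hy h5]

end Lifts

end Involution

end SymmetricLie

end

/-! ### Lifts of geodesics: uniqueness, velocity, local existence. -/

noncomputable section

namespace SymmetricLie

open Filter Topology OpSeries
open NormedSpace (exp)

namespace Involution

section Lifts

variable {E : Type*} [NormedAddCommGroup E] [NormedSpace ℝ E]
  {G : Type*} [TopologicalSpace G] [ChartedSpace E G] [Group G] (σ : Involution E G)
  [LieGroup 𝓘(ℝ, E) ∞ G] [IsTopologicalGroup G] [CompleteSpace E] [T2Space G]

/-- The norm `N` on `𝔭` is equivalent to the given one and invariant under `Ad k`, `k ∈ K`, and the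
operators `F(ad a)`, `a ∈ 𝔭`, are invertible and do not decrease it. -/
structure IsExpanding (N : Seminorm ℝ σ.pE) : Prop where
  equiv : ∀ a, ∃ e : σ.pE ≃L[ℝ] σ.pE, (e : σ.pE →L[ℝ] σ.pE) = σ.sinhcP a
  le : ∀ a w, N w ≤ N (σ.sinhcP a w)
  invariant : ∀ k : G, σ.toHom k = k → ∀ v w : σ.pE, (w : E) = Ad k (v : E) → N w = N v
  norm_le : ∃ C, 0 ≤ C ∧ ∀ v, ‖v‖ ≤ C * N v
  le_norm : ∃ C, 0 ≤ C ∧ ∀ v, N v ≤ C * ‖v‖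

/-- The curve `t ↦ ex v * ex (2 t w) * ex v`, the image of the geodesic `t ↦ q (ex v * ex (t w))`
under the quadratic representation. -/
def geodesic (G : Type*) [TopologicalSpace G] [ChartedSpace E G] [Group G] (v w : E) (t : ℝ) : G :=
  ex v * ex ((2 : ℝ) • t • w) * ex v

theorem continuous_geodesic (v w : E) : Continuous (geodesic G v w) := by
  unfold geodesic
  exact (continuous_const.mul (continuous_ex.comp (by fun_prop))).mul continuous_const

theorem hasLeftDeriv_geodesic (v w : E) (t : ℝ) :
    HasLeftDeriv (geodesic G v w) (Ad (ex v : G)⁻¹ ((2 : ℝ) • w)) t := by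
  refine HasLeftDeriv.mul_const _ (HasLeftDeriv.const_mul _ ?_)
  simpa only [smul_comm _ (2 : ℝ)] using hasLeftDeriv_ex_smul (G := G) ((2 : ℝ) • w) t

theorem Ad_ex_smul_self (v : E) (t : ℝ) : Ad (ex (t • v) : G) v = v := by
  have h3 : ad G v v = 0 := by
    have h := ad_swap (G := G) v v
    rw [eq_neg_iff_add_eq_zero, ← two_smul ℝ] at h
    simpa using h
  have h1 : ∀ s : ℝ, HasDerivAt (fun s : ℝ => exp (s • ad G v) v) 0 s := by
    intro s
    have h2 := (hasDerivAt_exp_smul_const (𝕂 := ℝ) (ad G v) s).clm_apply (hasDerivAt_const s v)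
    convert! h2 using 1
    simp [h3]
  have h2 := is_const_of_deriv_eq_zero (fun s => (h1 s).differentiableAt)
    (fun s => (h1 s).deriv) t 0
  rw [Ad_ex_smul]
  simpa using h2

variable {σ} {N : Seminorm ℝ σ.pE} {v w : σ.pE}

theorem IsExpanding.isLocallyInjective (hN : σ.IsExpanding N) :
    IsLocallyInjective fun x : σ.pE => (ex ((2 : ℝ) • x : E) : G) := by
  intro a
  obtain ⟨e, he⟩ := hN.equiv a
  have h := σ.hasStrictFDerivAt_polarCh a
  rw [← he] at h
  refine ⟨h.toOpenPartialHomeomorph.source, h.toOpenPartialHomeomorph.open_source,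
    h.mem_toOpenPartialHomeomorph_source, fun x hx y hy hxy => ?_⟩
  exact h.toOpenPartialHomeomorph.injOn hx hy (congrArg (σ.polarCh a) hxy)

theorem IsExpanding.eqOn_of_lift (hN : σ.IsExpanding N) {S : Set ℝ} (hS : IsPreconnected S) {α β : ℝ → σ.pE} {γ : ℝ → G}
    (hα : ContinuousOn α S) (hβ : ContinuousOn β S)
    (hαγ : ∀ t ∈ S, ex ((2 : ℝ) • α t : E) = γ t) (hβγ : ∀ t ∈ S, ex ((2 : ℝ) • β t : E) = γ t)
    {t : ℝ} (ht : t ∈ S) (h : α t = β t) : Set.EqOn α β S :=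
  (T2Space.isSeparatedMap _).eqOn_of_comp_eqOn hN.isLocallyInjective hS hα hβ
    (fun s hs => (hαγ s hs).trans (hβγ s hs).symm) ht h

/-- In the coordinates at `a = β t` the lift is a local inverse applied to the differentiable curve
`e^v e^{2τw} e^v`, so it is differentiable and obeys `F(ad a) d = proj (Ad g w)` with `g = e^a
e^{-v}`. The speed bound follows because `F(ad a)` is expanding and the right-hand side has norm `N
w`. -/
theorem IsExpanding.hasDerivAt_lift (hN : σ.IsExpanding N) {β : ℝ → σ.pE} {t : ℝ} (hβ : ContinuousAt β t)
    (h : ∀ᶠ τ in 𝓝 t, ex ((2 : ℝ) • β τ : E) = geodesic G (v : E) w τ) :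
    ∃ d, HasDerivAt β d t ∧
      σ.sinhcP (β t) d = σ.proj (exp (ad G (β t : E)) (exp (-ad G (v : E)) w)) ∧ N d ≤ N w := by
  set a := β t with ha
  obtain ⟨e, he⟩ := hN.equiv a
  have hs := σ.hasStrictFDerivAt_polarCh a
  rw [← he] at hs
  have hat := h.self_of_nhds
  rw [← ha, ex_two_smul] at hat
  set g : G := ex (a : E) * (ex (v : E))⁻¹ with hg
  have h1 := ((hasLeftDeriv_geodesic (G := G) (v : E) w t).const_mul (ex (a : E))⁻¹).mul_const
    (ex (a : E))⁻¹
  rw [inv_inv, ← Ad_mul_apply, map_smul] at h1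
  have h2 : HasDerivAt (fun τ => σ.polarCh a (geodesic G (v : E) w τ)) (σ.proj (Ad g (w : E))) t := by
    have h3 : HasDerivAt (fun τ => (ch ((ex (a : E))⁻¹ * (geodesic G (v : E) w τ) *
        (ex (a : E))⁻¹ : G) : E)) ((2 : ℝ) • Ad g (w : E)) t := by
      have h4 := h1.2
      beta_reduce at h4
      have h5 : (ex (a : E) : G)⁻¹ * geodesic G (v : E) w t * (ex (a : E))⁻¹ = 1 := by
        rw [← hat]; group
      rw [h5, inv_one] at h4
      simpa only [one_mul] using h4
    have h4 := HasFDerivAt.comp_hasDerivAt t ((2 : ℝ)⁻¹ • σ.proj).hasFDerivAt h3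
    convert! h4 using 1
    simp [smul_smul]
  have h3 : HasDerivAt β (e.symm (σ.proj (Ad g (w : E)))) t := by
    have h4 : σ.polarCh a (geodesic G (v : E) w t) = σ.polarCh a (ex ((2 : ℝ) • a : E)) := by
      rw [ex_two_smul, hat]
    have h5 := hs.to_localInverse.hasFDerivAt
    rw [← h4] at h5
    refine (h5.comp_hasDerivAt t h2).congr_of_eventuallyEq ?_
    filter_upwards [h, hβ.eventually hs.eventually_left_inverse] with τ hτ1 hτ2
    rw [Function.comp_apply, ← hτ1]
    exact hτ2.symm
  have hfix : e (e.symm (σ.proj (Ad g (w : E)))) = σ.proj (Ad g (w : E)) :=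
    e.apply_symm_apply _
  have hek : σ.sinhcP a (e.symm (σ.proj (Ad g (w : E)))) = σ.proj (Ad g (w : E)) := by
    rw [← he]; exact hfix
  refine ⟨_, h3, ?_, ?_⟩
  · rw [hek, hg, Ad_mul_apply, ← ex_neg, Ad_ex, Ad_ex, map_neg]
  · refine (hN.le a _).trans ?_
    rw [hek]
    -- The element of `K` comparing the representatives `e^a` and `e^v e^{tw}` of one point of `M`.
    -- As `g = k e^{tw}` and `Ad (e^{tw})` fixes `w`, `Ad g w` is `Ad k w`.
    set k : G := (ex (a : E))⁻¹ * ex (v : E) * ex (t • w : E) with hk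
    have h6 : g = k * ex (t • w : E) := by
      rw [hg, hk, mul_inv_eq_iff_eq_mul, mul_assoc, mul_assoc, mul_assoc,
        eq_inv_mul_iff_mul_eq, hat, geodesic, ex_two_smul]
      simp only [mul_assoc]
    have h7 : σ.toHom k = k := by
      have h8 : σ.toHom k = g * (ex (t • w : E))⁻¹ := by
        rw [hk, map_mul, map_mul, map_inv, σ.map_ex_of_mem a.2, σ.map_ex_of_mem v.2,
          σ.map_ex_of_mem (σ.pE.smul_mem t w.2), inv_inv]
      rw [h8, h6, mul_inv_cancel_right]
    have h9 : Ad g (w : E) = Ad k (w : E) := by rw [h6, Ad_mul_apply, Ad_ex_smul_self]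
    rw [h9]
    exact (hN.invariant k h7 w _ (σ.proj_of_mem (σ.Ad_mem_pE h7 w.2))).le

/-- The inverse function theorem lifts `γ` only in the coordinates `polarCh`, which forget the
`𝔨`-part of the chart. Since `σ` inverts both `γ` and `e^{2β}`, that part carries no information
near the identity. -/
theorem IsExpanding.exists_local_lift (hN : σ.IsExpanding N) {γ : ℝ → G} (hγ : Continuous γ)
    (hσ : ∀ t, σ.toHom (γ t) = (γ t)⁻¹) {a : σ.pE} {t : ℝ} (h : ex ((2 : ℝ) • a : E) = γ t) :
    ∃ δ > 0, ∃ β : ℝ → σ.pE, β t = a ∧ ContinuousOn β (Metric.ball t δ) ∧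
      ∀ τ ∈ Metric.ball t δ, ex ((2 : ℝ) • β τ : E) = γ τ := by
  obtain ⟨e, he⟩ := hN.equiv a
  have hs := σ.hasStrictFDerivAt_polarCh a
  rw [← he] at hs
  obtain ⟨U, hU, hinj⟩ := σ.exists_injOn_proj_ch
  let Φ := hs.toOpenPartialHomeomorph
  let c : ℝ → G := fun τ => (ex (a : E))⁻¹ * γ τ * (ex (a : E))⁻¹
  have hc : Continuous c := (continuous_const.mul hγ).mul continuous_const
  have hct : c t = 1 := by
    simp only [c, ← h, ex_two_smul]
    group
  have hc1 : Tendsto c (𝓝 t) (𝓝 1) := hct ▸ hc.tendsto t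
  have hxt : σ.polarCh a (γ t) = Φ a := congrArg (σ.polarCh a) h.symm
  have hpol : ∀ᶠ τ in 𝓝 t, ContinuousAt (fun τ => σ.polarCh a (γ τ)) τ := by
    filter_upwards [hc1.eventually (eventually_continuousAt_ch (E := E) (G := G))] with τ hτ
    exact ((2 : ℝ)⁻¹ • σ.proj).continuous.continuousAt.comp
      (ContinuousAt.comp (f := c) (g := (ch : G → E)) hτ hc.continuousAt)
  have htar : ∀ᶠ τ in 𝓝 t, σ.polarCh a (γ τ) ∈ Φ.target := by
    refine hpol.self_of_nhds.eventually (Φ.open_target.mem_nhds ?_)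
    change σ.polarCh a (γ t) ∈ _
    rw [hxt]
    exact Φ.map_source hs.mem_toOpenPartialHomeomorph_source
  let β : ℝ → σ.pE := fun τ => Φ.symm (σ.polarCh a (γ τ))
  have hβt : β t = a := by
    simp only [β, hxt]
    exact Φ.left_inv hs.mem_toOpenPartialHomeomorph_source
  have hβ : ∀ᶠ τ in 𝓝 t, ContinuousAt β τ := by
    filter_upwards [hpol, htar] with τ h1 h2
    exact ContinuousAt.comp (f := fun τ => σ.polarCh a (γ τ)) (Φ.continuousAt_symm h2) h1
  have hβ1 : Tendsto (fun τ => (ex (a : E))⁻¹ * ex ((2 : ℝ) • β τ : E) * (ex (a : E))⁻¹ : ℝ → G)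
      (𝓝 t) (𝓝 1) := by
    have h2 : Tendsto (fun x : σ.pE => (ex (a : E))⁻¹ * ex ((2 : ℝ) • x : E) * (ex (a : E))⁻¹)
        (𝓝 a) (𝓝 (1 : G)) := by
      have h3 : Continuous fun x : σ.pE =>
          ((ex (a : E))⁻¹ * ex ((2 : ℝ) • x : E) * (ex (a : E))⁻¹ : G) :=
        (continuous_const.mul (continuous_ex.comp (by fun_prop))).mul continuous_const
      convert! h3.tendsto a using 2
      rw [ex_two_smul]; group
    refine h2.comp ?_
    have := hβ.self_of_nhds.tendsto
    rwa [hβt] at this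
  have hlift : ∀ᶠ τ in 𝓝 t, ex ((2 : ℝ) • β τ : E) = γ τ := by
    filter_upwards [htar, hβ1.eventually hU, hc1.eventually hU] with τ h1 h2 h3
    have h4 : Φ (β τ) = σ.polarCh a (γ τ) := Φ.right_inv h1
    have h5 := hinj _ h2 _ h3 ?_ ?_ ?_
    · simpa [c] using h5
    · simp only [map_mul, map_inv, σ.map_ex_of_mem a.2,
        σ.map_ex_of_mem (σ.pE.smul_mem 2 (β τ).2)]
      group
    · simp only [c, map_mul, map_inv, σ.map_ex_of_mem a.2, hσ]
      group
    · exact smul_right_injective _ (by norm_num : (2 : ℝ)⁻¹ ≠ 0) h4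
  obtain ⟨δ, hδ, hball⟩ := Metric.eventually_nhds_iff_ball.1 (hβ.and hlift)
  exact ⟨δ, hδ, β, hβt, fun τ hτ => (hball τ hτ).1.continuousWithinAt, fun τ hτ => (hball τ hτ).2⟩

end Lifts

end Involution

end SymmetricLie

end

/-! ### Global existence of lifts by continuation. -/

noncomputable section

namespace SymmetricLie

open Filter Topology OpSeries
open NormedSpace (exp)

namespace Involution

section GlobalLifts

variable {E : Type*} [NormedAddCommGroup E] [NormedSpace ℝ E]
  {G : Type*} [TopologicalSpace G] [ChartedSpace E G] [Group G] {σ : Involution E G}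
  [LieGroup 𝓘(ℝ, E) ∞ G] [IsTopologicalGroup G] [CompleteSpace E] [T2Space G]

/-- The curve `β` is a continuous lift on `S`, starting at `v`, of the curve `geodesic G v w`. -/
def IsLiftOn (v w : σ.pE) (S : Set ℝ) (β : ℝ → σ.pE) : Prop :=
  ContinuousOn β S ∧ β 0 = v ∧ ∀ t ∈ S, ex ((2 : ℝ) • β t : E) = geodesic G (v : E) w t

variable {N : Seminorm ℝ σ.pE} {v w : σ.pE}

theorem IsLiftOn.mono {S T : Set ℝ} {β : ℝ → σ.pE} (h : IsLiftOn v w T β) (hST : S ⊆ T) :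
    IsLiftOn v w S β :=
  ⟨h.1.mono hST, h.2.1, fun t ht => h.2.2 t (hST ht)⟩

theorem geodesic_zero : geodesic G (v : E) w 0 = ex ((2 : ℝ) • v : E) := by
  simp [geodesic, ex_zero, ex_two_smul]

/-- Uniqueness makes the lifts on the intervals `[0, t]` compatible, so the diagonal `B t t` is a
lift. Its continuity at `t` is read off from a lift on a longer interval, hence the condition that
`J` has no maximum. -/
theorem IsExpanding.exists_isLiftOn_of_forall (hN : σ.IsExpanding N) {J : Set ℝ} (h0 : 0 ∈ J) (hJ0 : ∀ t ∈ J, 0 ≤ t)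
    (hJ : ∀ t ∈ J, ∃ s ∈ J, t < s) (h : ∀ t ∈ J, ∃ β, IsLiftOn v w (Set.Icc 0 t) β) :
    ∃ β, IsLiftOn v w J β := by
  have h' : ∀ t, ∃ β, t ∈ J → IsLiftOn v w (Set.Icc 0 t) β := by
    intro t
    by_cases ht : t ∈ J
    · obtain ⟨β, hβ⟩ := h t ht
      exact ⟨β, fun _ => hβ⟩
    · exact ⟨0, fun h => absurd h ht⟩
  choose B hB using h'
  have hBB : ∀ s ∈ J, ∀ t ∈ J, t ≤ s → B t t = B s t := by
    intro s hs t ht hts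
    exact hN.eqOn_of_lift isPreconnected_Icc (hB t ht).1
      ((hB s hs).mono (Set.Icc_subset_Icc_right hts)).1 (hB t ht).2.2
      ((hB s hs).mono (Set.Icc_subset_Icc_right hts)).2.2 (Set.left_mem_Icc.2 (hJ0 t ht))
      ((hB t ht).2.1.trans (hB s hs).2.1.symm) (Set.right_mem_Icc.2 (hJ0 t ht))
  refine ⟨fun t => B t t, fun t ht => ?_, (hB 0 h0).2.1, fun t ht =>
    (hB t ht).2.2 t (Set.right_mem_Icc.2 (hJ0 t ht))⟩
  obtain ⟨s, hs, hts⟩ := hJ t ht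
  have h1 : ContinuousWithinAt (B s) J t := by
    refine ((hB s hs).1 t ⟨hJ0 t ht, hts.le⟩).mono_of_mem_nhdsWithin ?_
    filter_upwards [self_mem_nhdsWithin, mem_nhdsWithin_of_mem_nhds (Iio_mem_nhds hts)] with r hr hrs
    exact ⟨hJ0 r hr, le_of_lt hrs⟩
  refine h1.congr_of_eventuallyEq ?_ (hBB s hs t ht hts.le)
  filter_upwards [self_mem_nhdsWithin, mem_nhdsWithin_of_mem_nhds (Iio_mem_nhds hts)] with r hr hrs
  exact hBB s hs r hr (le_of_lt hrs)

/-- The speed bound `N d ≤ N w` makes the lift Lipschitz on the open interval, so it has a limit at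
`T` by completeness, and the lifting equation passes to the closure. -/
theorem IsExpanding.exists_isLiftOn_Icc_of_Ico (hN : σ.IsExpanding N) {T : ℝ} (hT : 0 < T) {β : ℝ → σ.pE}
    (hβ : IsLiftOn v w (Set.Ico 0 T) β) : ∃ β, IsLiftOn v w (Set.Icc 0 T) β := by
  obtain ⟨C, hC, hCN⟩ := hN.norm_le
  have hd : ∀ t ∈ Set.Ioo 0 T, ∃ d, HasDerivAt β d t ∧ N d ≤ N w := by
    intro t ht
    have hnhds : Set.Ico 0 T ∈ 𝓝 t := Ico_mem_nhds ht.1 ht.2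
    obtain ⟨d, hd, -, hd'⟩ := hN.hasDerivAt_lift (hβ.1.continuousAt hnhds)
      (by filter_upwards [hnhds] with τ hτ using hβ.2.2 τ hτ)
    exact ⟨d, hd, hd'⟩
  have hlip : LipschitzOnWith (C * N w).toNNReal β (Set.Ioo 0 T) := by
    refine (convex_Ioo 0 T).lipschitzOnWith_of_nnnorm_hasDerivWithin_le (f' := deriv β)
      (fun t ht => ?_) fun t ht => ?_
    · obtain ⟨d, hd, -⟩ := hd t ht
      exact (hd.deriv ▸ hd).hasDerivWithinAt
    · obtain ⟨d, hd, hd'⟩ := hd t ht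
      rw [hd.deriv, ← NNReal.coe_le_coe, coe_nnnorm, Real.coe_toNNReal']
      exact ((hCN d).trans (by gcongr)).trans (le_max_left _ _)
  obtain ⟨a, ha⟩ : ∃ a, Tendsto β (𝓝[<] T) (𝓝 a) := by
    have h1 : Cauchy (map β (𝓝[Set.Ioo 0 T] T)) := by
      have : (𝓝[Set.Ioo 0 T] T).NeBot := right_nhdsWithin_Ioo_neBot hT
      exact (cauchy_nhds.mono nhdsWithin_le_nhds).map_of_le hlip.uniformContinuousOn
        (le_principal_iff.2 self_mem_nhdsWithin)
    rw [nhdsWithin_Ioo_eq_nhdsLT hT] at h1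
    exact CompleteSpace.complete h1
  have hne : ∀ t, t ≠ T → Function.update β T a t = β t := fun t ht => Function.update_of_ne ht _ _
  have hcont : ContinuousOn (Function.update β T a) (Set.Icc 0 T) := by
    rw [continuousOn_update_iff]
    rw [Set.Icc_sdiff_right]
    refine ⟨hβ.1, fun _ => ?_⟩
    refine ha.mono_left (nhdsWithin_mono _ fun x hx => hx.2)
  refine ⟨_, hcont, (hne 0 hT.ne).trans hβ.2.1, ?_⟩
  have hcl : Set.EqOn (fun t => (ex ((2 : ℝ) • (Function.update β T a t : E)) : G))
      (geodesic G (v : E) w) (Set.Ico 0 T) := by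
    intro t ht
    simp only [hne t ht.2.ne]
    exact hβ.2.2 t ht
  refine hcl.of_subset_closure ?_ (continuous_geodesic _ _).continuousOn Set.Ico_subset_Icc_self
    (by rw [closure_Ico hT.ne])
  have h1 : Continuous fun x : σ.pE => (ex ((2 : ℝ) • x : E) : G) := continuous_ex.comp (by fun_prop)
  exact h1.comp_continuousOn hcont

theorem IsExpanding.exists_isLiftOn_Icc_add (hN : σ.IsExpanding N) {T : ℝ} (hT : 0 ≤ T) {β : ℝ → σ.pE}
    (hβ : IsLiftOn v w (Set.Icc 0 T) β) : ∃ T' > T, ∃ β, IsLiftOn v w (Set.Icc 0 T') β := by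
  obtain ⟨δ, hδ, α, hα, hα', hαγ⟩ := hN.exists_local_lift (continuous_geodesic (G := G) (v : E) w)
    (fun t => σ.map_ex_mul_ex_mul_ex v.2 (σ.pE.smul_mem 2 (σ.pE.smul_mem t w.2)))
    (hβ.2.2 T (Set.right_mem_Icc.2 hT))
  have hsub : Set.Icc T (T + δ / 2) ⊆ Metric.ball T δ := by
    intro t ht
    rw [Metric.mem_ball, Real.dist_eq, abs_of_nonneg (sub_nonneg.2 ht.1)]
    linarith [ht.2]
  let f : ℝ → σ.pE := fun t => if t ≤ T then β t else α t
  have hf1 : Set.EqOn f β (Set.Icc 0 T) := fun t ht => if_pos ht.2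
  have hf2 : Set.EqOn f α (Set.Icc T (T + δ / 2)) := by
    intro t ht
    by_cases h : t ≤ T
    · have : t = T := le_antisymm h ht.1
      subst this
      simp [f, hα]
    · exact if_neg h
  have hU : Set.Icc 0 (T + δ / 2) = Set.Icc 0 T ∪ Set.Icc T (T + δ / 2) :=
    (Set.Icc_union_Icc_eq_Icc hT (by linarith)).symm
  refine ⟨T + δ / 2, by linarith, f, ?_, (hf1 ⟨le_rfl, hT⟩).trans hβ.2.1, ?_⟩
  · rw [hU]
    exact (hβ.1.congr hf1).union_of_isClosed ((hα'.mono hsub).congr hf2) isClosed_Icc isClosed_Icc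
  · rw [hU]
    rintro t (ht | ht)
    · rw [hf1 ht]; exact hβ.2.2 t ht
    · rw [hf2 ht]; exact hαγ t (hsub ht)

theorem IsExpanding.exists_isLiftOn_Icc (hN : σ.IsExpanding N) {T : ℝ} (hT : 0 ≤ T) :
    ∃ β, IsLiftOn v w (Set.Icc 0 T) β := by
  by_contra hcon
  let S : Set ℝ := {t | 0 ≤ t ∧ ∃ β, IsLiftOn v w (Set.Icc 0 t) β}
  have hmono : ∀ s t, 0 ≤ s → s ≤ t → t ∈ S → s ∈ S := fun s t hs hst ⟨_, β, hβ⟩ =>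
    ⟨hs, β, hβ.mono (Set.Icc_subset_Icc_right hst)⟩
  have h0 : (0 : ℝ) ∈ S := by
    refine ⟨le_rfl, fun _ => v, continuousOn_const, rfl, fun t ht => ?_⟩
    rw [Set.Icc_self] at ht
    rw [Set.mem_singleton_iff.1 ht, geodesic_zero]
  have hub : ∀ t ∈ S, t ≤ T := fun t ht => by
    by_contra! h
    exact hcon (hmono T t hT h.le ht).2
  have hlub := isLUB_csSup ⟨0, h0⟩ ⟨T, hub⟩
  set b := sSup S
  have hb0 : 0 ≤ b := hlub.1 h0
  have hlt : ∀ t ∈ Set.Ico 0 b, ∃ β, IsLiftOn v w (Set.Icc 0 t) β := by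
    intro t ht
    obtain ⟨s, hs, hts, -⟩ := hlub.exists_between ht.2
    exact (hmono t s ht.1 hts.le hs).2
  have hb : b ∈ S := by
    rcases hb0.eq_or_lt with h | h
    · rw [← h]; exact h0
    · obtain ⟨β, hβ⟩ := hN.exists_isLiftOn_of_forall (J := Set.Ico 0 b) ⟨le_rfl, h⟩
        (fun t ht => ht.1) (fun t ht => ⟨(t + b) / 2, ⟨by linarith [ht.1, ht.2], by
          linarith [ht.2]⟩, by linarith [ht.2]⟩) hlt
      exact ⟨hb0, hN.exists_isLiftOn_Icc_of_Ico h hβ⟩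
  obtain ⟨β, hβ⟩ := hb.2
  obtain ⟨T', hT', h⟩ := hN.exists_isLiftOn_Icc_add hb0 hβ
  exact hT'.not_ge (hlub.1 ⟨hb0.trans hT'.le, h⟩)

theorem IsExpanding.exists_isLiftOn_Ici (hN : σ.IsExpanding N) : ∃ β, IsLiftOn v w (Set.Ici 0) β :=
  hN.exists_isLiftOn_of_forall Set.self_mem_Ici (fun _ ht => ht)
    (fun t ht => ⟨t + 1, by simp at ht ⊢; linarith, by linarith⟩)
    fun _ ht => hN.exists_isLiftOn_Icc ht

theorem IsExpanding.exists_lift (hN : σ.IsExpanding N) (v w : σ.pE) : ∃ β : ℝ → σ.pE, Continuous β ∧ β 0 = v ∧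
    ∀ t, ex ((2 : ℝ) • β t : E) = geodesic G (v : E) w t := by
  obtain ⟨α, hα⟩ := hN.exists_isLiftOn_Ici (v := v) (w := w)
  obtain ⟨β, hβ⟩ := hN.exists_isLiftOn_Ici (v := v) (w := -w)
  have hc : ∀ {f : ℝ → σ.pE} {r : ℝ → ℝ}, ContinuousOn f (Set.Ici 0) → Continuous r →
      Continuous fun t => f (max (r t) 0) := fun hf hr =>
    hf.comp_continuous (hr.max continuous_const) fun t => Set.mem_Ici.2 (le_max_right _ _)
  -- On each half-line one of the two terms is constantly `v` and cancels, leaving the forward lift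
  -- for `w` or the time-reversed one for `-w`.
  refine ⟨fun t => α (max t 0) + β (max (-t) 0) - v,
    ((hc hα.1 continuous_id).add (hc hβ.1 continuous_neg)).sub continuous_const, ?_, fun t => ?_⟩
  · simp [hα.2.1, hβ.2.1]
  · beta_reduce
    rcases le_total 0 t with h | h
    · rw [max_eq_left h, max_eq_right (neg_nonpos.2 h), hβ.2.1, add_sub_cancel_right]
      exact hα.2.2 t h
    · rw [max_eq_right h, max_eq_left (neg_nonneg.2 h), hα.2.1, add_sub_cancel_left]
      refine (hβ.2.2 (-t) (neg_nonneg.2 h)).trans ?_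
      simp [geodesic]

end GlobalLifts

end Involution

end SymmetricLie

end

/-! ### Paths of operators, invariance of closed subspaces, and Lie triple systems. -/

noncomputable section

namespace SymmetricLie

open Filter Topology OpSeries
open NormedSpace (exp)

section Generic

variable {V : Type*} [NormedAddCommGroup V] [NormedSpace ℝ V]

/-- A path of operators that is uniformly bounded below and contains an invertible operator
consists of invertible operators. -/
theorem isUnit_of_bounded_below [CompleteSpace V] {A : ℝ → V →L[ℝ] V} (hA : Continuous A)
    (h0 : IsUnit (A 0)) {c : ℝ} (hc : ∀ t x, ‖x‖ ≤ c * ‖A t x‖) (t : ℝ) : IsUnit (A t) := by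
  rcases subsingleton_or_nontrivial V with hV | hV
  · exact ⟨1, Subsingleton.elim _ _⟩
  have hc0 : 0 < c := by
    obtain ⟨x, hx⟩ := exists_ne (0 : V)
    have h1 := (norm_pos_iff.2 hx).trans_le (hc 0 x)
    exact pos_of_mul_pos_left h1 (norm_nonneg _)
  -- Closedness: the lower bound gives `‖(A r)⁻¹‖ ≤ c` at each invertible `A r`, so every operator
  -- within `c⁻¹` of it is invertible.
  have hclopen : IsClopen {t | IsUnit (A t)} := by
    refine ⟨isClosed_of_closure_subset fun t ht => ?_, Units.isOpen.preimage hA⟩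
    have h1 : ∀ᶠ r in 𝓝 t, ‖A t - A r‖ < c⁻¹ := by
      have h2 : Tendsto (fun r => ‖A t - A r‖) (𝓝 t) (𝓝 0) := by
        simpa using ((continuous_const.sub hA).norm.tendsto t : Tendsto (fun r => ‖A t - A r‖) _ _)
      exact h2.eventually (gt_mem_nhds (inv_pos.2 hc0))
    obtain ⟨r, ⟨u, hu⟩, hr⟩ := mem_closure_iff_frequently.1 ht |>.and_eventually h1 |>.exists
    have h3 : ‖((u⁻¹ : (V →L[ℝ] V)ˣ) : V →L[ℝ] V)‖ ≤ c := by
      refine ContinuousLinearMap.opNorm_le_bound _ hc0.le fun x => ?_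
      have h4 : A r (((u⁻¹ : (V →L[ℝ] V)ˣ) : V →L[ℝ] V) x) = x := by
        rw [← hu]
        exact congrArg (fun T : V →L[ℝ] V => T x) u.mul_inv
      simpa only [h4] using hc r (((u⁻¹ : (V →L[ℝ] V)ˣ) : V →L[ℝ] V) x)
    have h4 : 0 < ‖((u⁻¹ : (V →L[ℝ] V)ˣ) : V →L[ℝ] V)‖ := Units.norm_pos _
    refine ⟨Units.ofNearby u (A t) ?_, rfl⟩
    rw [hu]
    exact hr.trans_le (inv_anti₀ h4 h3)
  have := hclopen.eq_univ ⟨0, h0⟩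
  exact (this ▸ Set.mem_univ t : t ∈ {t | IsUnit (A t)})

theorem tendsto_apply {ι : Type*} {l : Filter ι} {S : ι → V →L[ℝ] V} {y : ι → V} {S₀ : V →L[ℝ] V}
    {y₀ : V} (hS : Tendsto S l (𝓝 S₀)) (hy : Tendsto y l (𝓝 y₀)) :
    Tendsto (fun t => S t (y t)) l (𝓝 (S₀ y₀)) :=
  ((isBoundedBilinearMap_apply (𝕜 := ℝ) (E := V) (F := V)).continuous.tendsto (S₀, y₀)).comp
    (hS.prodMk_nhds hy)

theorem mem_of_tendsto_slope {s : Submodule ℝ V} (hs : IsClosed (s : Set V)) {β : ℝ → V} {d : V}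
    {t : ℝ} (hβ : HasDerivAt β d t) (h : ∀ t, β t ∈ s) : d ∈ s := by
  refine hs.mem_of_tendsto hβ.tendsto_slope (Eventually.of_forall fun r => ?_)
  rw [slope_def_module]
  exact s.smul_mem _ (s.sub_mem (h _) (h _))

/-- A curve that starts in a closed subspace, and whose velocity is close to the subspace as far as
the curve is, stays in the subspace. -/
theorem mem_of_deriv_near_of_nonneg {s : Submodule ℝ V} (hs : IsClosed (s : Set V)) {β d : ℝ → V}
    (hβ : ∀ t, HasDerivAt β (d t) t) (h0 : β 0 ∈ s)
    (h : ∀ T, ∃ K, 0 ≤ K ∧ ∀ t ∈ Set.Icc 0 T, ∀ z ∈ s, ‖β t - z‖ ≤ ‖β t‖ + 1 →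
      ∃ x ∈ s, ‖d t - x‖ ≤ K * ‖β t - z‖) {T : ℝ} (hT : 0 ≤ T) : β T ∈ s := by
  obtain ⟨K, hK, hKz⟩ := h T
  have hquot : ∀ x : V, s.mkQL x = (Submodule.Quotient.mk x : V ⧸ s) := fun _ => rfl
  have hd : ∀ t, HasDerivAt (fun t => s.mkQL (β t)) (s.mkQL (d t)) t := fun t =>
    s.mkQL.hasFDerivAt.comp_hasDerivAt t (hβ t)
  have hbound : ∀ t ∈ Set.Ico 0 T, ‖s.mkQL (d t)‖ ≤ K * ‖s.mkQL (β t)‖ := by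
    intro t ht
    -- The distance to `s` may not be attained, so `z` is taken nearest up to `ε`. Since `ε < 1`, it
    -- satisfies the cap `‖β t‖ + 1` under which the hypothesis applies.
    have h1 : ∀ ε ∈ Set.Ioo (0 : ℝ) 1, ‖s.mkQL (d t)‖ ≤ K * (‖s.mkQL (β t)‖ + ε) := by
      intro ε hε
      obtain ⟨m, hm, hm'⟩ := Submodule.Quotient.norm_mk_lt (s.mkQL (β t)) hε.1
      have hz : β t - m ∈ s := by
        rw [← Submodule.Quotient.mk_eq_zero, Submodule.Quotient.mk_sub, hm, hquot, sub_self]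
      have hle : ‖s.mkQL (β t)‖ ≤ ‖β t‖ := Submodule.Quotient.norm_mk_le _ _
      obtain ⟨x, hx, hx'⟩ := hKz t ⟨ht.1, ht.2.le⟩ _ hz (by
        rw [sub_sub_cancel]; linarith [hε.2])
      rw [sub_sub_cancel] at hx'
      have h2 : s.mkQL (d t) = s.mkQL (d t - x) := by
        rw [map_sub, hquot x, (Submodule.Quotient.mk_eq_zero s).2 hx, sub_zero]
      rw [h2]
      exact (Submodule.Quotient.norm_mk_le s _).trans (hx'.trans (by gcongr))
    have h2 : Tendsto (fun ε : ℝ => K * (‖s.mkQL (β t)‖ + ε)) (𝓝[>] 0)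
        (𝓝 (K * (‖s.mkQL (β t)‖ + 0))) :=
      ((continuous_const.mul (continuous_const.add continuous_id)).tendsto 0).mono_left
        nhdsWithin_le_nhds
    rw [add_zero] at h2
    refine ge_of_tendsto h2 ?_
    filter_upwards [Ioo_mem_nhdsGT (zero_lt_one' ℝ)] with ε hε using h1 ε hε
  have : IsClosed (s : Set V) := hs
  have hz := eq_zero_of_abs_deriv_le_mul_abs_self_of_eq_zero_right
    (fun t _ => (hd t).continuousAt.continuousWithinAt) (fun t _ => (hd t).hasDerivWithinAt)
    (by rw [hquot]; exact (Submodule.Quotient.mk_eq_zero s).2 h0) hbound T ⟨hT, le_rfl⟩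
  exact (Submodule.Quotient.mk_eq_zero s).1 hz

end Generic

section Triple

variable {E : Type*} [NormedAddCommGroup E] [NormedSpace ℝ E]
  {G : Type*} [TopologicalSpace G] [ChartedSpace E G] [Group G]
  [LieGroup 𝓘(ℝ, E) ∞ G]

theorem ad_ad_mem_of_triple {s : Submodule ℝ E}
    (h : ∀ v ∈ s, ∀ w ∈ s, ∀ u ∈ s, ad G (ad G v w) u ∈ s) :
    ∀ u ∈ s, ∀ w ∈ s, ad G u (ad G u w) ∈ s := by
  intro u hu w hw
  rw [ad_swap]
  exact s.neg_mem (h u hu w hw u hu)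

/-- Polarizing `u ↦ (ad u)²` puts `[a,[b,c]] + [b,[a,c]]` in `s`. By the Jacobi identity the
instances `(v,u,w)` and `(w,u,v)` differ by `3[u,[v,w]]`. -/
theorem triple_of_ad_ad_mem [CompleteSpace E] {s : Submodule ℝ E}
    (h : ∀ u ∈ s, ∀ w ∈ s, ad G u (ad G u w) ∈ s) :
    ∀ v ∈ s, ∀ w ∈ s, ∀ u ∈ s, ad G (ad G v w) u ∈ s := by
  have hpol : ∀ a ∈ s, ∀ b ∈ s, ∀ c ∈ s, ad G a (ad G b c) + ad G b (ad G a c) ∈ s := by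
    intro a ha b hb c hc
    have h1 := s.sub_mem (s.sub_mem (h _ (s.add_mem ha hb) c hc) (h a ha c hc)) (h b hb c hc)
    convert h1 using 1
    simp only [map_add, add_apply]
    abel
  have hneg : ∀ a b c : E, ad G a (ad G b c) = -ad G a (ad G c b) := fun a b c => by
    rw [ad_swap b c, map_neg]
  intro v hv w hw u hu
  have h1 : ad G u (ad G v w) = -ad G w (ad G u v) + ad G v (ad G u w) := by
    rw [ad_leibniz, ad_swap _ w]
  have h2 := hpol v hv u hu w hw
  have h3 := hpol w hw u hu v hv
  have h4 : (3 : ℝ) • ad G (ad G v w) u ∈ s := by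
    convert s.neg_mem (s.sub_mem h2 h3) using 1
    rw [ad_swap _ u, hneg u w v]
    linear_combination (norm := module) (-1 : ℝ) • h1
  have h5 := s.smul_mem (3 : ℝ)⁻¹ h4
  rwa [smul_smul, inv_mul_cancel₀ (by norm_num), one_smul] at h5

end Triple

end SymmetricLie

end

/-! ### The implications between the four conditions. -/

noncomputable section

namespace SymmetricLie

open Filter Topology OpSeries
open NormedSpace (exp)

namespace Involution

section Characterization

variable {E : Type*} [NormedAddCommGroup E] [NormedSpace ℝ E]
  {G : Type*} [TopologicalSpace G] [ChartedSpace E G] [Group G] {σ : Involution E G}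
  [LieGroup 𝓘(ℝ, E) ∞ G] [IsTopologicalGroup G] [CompleteSpace E] [T2Space G]
  {N : Seminorm ℝ σ.pE} {s : Submodule ℝ E}

/-- Equivalence of `N` with the norm turns expansion into a lower bound whose constant does not
depend on `a`; this uniformity drives all the limit and connectedness arguments. -/
theorem IsExpanding.exists_norm_le (hN : σ.IsExpanding N) :
    ∃ C, 0 ≤ C ∧ ∀ a w, ‖w‖ ≤ C * ‖σ.sinhcP a w‖ := by
  obtain ⟨C, hC, h1⟩ := hN.norm_le
  obtain ⟨C', hC', h2⟩ := hN.le_norm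
  refine ⟨C * C', by positivity, fun a w => (h1 w).trans ?_⟩
  rw [mul_assoc]
  gcongr
  exact (hN.le a w).trans (h2 _)

/-- The operators `F(t ad v)` preserve `s`, are uniformly bounded below on it, and equal the
identity at `t = 0`; hence invertibility propagates to `t = 1`. -/
theorem IsExpanding.exists_equiv (hN : σ.IsExpanding N) (hs : IsClosed (s : Set E))
    (hsp : s ≤ σ.pE) (h : ∀ u ∈ s, ∀ w ∈ s, ad G u (ad G u w) ∈ s) {v : E} (hv : v ∈ s) :
    ∃ e : s ≃L[ℝ] s, ∀ w : s, (e w : E) = sinhc (ad G v) w := by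
  have : CompleteSpace s := hs.completeSpace_coe
  have hmem : ∀ (t : ℝ) (w : s), sinhc (ad G (t • v)) w ∈ s := fun t w =>
    sinhc_apply_mem hs (fun x hx => h _ (s.smul_mem t hv) x hx) w.2
  let A : ℝ → s →L[ℝ] s := fun t =>
    (sinhc (ad G (t • v)) ∘L s.subtypeL).codRestrict s (hmem t)
  have hA : Continuous A := by
    have h1 : Continuous fun t : ℝ => (sinhc (ad G (t • v)) : E →L[ℝ] E) :=
      continuous_sinhc.comp ((ad G).continuous.comp (by fun_prop))
    rw [continuous_iff_continuousAt]
    intro t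
    refine (tendsto_iff_norm_sub_tendsto_zero (E := s →L[ℝ] s)).2 (squeeze_zero
      (fun r => norm_nonneg (A r - A t)) (fun r => ?_) (tendsto_iff_norm_sub_tendsto_zero.1 (h1.tendsto t)))
    exact ContinuousLinearMap.opNorm_le_bound _ (norm_nonneg _) fun w =>
      (sinhc (ad G (r • v)) - sinhc (ad G (t • v))).le_opNorm (w : E)
  obtain ⟨C, -, hC⟩ := hN.exists_norm_le
  obtain ⟨u, hu⟩ := isUnit_of_bounded_below hA
    ⟨1, by ext w; simp [A, sinhc_zero]⟩
    (fun t w => hC ⟨t • v, hsp (s.smul_mem t hv)⟩ ⟨w, hsp w.2⟩) 1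
  refine ⟨ContinuousLinearEquiv.unitsEquiv ℝ s u, fun w => ?_⟩
  rw [ContinuousLinearEquiv.unitsEquiv_apply, hu]
  simp [A]

/-- With `F(t ad v) y_t = w`, the `y_t` are bounded uniformly in `t`, so `(w - y_t) / t²`, which
lies in `s`, tends to `(ad v)² w / 6`. Only surjectivity on `s` is needed. -/
theorem IsExpanding.ad_ad_mem (hN : σ.IsExpanding N) (hs : IsClosed (s : Set E)) (hsp : s ≤ σ.pE)
    (h : ∀ v ∈ s, ∀ w ∈ s, ∃ y ∈ s, sinhc (ad G v) y = w) :
    ∀ u ∈ s, ∀ w ∈ s, ad G u (ad G u w) ∈ s := by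
  intro v hv w hw
  obtain ⟨C, -, hC⟩ := hN.exists_norm_le
  choose y hy hyw using fun t : ℝ => h (t • v) (s.smul_mem t hv) w hw
  set T : E →L[ℝ] E := ad G v with hT
  have hyC : ∀ t, ‖y t‖ ≤ C * ‖w‖ := fun t => by
    have := hC ⟨t • v, hsp (s.smul_mem t hv)⟩ ⟨y t, hsp (hy t)⟩
    rw [← hyw t]
    exact this
  let S : ℝ → E →L[ℝ] E := fun t => T * T * sinhcRem (t • T)
  have hS : Continuous S :=
    continuous_const.mul (continuous_sinhcRem.comp (continuous_id.smul continuous_const))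
  have hwy : ∀ t, w - y t = t ^ 2 • S t (y t) := by
    intro t
    have h1 := hyw t
    rw [map_smul, ← hT, sinhc_eq] at h1
    rw [← h1]
    simp only [S, add_apply, one_apply_eq_self, smul_mul_assoc, mul_smul_comm, smul_smul,
      smul_apply]
    rw [add_sub_cancel_left, pow_two]
  have hy0 : Tendsto y (𝓝 0) (𝓝 w) := by
    rw [tendsto_iff_norm_sub_tendsto_zero]
    refine squeeze_zero (g := fun t => t ^ 2 * (‖S t‖ * (C * ‖w‖))) (fun _ => norm_nonneg _)
      (fun t => ?_) ?_
    · rw [norm_sub_rev, hwy, norm_smul, norm_pow, Real.norm_eq_abs, sq_abs]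
      gcongr
      exact (S t).le_opNorm_of_le (hyC t)
    · have h1 : Continuous fun t : ℝ => t ^ 2 * (‖S t‖ * (C * ‖w‖)) := by fun_prop
      simpa using h1.tendsto 0
  have hlim : Tendsto (fun t => S t (y t)) (𝓝[≠] 0) (𝓝 ((6 : ℝ)⁻¹ • T (T w))) := by
    have h1 : Tendsto (fun t => S t (y t)) (𝓝 0) (𝓝 (S 0 w)) :=
      tendsto_apply (hS.tendsto 0) hy0
    have h2 : S 0 w = (6 : ℝ)⁻¹ • T (T w) := by
      simp [S, sinhcRem_zero]
    rw [h2] at h1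
    exact h1.mono_left nhdsWithin_le_nhds
  have hmem : (6 : ℝ)⁻¹ • T (T w) ∈ s := by
    refine hs.mem_of_tendsto hlim ?_
    filter_upwards [self_mem_nhdsWithin] with t ht
    have h1 : S t (y t) = (t ^ 2)⁻¹ • (w - y t) := by
      rw [hwy, smul_smul, inv_mul_cancel₀ (pow_ne_zero 2 ht), one_smul]
    rw [h1]
    exact s.smul_mem _ (s.sub_mem hw (hy t))
  have h6 := s.smul_mem (6 : ℝ) hmem
  rwa [smul_smul, mul_inv_cancel₀ (by norm_num), one_smul] at h6

/-- The preimage of `w` is the initial velocity of the lift starting at `v`: at `t = 0` the two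
exponentials in the velocity equation cancel. It lies in `s` as a limit of difference quotients. -/
theorem IsExpanding.exists_sinhc_eq_of_lift (hN : σ.IsExpanding N) (hs : IsClosed (s : Set E))
    (hsp : s ≤ σ.pE)
    (h : ∀ v ∈ s, ∀ w ∈ s, ∀ β : ℝ → σ.pE, Continuous β →
      (∀ t, ex ((2 : ℝ) • β t : E) = geodesic G v w t) → (β 0 : E) ∈ s → ∀ t, (β t : E) ∈ s) :
    ∀ v ∈ s, ∀ w ∈ s, ∃ y ∈ s, sinhc (ad G v) y = w := by
  intro v hv w hw
  obtain ⟨β, hβ, h0, hβγ⟩ := hN.exists_lift ⟨v, hsp hv⟩ ⟨w, hsp hw⟩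
  obtain ⟨d, hd, hd', -⟩ := hN.hasDerivAt_lift hβ.continuousAt (Eventually.of_forall hβγ) (t := 0)
  have hmem := h v hv w hw β hβ hβγ (by rw [h0]; exact hv)
  refine ⟨d, mem_of_tendsto_slope hs (σ.pE.subtypeL.hasFDerivAt.comp_hasDerivAt 0 hd) hmem, ?_⟩
  rw [h0] at hd'
  have h1 := congrArg (Subtype.val : σ.pE → E) hd'
  rw [coe_sinhcP] at h1
  refine h1.trans ?_
  have h2 : exp (ad G v) (exp (-ad G v) w) = w :=
    congrArg (fun T : E →L[ℝ] E => T w) (exp_mul_exp_neg (ad G v))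
  simp only [h2]
  exact σ.proj_of_mem (hsp hw)

variable (σ) in
/-- The elements whose `𝔭`-component lies in `s` and whose `𝔨`-component maps `s` into itself. -/
def tripleHull (s : Submodule ℝ E) : Submodule ℝ E where
  carrier := {x | (σ.proj x : E) ∈ s ∧ ∀ u ∈ s, ad G u (x - σ.proj x) ∈ s}
  zero_mem' := by simp
  add_mem' := by
    rintro x y ⟨hx, hx'⟩ ⟨hy, hy'⟩
    refine ⟨by rw [map_add]; exact s.add_mem hx hy, fun u hu => ?_⟩
    rw [map_add, Submodule.coe_add, add_sub_add_comm, map_add]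
    exact s.add_mem (hx' u hu) (hy' u hu)
  smul_mem' := by
    rintro c x ⟨hx, hx'⟩
    refine ⟨by rw [map_smul]; exact s.smul_mem c hx, fun u hu => ?_⟩
    rw [map_smul, Submodule.coe_smul, ← smul_sub, map_smul]
    exact s.smul_mem c (hx' u hu)

theorem isClosed_tripleHull (hs : IsClosed (s : Set E)) :
    IsClosed (σ.tripleHull s : Set E) := by
  have h1 : (σ.tripleHull s : Set E) = {x | (σ.proj x : E) ∈ s} ∩
      ⋂ u ∈ s, {x | ad G u (x - σ.proj x) ∈ s} := by
    ext x
    simp [tripleHull]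
  rw [h1]
  refine (hs.preimage (by fun_prop)).inter (isClosed_biInter fun u _ => ?_)
  exact hs.preimage (f := fun x => ad G u (x - σ.proj x)) (by fun_prop)

theorem le_tripleHull (hsp : s ≤ σ.pE) : s ≤ σ.tripleHull s := by
  intro x hx
  have h1 := σ.proj_of_mem (hsp hx)
  refine ⟨by rwa [h1], fun u _ => ?_⟩
  rw [h1, sub_self, map_zero]
  exact s.zero_mem

/-- For `x = p + k`, the `𝔭`-part of `[u, x]` is `[u, k]`, in `s` by assumption on `k`; its `𝔨`-part
`[u, p]` acts on `s` by the triple product. Exponentials of `ad u` therefore preserve the hull. -/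
theorem ad_mem_tripleHull (hsp : s ≤ σ.pE)
    (h : ∀ v ∈ s, ∀ w ∈ s, ∀ u ∈ s, ad G (ad G v w) u ∈ s) {u x : E} (hu : u ∈ s)
    (hx : x ∈ σ.tripleHull s) : ad G u x ∈ σ.tripleHull s := by
  obtain ⟨h1, h2⟩ := hx
  obtain ⟨p, hp⟩ : ∃ p : E, ((σ.proj x : σ.pE) : E) = p := ⟨_, rfl⟩
  simp only [hp] at h1 h2
  obtain ⟨k, rfl⟩ : ∃ k, x = p + k := ⟨x - p, by abel⟩
  rw [add_sub_cancel_left] at h2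
  have h3 : (σ.proj (ad G u (p + k)) : E) = ad G u k := by
    have h4 : σ.dσ (ad G u p) = ad G u p := by
      rw [dσ_ad, σ.mem_pE.1 (hsp hu), σ.mem_pE.1 (hsp h1)]
      simp
    rw [coe_proj, map_add, map_add, h4, σ.mem_pE.1 (hsp (h2 u hu))]
    module
  refine ⟨by rw [h3]; exact h2 u hu, fun r hr => ?_⟩
  rw [h3, map_add, add_sub_cancel_right, ad_swap]
  exact s.neg_mem (h u hu p h1 r hr)

theorem proj_exp_exp_mem (hs : IsClosed (s : Set E)) (hsp : s ≤ σ.pE)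
    (h : ∀ v ∈ s, ∀ w ∈ s, ∀ u ∈ s, ad G (ad G v w) u ∈ s) {v z w : E} (hv : v ∈ s) (hz : z ∈ s)
    (hw : w ∈ s) : (σ.proj (exp (ad G z) (exp (-ad G v) w)) : E) ∈ s := by
  have hcl := isClosed_tripleHull (σ := σ) hs
  refine (exp_apply_mem hcl (fun x hx => ad_mem_tripleHull hsp h hz hx)
    (exp_apply_mem hcl (fun x hx => ?_) (le_tripleHull hsp hw))).1
  rw [← map_neg]
  exact ad_mem_tripleHull hsp h (s.neg_mem hv) hx

/-- The velocity of the lifts of the geodesics depends on the point in a locally Lipschitz way. -/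
theorem IsExpanding.exists_velocity_lipschitz (hN : σ.IsExpanding N) (y : E) (D R : ℝ) :
    ∃ K, 0 ≤ K ∧ ∀ b z d x : σ.pE, ‖b‖ ≤ R → ‖z‖ ≤ R → ‖d‖ ≤ D →
      σ.sinhcP b d = σ.proj (exp (ad G (b : E)) y) →
      σ.sinhcP z x = σ.proj (exp (ad G (z : E)) y) → ‖d - x‖ ≤ K * ‖b - z‖ := by
  obtain ⟨C, hC, hCN⟩ := hN.exists_norm_le
  set M := ‖ad (E := E) G‖
  obtain ⟨L₁, hL₁, h1⟩ := exists_lipschitz_exp (V := E) (M * R)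
  obtain ⟨L₂, hL₂, h2⟩ := exists_lipschitz_sinhc (V := E) (M * R)
  refine ⟨C * (L₂ * M * |D| + ‖σ.proj‖ * (L₁ * M * ‖y‖)), by positivity,
    fun b z d x hb hz hd hbd hzx => ?_⟩
  have hM : ∀ a : σ.pE, ‖a‖ ≤ R → ‖ad G (a : E)‖ ≤ M * R := fun a ha =>
    (ad (E := E) G).le_opNorm_of_le ha
  have hbz : ‖ad G (b : E) - ad G (z : E)‖ ≤ M * ‖b - z‖ := by
    rw [← map_sub]
    exact (ad (E := E) G).le_opNorm _
  -- Subtracting the two velocity equations reduces the claim to the Lipschitz bounds for `sinhc`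
  -- and `exp` and the uniform lower bound for `sinhcP z`.
  have h3 : σ.sinhcP z (d - x) = (σ.sinhcP z - σ.sinhcP b) d +
      σ.proj ((exp (ad G (b : E)) - exp (ad G (z : E))) y) := by
    simp only [map_sub, sub_apply, hzx, hbd]
    abel
  have h4 : ‖(σ.sinhcP z - σ.sinhcP b) d‖ ≤ L₂ * M * |D| * ‖b - z‖ := by
    calc ‖(σ.sinhcP z - σ.sinhcP b) d‖
        = ‖(sinhc (ad G (z : E)) - sinhc (ad G (b : E))) (d : E)‖ := rfl
      _ ≤ ‖sinhc (ad G (z : E)) - sinhc (ad G (b : E))‖ * ‖(d : E)‖ :=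
        ContinuousLinearMap.le_opNorm _ _
      _ ≤ (L₂ * (M * ‖b - z‖)) * |D| := by
        gcongr
        · rw [norm_sub_rev]
          exact (h2 _ _ (hM b hb) (hM z hz)).trans (by gcongr)
        · exact hd.trans (le_abs_self D)
      _ = L₂ * M * |D| * ‖b - z‖ := by ring
  have h5 : ‖σ.proj ((exp (ad G (b : E)) - exp (ad G (z : E))) y)‖ ≤
      ‖σ.proj‖ * (L₁ * M * ‖y‖) * ‖b - z‖ := by
    calc ‖σ.proj ((exp (ad G (b : E)) - exp (ad G (z : E))) y)‖
        ≤ ‖σ.proj‖ * (‖exp (ad G (b : E)) - exp (ad G (z : E))‖ * ‖y‖) :=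
          σ.proj.le_opNorm_of_le (ContinuousLinearMap.le_opNorm _ _)
      _ ≤ ‖σ.proj‖ * ((L₁ * (M * ‖b - z‖)) * ‖y‖) := by
        gcongr
        exact (h1 _ _ (hM b hb) (hM z hz)).trans (by gcongr)
      _ = ‖σ.proj‖ * (L₁ * M * ‖y‖) * ‖b - z‖ := by ring
  calc ‖d - x‖ ≤ C * ‖σ.sinhcP z (d - x)‖ := hCN z _
    _ ≤ C * (L₂ * M * |D| * ‖b - z‖ + ‖σ.proj‖ * (L₁ * M * ‖y‖) * ‖b - z‖) := by
      rw [h3]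
      gcongr
      exact (norm_add_le _ _).trans (add_le_add h4 h5)
    _ = _ := by ring

/-- For `z ∈ s` near `β t`, the velocity equation at `z` has a solution in `s`, which the Lipschitz
estimate compares with the velocity of `β`. Grönwall's inequality in the quotient by `s` concludes.
-/
theorem IsExpanding.lift_mem (hN : σ.IsExpanding N) (hs : IsClosed (s : Set E)) (hsp : s ≤ σ.pE)
    (h : ∀ v ∈ s, ∀ w ∈ s, ∀ u ∈ s, ad G (ad G v w) u ∈ s)
    {v w : E} (hv : v ∈ s) (hw : w ∈ s) {β : ℝ → σ.pE} (hβ : Continuous β)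
    (hβγ : ∀ t, ex ((2 : ℝ) • β t : E) = geodesic G v w t) (h0 : (β 0 : E) ∈ s) (t : ℝ) :
    (β t : E) ∈ s := by
  wlog ht : 0 ≤ t generalizing w β t
  · have h1 := this (w := -w) (s.neg_mem hw) (β := fun t => β (-t)) (hβ.comp continuous_neg)
      (fun t => (hβγ (-t)).trans (by simp [geodesic])) (by simpa using h0) (-t) (by linarith)
    simpa using h1
  obtain ⟨C, hC, hCN⟩ := hN.norm_le
  choose d hd hdY hdN using fun t => hN.hasDerivAt_lift (v := ⟨v, hsp hv⟩) (w := ⟨w, hsp hw⟩)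
    (hβ.continuousAt (x := t)) (Eventually.of_forall hβγ)
  let s' : Submodule ℝ σ.pE := s.comap σ.pE.subtype
  have hs' : IsClosed (s' : Set σ.pE) := hs.preimage continuous_subtype_val
  refine mem_of_deriv_near_of_nonneg (s := s') hs' hd h0 (fun T => ?_) ht
  obtain ⟨R, hR⟩ := isCompact_Icc.exists_bound_of_continuousOn (s := Set.Icc 0 T) hβ.continuousOn
  -- The radius covers both `‖β t‖ ≤ R` and `‖z‖ ≤ ‖β t‖ + (‖β t‖ + 1)`; the first constant bounds
  -- the speed of the lift.
  obtain ⟨K, hK, hKb⟩ := hN.exists_velocity_lipschitz (exp (-ad G v) w)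
    (C * N ⟨w, hsp hw⟩) (R + (R + 1))
  refine ⟨K, hK, fun t ht z hz hzt => ?_⟩
  have hRt := hR t ht
  obtain ⟨e, he⟩ := hN.exists_equiv hs hsp (ad_ad_mem_of_triple h) hz
  let y : s := ⟨_, proj_exp_exp_mem hs hsp h hv hz hw⟩
  have hx : sinhc (ad G (z : E)) (e.symm y) = y := by
    refine (he _).symm.trans ?_
    rw [e.apply_symm_apply]
  refine ⟨⟨e.symm y, hsp (e.symm y).2⟩, (e.symm y).2, hKb _ _ _ _ ?_ ?_ ?_ (hdY t)
    (Subtype.ext hx)⟩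
  · linarith [norm_nonneg (β t)]
  · have h1 : ‖z‖ ≤ ‖β t‖ + ‖β t - z‖ := by
      simpa using norm_sub_le (β t) (β t - z)
    linarith
  · exact (hCN _).trans (by gcongr; exact hdN t)

end Characterization

end Involution

end SymmetricLie

end

/-! ### Translation between the model space and the Lie algebra, and the main theorem. -/

noncomputable section

namespace SymmetricLie

open Filter Topology OpSeries
open NormedSpace (exp)

section Transfer

variable {E : Type*} [NormedAddCommGroup E] [NormedSpace ℝ E]
  {G : Type*} [TopologicalSpace G] [ChartedSpace E G] [Group G]
  [LieGroup 𝓘(ℝ, E) ∞ G] [CompleteSpace E]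

theorem bracket_bracket_eq_ad (v w u : GroupLieAlgebra 𝓘(ℝ, E) G) :
    ⁅⁅v, w⁆, u⁆ = ad (E := E) G (ad (E := E) G v w) u :=
  (bracket_eq_ad _ u).trans (congrArg (fun x : E => ad G x u) (bracket_eq_ad v w))

theorem bracket_bracket_eq_ad' (v w u : GroupLieAlgebra 𝓘(ℝ, E) G) :
    ⁅v, ⁅w, u⁆⁆ = ad (E := E) G v (ad (E := E) G w u) :=
  (bracket_eq_ad v _).trans (congrArg (fun x : E => ad (E := E) G v x) (bracket_eq_ad w u))

theorem sinhAdDivAd_eq (v w : GroupLieAlgebra 𝓘(ℝ, E) G) :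
    sinhAdDivAd v w = sinhc (ad (E := E) G v) w := by
  have h1 := (expBounded_sinhc.hasSum_apply (ad (E := E) G v * ad (E := E) G v) w).tsum_eq
  refine Eq.trans ?_ h1
  refine tsum_congr fun n => ?_
  congr 1
  have h2 : (fun x : GroupLieAlgebra 𝓘(ℝ, E) G => ⁅v, x⁆) = ad (E := E) G v := by
    ext x
    exact bracket_eq_ad v x
  rw [h2, ← pow_two, ← pow_mul]
  clear h1
  generalize 2 * n = m
  induction m generalizing w with
  | zero => rfl
  | succ m ih => exact (Function.iterate_succ_apply (f := ad (E := E) G v) m w).trans (ih _)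

namespace Involution

/-- The curvature condition at the base point `g = 1` suffices. The norm bounds express that `N`
induces the topology of `𝔭`. -/
theorem isExpanding_of_semiNegativeCurvature [IsTopologicalGroup G] [T2Space G]
    {σ : Involution E G} {N : Seminorm ℝ σ.p}
    (hN : σ.IsInvariantNorm N) (hcurv : σ.SemiNegativeCurvature N) :
    σ.IsExpanding N := by
  have hdiff : ∀ v w : σ.pE, (show σ.pE from σ.expDifferential 1 v w) = σ.sinhcP v w :=
    fun v w => σ.expDifferential_eq 1 v w
  have hcomp : WithSeminorms fun _ : Unit => (show Seminorm ℝ σ.pE from N) := hN.compatible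
  refine ⟨fun a => ?_, fun a w => ?_, fun k hk v w h => hN.invariant k hk v w h, ?_, ?_⟩
  · obtain ⟨e, he⟩ := (hcurv 1 a).1
    refine ⟨(show σ.pE ≃L[ℝ] σ.pE from e), ?_⟩
    ext1 w
    exact (he w).trans (hdiff a w)
  · rw [← hdiff]
    exact (hcurv 1 a).2 w
  · obtain ⟨s, C, -, h⟩ := Seminorm.bound_of_continuous hcomp (normSeminorm ℝ σ.pE) continuous_norm
    refine ⟨C, C.2, fun v => (h v).trans ?_⟩
    change (C : ℝ) * _ ≤ _
    gcongr
    exact (Finset.sup_le (fun _ _ => le_rfl) :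
      s.sup (fun _ : Unit => (show Seminorm ℝ σ.pE from N)) ≤ _) v
  · obtain ⟨C, hC, h⟩ := Seminorm.bound_of_continuous_normedSpace (show Seminorm ℝ σ.pE from N)
      (hcomp.continuous_seminorm ())
    exact ⟨C, hC.le, h⟩

end Involution

end Transfer

end SymmetricLie

end

theorem mainTheorem7
    {E : Type*} [NormedAddCommGroup E] [NormedSpace ℝ E] [CompleteSpace E]
    {G : Type*} [TopologicalSpace G] [T2Space G] [ChartedSpace E G] [Group G]
    [LieGroup 𝓘(ℝ, E) ∞ G]
    (σ : SymmetricLie.Involution E G)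
    (hconn : ConnectedSpace (G ⧸ σ.K))
    (N : Seminorm ℝ σ.p) (hN : σ.IsInvariantNorm N) (hcurv : σ.SemiNegativeCurvature N)
    (s : Submodule ℝ (GroupLieAlgebra 𝓘(ℝ, E) G)) (hsp : s ≤ σ.p)
    (hs : IsClosed (s : Set (GroupLieAlgebra 𝓘(ℝ, E) G))) :
    List.TFAE [
      ∀ v ∈ s, ∀ w ∈ s, ∀ u ∈ s, ⁅⁅v, w⁆, u⁆ ∈ s,
      ∀ u ∈ s, ∀ w ∈ s, ⁅u, ⁅u, w⁆⁆ ∈ s,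
      ∀ v ∈ s, ∃ e : s ≃L[ℝ] s, ∀ w : s,
        (e w : GroupLieAlgebra 𝓘(ℝ, E) G) = SymmetricLie.sinhAdDivAd v w,
      ∀ v ∈ s, ∀ w ∈ s, ∀ β : ℝ → σ.p, Continuous β →
        (∀ t : ℝ, (QuotientGroup.mk
            (SymmetricLie.lieExp (β t : GroupLieAlgebra 𝓘(ℝ, E) G)) : G ⧸ σ.K) =
          QuotientGroup.mk (SymmetricLie.lieExp v * SymmetricLie.lieExp (t • w))) →
        (β 0 : GroupLieAlgebra 𝓘(ℝ, E) G) ∈ s →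
        ∀ t : ℝ, (β t : GroupLieAlgebra 𝓘(ℝ, E) G) ∈ s] := by
  have : IsTopologicalGroup G := topologicalGroup_of_lieGroup 𝓘(ℝ, E) ∞
  have hexp := SymmetricLie.Involution.isExpanding_of_semiNegativeCurvature hN hcurv
  let s' : Submodule ℝ E := s
  have hsp' : s' ≤ σ.pE := hsp
  have hs' : IsClosed (s' : Set E) := hs
  have hlift : ∀ v ∈ s', ∀ w ∈ s', ∀ β : ℝ → σ.pE,
      (∀ t : ℝ, (QuotientGroup.mk (SymmetricLie.ex (β t : E)) : G ⧸ σ.K) =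
        QuotientGroup.mk (SymmetricLie.ex v * SymmetricLie.ex (t • w))) ↔
      ∀ t, SymmetricLie.ex ((2 : ℝ) • β t : E) = SymmetricLie.Involution.geodesic G v w t :=
    fun v hv w hw β => forall_congr' fun t =>
      σ.mk_ex_eq_mk_iff (β t).2 (hsp' hv) (σ.pE.smul_mem t (hsp' hw))
  have h12 : (∀ v ∈ s, ∀ w ∈ s, ∀ u ∈ s, ⁅⁅v, w⁆, u⁆ ∈ s) ↔
      ∀ v ∈ s', ∀ w ∈ s', ∀ u ∈ s', SymmetricLie.ad G (SymmetricLie.ad G v w) u ∈ s' := by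
    exact forall₂_congr fun v _ => forall₂_congr fun w _ => forall₂_congr fun u _ =>
      Iff.of_eq (congrArg (· ∈ s) (SymmetricLie.bracket_bracket_eq_ad v w u))
  have h22 : (∀ u ∈ s, ∀ w ∈ s, ⁅u, ⁅u, w⁆⁆ ∈ s) ↔
      ∀ u ∈ s', ∀ w ∈ s', SymmetricLie.ad G u (SymmetricLie.ad G u w) ∈ s' := by
    exact forall₂_congr fun u _ => forall₂_congr fun w _ =>
      Iff.of_eq (congrArg (· ∈ s) (SymmetricLie.bracket_bracket_eq_ad' u u w))
  have h32 : (∀ v ∈ s, ∃ e : s ≃L[ℝ] s, ∀ w : s,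
        (e w : GroupLieAlgebra 𝓘(ℝ, E) G) = SymmetricLie.sinhAdDivAd v w) ↔
      ∀ v ∈ s', ∃ e : s' ≃L[ℝ] s', ∀ w : s',
        (e w : E) = OpSeries.sinhc (SymmetricLie.ad G v) w := by
    simp only [SymmetricLie.sinhAdDivAd_eq]
    rfl
  rw [h12, h22, h32]
  tfae_have 1 → 2 := SymmetricLie.ad_ad_mem_of_triple
  tfae_have 2 → 1 := SymmetricLie.triple_of_ad_ad_mem
  tfae_have 2 → 3 := fun h v hv => hexp.exists_equiv hs' hsp' h hv
  tfae_have 3 → 2 := fun h => hexp.ad_ad_mem hs' hsp' fun v hv w hw => by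
    obtain ⟨e, he⟩ := h v hv
    exact ⟨e.symm ⟨w, hw⟩, (e.symm ⟨w, hw⟩).2, by rw [← he, e.apply_symm_apply]⟩
  tfae_have 1 → 4 := fun h v hv w hw β hβ hβγ h0 t =>
    hexp.lift_mem hs' hsp' h hv hw hβ ((hlift v hv w hw β).1 hβγ) h0 t
  tfae_have 4 → 2 := fun h => hexp.ad_ad_mem hs' hsp' <|
    hexp.exists_sinhc_eq_of_lift hs' hsp' fun v hv w hw β hβ hβγ h0 t =>
      h v hv w hw β hβ ((hlift v hv w hw β).2 hβγ) h0 t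
  tfae_finish
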